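/- **Language.** Ground types are $A,B ::= \mathtt I \mid A\oplus B\mid A\otimes B\mid \mathtt{Nat}$. Fix a countably infinite set of variables $x$. Basis values are $b ::= * \mid x \mid \mathtt{inl}\,b\mid \mathtt{inr}\,b\mid b\otimes b\mid \mathtt{zero}\mid \mathtt S\,b$. Expressions $e$ have the same constructors and, in addition, finite formal linear combinations $\Sigma_{i\in I}(\alpha_i\cdot e_i)$ with $\alpha_i\in\mathbb C$; a value is a combination $\Sigma_i(\alpha_i\cdot b_i)$ of basis values. Unitaries are $\omega ::= \{b_1\leftrightarrow e_1\mid\dots\mid b_n\leftrightarrow e_n\}\mid \omega\otimes\omega\mid\omega\oplus\omega\mid\omega\circ\omega\mid\omega^{-1}\mid\mathtt{ctrl}\,\omega$. Terms $t$ have the constructors of expressions and, in addition, applications $\omega\,t$. **Orthogonality** $\bot$ is the least symmetric relation on terms such that: $\mathtt{inl}\,t_1\bot\mathtt{inr}\,t_2$; $\mathtt{zero}\bot\mathtt S\,t$; if $t_1\bot t_2$ then $\mathtt S\,t_1\bot\mathtt S\,t_2$, $\mathtt{inl}\,t_1\bot\mathtt{inl}\,t_2$, $\mathtt{inr}\,t_1\bot\mathtt{inr}\,t_2$,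 $\omega\,t_1\bot\omega\,t_2$, $t\otimes t_1\bot t'\otimes t_2$ and $t_1\otimes t\bot t_2\otimes t'$; if $t\bot t_i$ for all $i\in I$ then $t\bot\Sigma_{i\in I}(\alpha_i\cdot t_i)$; if $t_k=t$, $\alpha_k=0$ and $t\bot t_i$ for all $i\ne k$ in $I$, then $t\bot\Sigma_{i\in I}(\alpha_i\cdot t_i)$; and if $(t_i)_{i\in I}$ are pairwise orthogonal, $J,K\subseteq I$ and $\sum_{i\in J\cap K}\overline{\alpha_i}\beta_i=0$, then $\Sigma_{j\in J}(\alpha_j\cdot t_j)\bot\Sigma_{k\in K}(\beta_k\cdot t_k)$. **Orthogonal decompositions.** $\mathrm{OD}_A(S)$, for finite sets $S$ of basis values, is generated by: $\mathrm{OD}_A\{x\}$; $\mathrm{OD}_{\mathtt I}\{*\}$; if $\mathrm{OD}_A S$ and $\mathrm{OD}_B T$ then $\mathrm{OD}_{A\oplus B}(\mathtt{inl}\,S\cup\mathtt{inr}\,T)$; if $\mathrm{OD}_{\mathtt{Nat}}S$ then $\mathrm{OD}_{\mathtt{Nat}}(\{\mathtt{zero}\}\cup\mathtt S\,S)$; and,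 for a set $S$ of pairs, $\mathrm{OD}_{A\otimes B}S$ if $\mathrm{OD}_A(\pi_1 S)$ and $\mathrm{OD}_B\{b'\mid b\otimes b'\in S\}$ for every $b\in\pi_1S$, or symmetrically with the two components exchanged. $\mathrm{OD}^e_A(S)$, for finite sets of expressions, is generated by the same rules together with: if $\mathrm{OD}^e_A S$ and $(\alpha_{e,e'})_{e,e'\in S}$ is a unitary matrix, then $\mathrm{OD}^e_A\{\Sigma_{e'\in S}(\alpha_{e,e'}\cdot e')\mid e\in S\}$. **Typing.** A context $\Delta$ is a finite set of typed, pairwise distinct variables, and $\Delta_1,\Delta_2$ denotes a disjoint union. Typing is strictly linear: $\vdash *:\mathtt I$; $x:A\vdash x:A$; $\vdash\mathtt{zero}:\mathtt{Nat}$; $\mathtt{inl},\mathtt{inr},\mathtt S$ are typed as usual; $\Delta_1,\Delta_2\vdash t_1\otimes t_2:A\otimes B$ if $\Delta_1\vdash t_1:A$ and $\Delta_2\vdash t_2:B$; $\Delta\vdash\Sigma_i(\alpha_i\cdot t_i):A$ if $\Delta\vdash t_i:A$ for all $i$, $\sum_i|\alpha_i|^2=1$ and $t_i\bot t_j$ for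 $i\ne j$; $\Delta\vdash\omega\,t:B$ if $\vdash\omega:A\leftrightarrow B$ and $\Delta\vdash t:A$. For unitaries, $\vdash\{b_i\leftrightarrow e_i\}_{i\le n}:A\leftrightarrow B$ if the $b_i$ are pairwise distinct, the $e_i$ are pairwise distinct, $\mathrm{OD}_A\{b_1,\dots,b_n\}$, $\mathrm{OD}^e_B\{e_1,\dots,e_n\}$, and for each $i$ there is $\Delta_i$ with $\Delta_i\vdash b_i:A$ and $\Delta_i\vdash e_i:B$; the operations $\omega_1\otimes\omega_2$, $\omega_1\oplus\omega_2$, $\omega_2\circ\omega_1$, $\omega^{-1}$ are typed as usual; and $\mathtt{ctrl}\,\omega:(\mathtt I\oplus\mathtt I)\otimes A\leftrightarrow(\mathtt I\oplus\mathtt I)\otimes A$ if $\omega:A\leftrightarrow A$. **Equational theory.** $\Delta\vdash t_1=t_2:A$ is the least family of relations closed under the following rules. * Reflexivity on well-typed terms, symmetry, transitivity. * For well-typed left-hand sides: $\Sigma_i(\alpha_i\cdot t_i)=\Sigma_i(\alpha_{\ell(i)}\cdot t_{\ell(i)})$ for a permutation $\ell$; $\Sigma_{i\le n}(\alpha_i\cdot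 t_i)=\Sigma_{i<n}(\alpha_i\cdot t_i)$ if $\alpha_n=0$; $\Sigma_i(\alpha_i\cdot\Sigma_j(\beta_{ij}\cdot t_j))=\Sigma_j\big((\sum_i\alpha_i\beta_{ij})\cdot t_j\big)$. * $1\cdot t=t$ for well-typed $t$; $\Sigma_i(\alpha_i\cdot\Sigma_j(\beta_{ij}\cdot t_{ij}))=\Sigma_{ij}(\alpha_i\beta_{ij}\cdot t_{ij})$ if the right-hand side is well typed. * Linearity of $\omega$, $\mathtt{inl}$, $\mathtt{inr}$, $\mathtt S$ and of $\otimes$ in each argument over a well-typed combination. * Congruence for $\mathtt{inl}$, $\mathtt{inr}$, $\mathtt S$, $\omega$ and each argument of $\otimes$, and $\Sigma_i(\alpha_i\cdot t_i)=\Sigma_i(\alpha_i\cdot t_i')$ if the left-hand side is well typed and $t_i=t_i'$ for all $i$. * For well-typed unitaries and well-typed basis values (closed, except in the rule for $\circ$, which is allowed in any context): $\{b_i\leftrightarrow e_i\}_i\,b'=\sigma(e_i)$ if $b'$ matches the pattern $b_i$ with least substitution $\sigma$ (so $\sigma(b_i)=b'$); $\omega^{-1}v=b$ if $\omega\,b=v$,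 for $v$ a value; $(\omega_2\circ\omega_1)\,b=\omega_2(\omega_1\,b)$; $(\omega_1\otimes\omega_2)(b_1\otimes b_2)=(\omega_1b_1)\otimes(\omega_2b_2)$; $(\omega_1\oplus\omega_2)(\mathtt{inl}\,b)=\mathtt{inl}(\omega_1b)$ and $(\omega_1\oplus\omega_2)(\mathtt{inr}\,b)=\mathtt{inr}(\omega_2b)$; $(\mathtt{ctrl}\,\omega)((\mathtt{inl}\,*)\otimes b)=(\mathtt{inl}\,*)\otimes b$ and $(\mathtt{ctrl}\,\omega)((\mathtt{inr}\,*)\otimes b)=(\mathtt{inr}\,*)\otimes(\omega\,b)$. **Semantics.** $[\![\mathtt I]\!]=\mathbb C$, $[\![A\oplus B]\!]=[\![A]\!]\oplus[\![B]\!]$, $[\![A\otimes B]\!]=[\![A]\!]\otimes[\![B]\!]$ (Hilbert tensor product), $[\![\mathtt{Nat}]\!]=\ell^2(\mathbb N)$, and a context is interpreted by the Hilbert tensor product of its types ($\mathbb C$ if it is empty). A derivation of $\Delta\vdash t:A$ is interpreted by a bounded linear map $[\![\Delta]\!]\to[\![A]\!]$, up to the canonical permutations of tensor factors: $[\![*]\!]=\mathrm{id}$,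 $[\![x]\!]=\mathrm{id}$, $[\![\mathtt{inl}\,t]\!]=\iota_l\circ[\![t]\!]$, $[\![\mathtt{inr}\,t]\!]=\iota_r\circ[\![t]\!]$, $[\![t\otimes t']\!]=[\![t]\!]\otimes[\![t']\!]$, $[\![\mathtt{zero}]\!]=|0\rangle$, $[\![\mathtt S\,t]\!]=\mathrm{succ}\circ[\![t]\!]$ with $\mathrm{succ}|n\rangle=|n+1\rangle$, $[\![\Sigma_i(\alpha_i\cdot t_i)]\!]=\sum_i\alpha_i[\![t_i]\!]$, $[\![\omega\,t]\!]=[\![\omega]\!]\circ[\![t]\!]$; where $[\![\{b_i\leftrightarrow e_i\}_i]\!]=\sum_i[\![e_i]\!]\circ[\![b_i]\!]^\dagger$, $[\![\omega_2\circ\omega_1]\!]=[\![\omega_2]\!]\circ[\![\omega_1]\!]$, $[\![\omega_1\otimes\omega_2]\!]=[\![\omega_1]\!]\otimes[\![\omega_2]\!]$, $[\![\omega_1\oplus\omega_2]\!]=[\![\omega_1]\!]\oplus[\![\omega_2]\!]$, $[\![\omega^{-1}]\!]=[\![\omega]\!]^\dagger$ and $[\![\mathtt{ctrl}\,\omega]\!]=|0\rangle\langle0|\otimes\mathrm{id}+|1\rangle\langle1|\otimes[\![\omega]\!]$.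 **Theorem (Completeness).** Let $\vdash t_1:A$ and $\vdash t_2:A$ be closed well-typed terms. Then $[\![\vdash t_1:A]\!]$ and $[\![\vdash t_2:A]\!]$ are isometries $\mathbb C\to[\![A]\!]$, for any choice of typing derivations, and $$\vdash t_1=t_2:A\quad\text{in the equational theory}\iff[\![\vdash t_1:A]\!]=[\![\vdash t_2:A]\!].$$ -/

import Mathlib

open scoped TensorProduct
open UniformSpace (Completion)

noncomputable section

/-! ## Hilbert spaces and their operations -/

/-- Complex Hilbert spaces, bundled. -/
structure Hilb : Type 1 where
  carrier : Type
  [normedAddCommGroup : NormedAddCommGroup carrier]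
  [innerProductSpace : InnerProductSpace ℂ carrier]
  [completeSpace : CompleteSpace carrier]

namespace Hilb

instance : CoeSort Hilb (Type) := ⟨Hilb.carrier⟩

attribute [instance] Hilb.normedAddCommGroup Hilb.innerProductSpace Hilb.completeSpace

/-- The one-dimensional Hilbert space `ℂ`. -/
def one : Hilb := ⟨ℂ⟩

/-- The Hilbert direct sum `X ⊕ Y`. -/
def oplus (X Y : Hilb) : Hilb := ⟨WithLp 2 (X × Y)⟩

/-- The Hilbert tensor product: the completion of the algebraic tensor product for
`⟪x₁ ⊗ y₁, x₂ ⊗ y₂⟫ = ⟪x₁, x₂⟫ ⟪y₁, y₂⟫`. -/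
def tensor (X Y : Hilb) : Hilb := ⟨Completion (X ⊗[ℂ] Y)⟩

/-- The Hilbert space `ℓ²(ℕ)`. -/
def ell2 : Hilb := ⟨lp (fun _ : ℕ => ℂ) 2⟩

/-- The left injection `x ↦ (x, 0)`. -/
def inl (X Y : Hilb) : X →L[ℂ] oplus X Y :=
  ((WithLp.prodContinuousLinearEquiv 2 ℂ X Y).symm : X × Y →L[ℂ] WithLp 2 (X × Y)) ∘L
    ContinuousLinearMap.inl ℂ X Y

/-- The right injection `y ↦ (0, y)`. -/
def inr (X Y : Hilb) : Y →L[ℂ] oplus X Y :=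
  ((WithLp.prodContinuousLinearEquiv 2 ℂ X Y).symm : X × Y →L[ℂ] WithLp 2 (X × Y)) ∘L
    ContinuousLinearMap.inr ℂ X Y

/-- `f ⊕ g`. -/
def oplusMap {X X' Y Y' : Hilb} (f : X →L[ℂ] Y) (g : X' →L[ℂ] Y') :
    oplus X X' →L[ℂ] oplus Y Y' :=
  ((WithLp.prodContinuousLinearEquiv 2 ℂ Y Y').symm : Y × Y' →L[ℂ] WithLp 2 (Y × Y')) ∘L
    f.prodMap g ∘L
      (WithLp.prodContinuousLinearEquiv 2 ℂ X X' : WithLp 2 (X × X') →L[ℂ] X × X')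

/-- `f ⊗ g`, the continuous extension of the algebraic tensor product of `f` and `g`. -/
def tensorMap {X X' Y Y' : Hilb} (f : X →L[ℂ] Y) (g : X' →L[ℂ] Y') :
    tensor X X' →L[ℂ] tensor Y Y' :=
  (TensorProduct.mapL f g).completion

/-- The pure tensor `x ⊗ y`. -/
def tmul {X Y : Hilb} (x : X) (y : Y) : tensor X Y := ((x ⊗ₜ[ℂ] y : X ⊗[ℂ] Y) : Completion _)

/-- The right unitor `X ⊗ ℂ → X`. -/
def rightUnitor (X : Hilb) : tensor X one →L[ℂ] X :=
  ((TensorProduct.ridIsometry ℂ X : X ⊗[ℂ] ℂ ≃ₗᵢ[ℂ] X) :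
    X ⊗[ℂ] ℂ →L[ℂ] X).fromCompletion

/-- The isomorphism `ℂ → ℂ ⊗ ℂ`, `1 ↦ 1 ⊗ 1`. -/
def unitSplit : one →L[ℂ] tensor one one :=
  ContinuousLinearMap.toSpanSingleton ℂ (tmul (X := one) (Y := one) (1 : ℂ) (1 : ℂ))

/-- The symmetry `X ⊗ Y → Y ⊗ X`. -/
def braid (X Y : Hilb) : tensor X Y →L[ℂ] tensor Y X :=
  ((TensorProduct.commIsometry ℂ X Y : X ⊗[ℂ] Y ≃ₗᵢ[ℂ] Y ⊗[ℂ] X) :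
    X ⊗[ℂ] Y →L[ℂ] Y ⊗[ℂ] X).completion

theorem denseRange_map_of_denseRange {E F G H : Type*}
    [NormedAddCommGroup E] [InnerProductSpace ℂ E] [NormedAddCommGroup F] [InnerProductSpace ℂ F]
    [NormedAddCommGroup G] [InnerProductSpace ℂ G] [NormedAddCommGroup H] [InnerProductSpace ℂ H]
    (f : E →ₗᵢ[ℂ] G) (g : F →ₗᵢ[ℂ] H) (hf : DenseRange f) (hg : DenseRange g) :
    DenseRange (TensorProduct.mapIsometry f g) := by
  have key : ∀ z, z ∈ (LinearMap.range
      (TensorProduct.mapIsometry f g).toLinearMap).topologicalClosure := by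
    intro z
    induction z with
    | zero => exact Submodule.zero_mem _
    | add x y hx hy => exact Submodule.add_mem _ hx hy
    | tmul x y =>
      have hc : Continuous fun p : G × H => p.1 ⊗ₜ[ℂ] p.2 := by
        have : (fun p : G × H => p.1 ⊗ₜ[ℂ] p.2) =
            fun p : G × H => (LinearMap.mkContinuous₂ (TensorProduct.mk ℂ G H) 1
              (fun x y => by simp)) p.1 p.2 := rfl
        rw [this]
        fun_prop
      refine (hf.prodMap hg).induction_on
        (p := fun q : G × H => q.1 ⊗ₜ[ℂ] q.2 ∈ (LinearMap.range
          (TensorProduct.mapIsometry f g).toLinearMap).topologicalClosure) (x, y) ?_ ?_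
      · exact (Submodule.isClosed_topologicalClosure _).preimage hc
      · rintro ⟨a, b⟩
        exact Submodule.le_topologicalClosure _ ⟨a ⊗ₜ[ℂ] b, by simp⟩
  intro z
  have := key z
  rw [← SetLike.mem_coe, Submodule.topologicalClosure_coe] at this
  exact this

/-- The algebraic tensor product inside the Hilbert tensor product. -/
def embed (X Y : Hilb) : (X : Type) ⊗[ℂ] Y →ₗᵢ[ℂ] tensor X Y := Completion.toComplₗᵢ

theorem denseRange_embed (X Y : Hilb) : DenseRange (embed X Y) :=
  Completion.denseRange_coe (α := X ⊗[ℂ] Y)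

/-- The algebraic `(X ⊗ Y) ⊗ Z` inside the Hilbert space `(X ⊗ Y) ⊗ Z`. -/
def assocDom (X Y Z : Hilb) : ((X : Type) ⊗[ℂ] Y) ⊗[ℂ] Z →ₗᵢ[ℂ] tensor (tensor X Y) Z :=
  (embed (tensor X Y) Z).comp (TensorProduct.mapIsometry (embed X Y) LinearIsometry.id)

/-- The algebraic `X ⊗ (Y ⊗ Z)` inside the Hilbert space `X ⊗ (Y ⊗ Z)`. -/
def assocCod (X Y Z : Hilb) : (X : Type) ⊗[ℂ] ((Y : Type) ⊗[ℂ] Z) →ₗᵢ[ℂ] tensor X (tensor Y Z) :=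
  (embed X (tensor Y Z)).comp (TensorProduct.mapIsometry LinearIsometry.id (embed Y Z))

theorem denseRange_assocDom (X Y Z : Hilb) : DenseRange (assocDom X Y Z) :=
  (denseRange_embed (tensor X Y) Z).comp
    (denseRange_map_of_denseRange (embed X Y) (LinearIsometry.id (E := Z)) (denseRange_embed X Y)
      Function.surjective_id.denseRange) (embed (tensor X Y) Z).continuous

theorem denseRange_assocCod (X Y Z : Hilb) : DenseRange (assocCod X Y Z) :=
  (denseRange_embed X (tensor Y Z)).comp
    (denseRange_map_of_denseRange (LinearIsometry.id (E := X)) (embed Y Z)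
      Function.surjective_id.denseRange (denseRange_embed Y Z)) (embed X (tensor Y Z)).continuous

/-- The associator `(X ⊗ Y) ⊗ Z ≃ X ⊗ (Y ⊗ Z)`, the unitary extending the algebraic one. -/
def assoc (X Y Z : Hilb) : tensor (tensor X Y) Z ≃ₗᵢ[ℂ] tensor X (tensor Y Z) :=
  (TensorProduct.assoc ℂ X Y Z).extendOfIsometry (assocDom X Y Z).toLinearMap
    (assocCod X Y Z).toLinearMap (denseRange_assocDom X Y Z) (denseRange_assocCod X Y Z)
    (fun x => ((assocCod X Y Z).norm_map _).trans
      (((TensorProduct.assocIsometry ℂ X Y Z).norm_map x).trans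
        ((assocDom X Y Z).norm_map x).symm))

/-- The associator as a bounded linear map. -/
def assocHom (X Y Z : Hilb) : tensor (tensor X Y) Z →L[ℂ] tensor X (tensor Y Z) :=
  ((assoc X Y Z).toContinuousLinearEquiv : _ →L[ℂ] _)

/-- The inverse of the associator as a bounded linear map. -/
def assocInv (X Y Z : Hilb) : tensor X (tensor Y Z) →L[ℂ] tensor (tensor X Y) Z :=
  ((assoc X Y Z).symm.toContinuousLinearEquiv : _ →L[ℂ] _)

/-- The adjoint `f†`. -/
def dagger {X Y : Hilb} (f : X →L[ℂ] Y) : Y →L[ℂ] X := ContinuousLinearMap.adjoint f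

/-- The canonical basis vector `|n⟩` of `ℓ²(ℕ)`. -/
def ket (n : ℕ) : lp (fun _ : ℕ => ℂ) 2 := lp.single 2 n (1 : ℂ)

theorem orthonormal_ket_succ : Orthonormal ℂ (fun n : ℕ => ket (n + 1)) := by
  rw [orthonormal_iff_ite]
  intro i j
  simp only [ket]
  rw [lp.inner_single_left, lp.single_apply, Pi.single_apply]
  simp

/-- `|0⟩` as a map `ℂ → ℓ²(ℕ)`. -/
def ketZero : one →L[ℂ] ell2 := ContinuousLinearMap.toSpanSingleton ℂ (ket 0)

/-- The isometry of `ℓ²(ℕ)` that maps `|n⟩` to `|n + 1⟩`. -/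
def succIsometry : lp (fun _ : ℕ => ℂ) 2 →ₗᵢ[ℂ] lp (fun _ : ℕ => ℂ) 2 :=
  orthonormal_ket_succ.orthogonalFamily.linearIsometry

/-- `succIsometry` as a bounded linear map. -/
def succMap : ell2 →L[ℂ] ell2 := succIsometry.toContinuousLinearMap

/-- The controlled map `|0⟩⟨0| ⊗ id + |1⟩⟨1| ⊗ f`. -/
def ctrlMap {X : Hilb} (f : X →L[ℂ] X) :
    tensor (oplus one one) X →L[ℂ] tensor (oplus one one) X :=
  tensorMap (inl one one ∘L dagger (inl one one)) (ContinuousLinearMap.id ℂ X) +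
    tensorMap (inr one one ∘L dagger (inr one one)) f

end Hilb

namespace QControl

/-! ## Syntax -/

/-- Ground types. -/
inductive Ty : Type
  | unit : Ty
  | oplus : Ty → Ty → Ty
  | tensor : Ty → Ty → Ty
  | nat : Ty

/-- Variables. -/
abbrev Var : Type := ℕ

/-- Basis values. -/
inductive Basis : Type
  | unit : Basis
  | var : Var → Basis
  | inl : Basis → Basis
  | inr : Basis → Basis
  | pair : Basis → Basis → Basis
  | zero : Basis
  | succ : Basis → Basis

/-- Terms whose unitaries are drawn from `U`; `sum n α t` is the formal linear combination
`Σ_{i < n} (α i · t i)`. -/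
inductive Tm (U : Type) : Type
  | unit : Tm U
  | var : Var → Tm U
  | inl : Tm U → Tm U
  | inr : Tm U → Tm U
  | pair : Tm U → Tm U → Tm U
  | zero : Tm U
  | succ : Tm U → Tm U
  | app : U → Tm U → Tm U
  | sum : (n : ℕ) → (Fin n → ℂ) → (Fin n → Tm U) → Tm U

/-- Expressions are the terms without application of a unitary. -/
abbrev Expr : Type := Tm Empty

/-- Unitaries; `abs n b e` is the unitary abstraction `{b₁ ↔ e₁ | … | bₙ ↔ eₙ}`. -/
inductive Unitary : Type
  | abs : (n : ℕ) → (Fin n → Basis) → (Fin n → Expr) → Unitary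
  | tensor : Unitary → Unitary → Unitary
  | oplus : Unitary → Unitary → Unitary
  | comp : Unitary → Unitary → Unitary
  | inv : Unitary → Unitary
  | ctrl : Unitary → Unitary

/-- Terms. -/
abbrev Term : Type := Tm Unitary

/-- Basis values are terms (and expressions). -/
def Basis.toTm {U : Type} : Basis → Tm U
  | .unit => .unit
  | .var x => .var x
  | .inl b => .inl b.toTm
  | .inr b => .inr b.toTm
  | .pair b b' => .pair b.toTm b'.toTm
  | .zero => .zero
  | .succ b => .succ b.toTm

/-- Expressions are terms. -/
def Expr.toTerm : Expr → Term
  | .unit => .unit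
  | .var x => .var x
  | .inl e => .inl (Expr.toTerm e)
  | .inr e => .inr (Expr.toTerm e)
  | .pair e e' => .pair (Expr.toTerm e) (Expr.toTerm e')
  | .zero => .zero
  | .succ e => .succ (Expr.toTerm e)
  | .app u _ => u.elim
  | .sum n α e => .sum n α (fun i => Expr.toTerm (e i))

/-! ## Orthogonality and orthogonal decompositions -/

/-- The orthogonality relation on terms. In `sum_sum`, the index sets `J, K ⊆ I` are given by
injections into `I = Fin N`, and the scalar condition is `∑_{i ∈ J ∩ K} conj (α_i) β_i = 0`. -/
inductive Orth {U : Type} : Tm U → Tm U → Prop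
  | symm {t₁ t₂} : Orth t₁ t₂ → Orth t₂ t₁
  | inl_inr (t₁ t₂) : Orth (.inl t₁) (.inr t₂)
  | zero_succ (t) : Orth .zero (.succ t)
  | succ {t₁ t₂} : Orth t₁ t₂ → Orth (.succ t₁) (.succ t₂)
  | pair_right {t₁ t₂} (t t') : Orth t₁ t₂ → Orth (.pair t t₁) (.pair t' t₂)
  | pair_left {t₁ t₂} (t t') : Orth t₁ t₂ → Orth (.pair t₁ t) (.pair t₂ t')
  | inl {t₁ t₂} : Orth t₁ t₂ → Orth (.inl t₁) (.inl t₂)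
  | inr {t₁ t₂} : Orth t₁ t₂ → Orth (.inr t₁) (.inr t₂)
  | app (ω : U) {t₁ t₂} : Orth t₁ t₂ → Orth (.app ω t₁) (.app ω t₂)
  | sum_right {t} (n : ℕ) (α : Fin n → ℂ) (s : Fin n → Tm U) :
      (∀ i, Orth t (s i)) → Orth t (.sum n α s)
  | sum_self (n : ℕ) (α : Fin n → ℂ) (s : Fin n → Tm U) (k : Fin n) :
      (∀ i, i ≠ k → Orth (s k) (s i)) → α k = 0 → Orth (s k) (.sum n α s)
  | sum_sum (N : ℕ) (t : Fin N → Tm U) (p q : ℕ) (J : Fin p → Fin N) (K : Fin q → Fin N)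
      (α : Fin p → ℂ) (β : Fin q → ℂ) :
      Function.Injective J → Function.Injective K →
      (∀ i j, i ≠ j → Orth (t i) (t j)) →
      (∑ a, ∑ b, if J a = K b then (starRingEnd ℂ) (α a) * β b else 0) = 0 →
      Orth (.sum p α (fun a => t (J a))) (.sum q β (fun b => t (K b)))

/-- Orthogonal decompositions `OD_A S` made of basis values. -/
inductive OD : Ty → Set Basis → Prop
  | var (A : Ty) (x : Var) : OD A {.var x}
  | unit : OD .unit {.unit}
  | oplus {A B S T} : OD A S → OD B T → OD (.oplus A B) (Basis.inl '' S ∪ Basis.inr '' T)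
  | nat {S} : OD .nat S → OD .nat ({.zero} ∪ Basis.succ '' S)
  | tensor_right {A B} {S : Set Basis} :
      (∀ b ∈ S, ∃ b₁ b₂, b = .pair b₁ b₂) →
      OD B {b₂ | ∃ b₁, .pair b₁ b₂ ∈ S} →
      (∀ b₂ ∈ {b₂ | ∃ b₁, .pair b₁ b₂ ∈ S}, OD A {b₁ | .pair b₁ b₂ ∈ S}) →
      OD (.tensor A B) S
  | tensor_left {A B} {S : Set Basis} :
      (∀ b ∈ S, ∃ b₁ b₂, b = .pair b₁ b₂) →
      OD A {b₁ | ∃ b₂, .pair b₁ b₂ ∈ S} →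
      (∀ b₁ ∈ {b₁ | ∃ b₂, .pair b₁ b₂ ∈ S}, OD B {b₂ | .pair b₁ b₂ ∈ S}) →
      OD (.tensor A B) S

/-- Orthogonal decompositions `OD^e_A S` made of expressions: closed, in addition, under change of
basis by a unitary matrix indexed by (an enumeration of) `S`. -/
inductive ODe : Ty → Set Expr → Prop
  | var (A : Ty) (x : Var) : ODe A {.var x}
  | unit : ODe .unit {.unit}
  | oplus {A B S T} : ODe A S → ODe B T → ODe (.oplus A B) (Tm.inl '' S ∪ Tm.inr '' T)
  | nat {S} : ODe .nat S → ODe .nat ({.zero} ∪ Tm.succ '' S)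
  | tensor_right {A B} {S : Set Expr} :
      (∀ e ∈ S, ∃ e₁ e₂, e = .pair e₁ e₂) →
      ODe B {e₂ | ∃ e₁, .pair e₁ e₂ ∈ S} →
      (∀ e₂ ∈ {e₂ | ∃ e₁, .pair e₁ e₂ ∈ S}, ODe A {e₁ | .pair e₁ e₂ ∈ S}) →
      ODe (.tensor A B) S
  | tensor_left {A B} {S : Set Expr} :
      (∀ e ∈ S, ∃ e₁ e₂, e = .pair e₁ e₂) →
      ODe A {e₁ | ∃ e₂, .pair e₁ e₂ ∈ S} →
      (∀ e₁ ∈ {e₁ | ∃ e₂, .pair e₁ e₂ ∈ S}, ODe B {e₂ | .pair e₁ e₂ ∈ S}) →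
      ODe (.tensor A B) S
  | change {A} (n : ℕ) (s : Fin n → Expr) (α : Matrix (Fin n) (Fin n) ℂ) :
      Function.Injective s → ODe A (Set.range s) → α ∈ Matrix.unitaryGroup (Fin n) ℂ →
      ODe A (Set.range fun i => .sum n (α i) s)

/-! ## Typing -/

/-- Typing contexts. -/
abbrev Ctx : Type := List (Var × Ty)

/-- The variables of a context are pairwise distinct. -/
def Ctx.Distinct (Δ : Ctx) : Prop := (Δ.map Prod.fst).Nodup

/-- `Split Δ Δ₁ Δ₂` exhibits `Δ` as the union `Δ₁, Δ₂`. -/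
inductive Split : Ctx → Ctx → Ctx → Type
  | nil : Split [] [] []
  | left {Δ Δ₁ Δ₂} (p : Var × Ty) : Split Δ Δ₁ Δ₂ → Split (p :: Δ) (p :: Δ₁) Δ₂
  | right {Δ Δ₁ Δ₂} (p : Var × Ty) : Split Δ Δ₁ Δ₂ → Split (p :: Δ) Δ₁ (p :: Δ₂)

/-- Derivations of `Δ ⊢ t : A`, given the derivations `TU ω A B` of `⊢ ω : A ↔ B`. -/
inductive Der {U : Type} (TU : U → Ty → Ty → Type) : Ctx → Tm U → Ty → Type
  | unit : Der TU [] .unit .unit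
  | var (x : Var) (A : Ty) : Der TU [(x, A)] (.var x) A
  | pair {Δ Δ₁ Δ₂ t₁ t₂ A B} (hΔ : Δ.Distinct) (s : Split Δ Δ₁ Δ₂)
      (d₁ : Der TU Δ₁ t₁ A) (d₂ : Der TU Δ₂ t₂ B) : Der TU Δ (.pair t₁ t₂) (.tensor A B)
  | inl {Δ t A} (B : Ty) (d : Der TU Δ t A) : Der TU Δ (.inl t) (.oplus A B)
  | inr {Δ t B} (A : Ty) (d : Der TU Δ t B) : Der TU Δ (.inr t) (.oplus A B)
  | zero : Der TU [] .zero .nat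
  | succ {Δ t} (d : Der TU Δ t .nat) : Der TU Δ (.succ t) .nat
  | sum {Δ A} {n : ℕ} {α : Fin n → ℂ} {t : Fin n → Tm U} (d : ∀ i, Der TU Δ (t i) A)
      (hα : ∑ i, ‖α i‖ ^ 2 = 1) (ht : ∀ i j, i ≠ j → Orth (t i) (t j)) :
      Der TU Δ (.sum n α t) A
  | app {Δ ω t A B} (u : TU ω A B) (d : Der TU Δ t A) : Der TU Δ (.app ω t) B

/-- Typing derivations of expressions. -/
abbrev ExprDer : Ctx → Expr → Ty → Type := Der (fun (u : Empty) _ _ => u.elim)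

/-- Derivations of `⊢ ω : A ↔ B`. The clauses of an abstraction have pairwise distinct left-hand
sides and pairwise distinct right-hand sides. -/
inductive UDer : Unitary → Ty → Ty → Type
  | abs {A B : Ty} {n : ℕ} {b : Fin n → Basis} {e : Fin n → Expr} (Δ : Fin n → Ctx)
      (db : ∀ i, ExprDer (Δ i) (b i).toTm A) (de : ∀ i, ExprDer (Δ i) (e i) B)
      (hb : Function.Injective b) (he : Function.Injective e)
      (ODb : OD A (Set.range b)) (ODe : ODe B (Set.range e)) : UDer (.abs n b e) A B
  | inv {ω A B} (u : UDer ω A B) : UDer (.inv ω) B A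
  | comp {ω₂ ω₁ A B C} (u₁ : UDer ω₁ A B) (u₂ : UDer ω₂ B C) : UDer (.comp ω₂ ω₁) A C
  | tensor {ω₁ ω₂ A₁ A₂ B₁ B₂} (u₁ : UDer ω₁ A₁ B₁) (u₂ : UDer ω₂ A₂ B₂) :
      UDer (.tensor ω₁ ω₂) (.tensor A₁ A₂) (.tensor B₁ B₂)
  | oplus {ω₁ ω₂ A₁ A₂ B₁ B₂} (u₁ : UDer ω₁ A₁ B₁) (u₂ : UDer ω₂ A₂ B₂) :
      UDer (.oplus ω₁ ω₂) (.oplus A₁ A₂) (.oplus B₁ B₂)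
  | ctrl {ω A} (u : UDer ω A A) :
      UDer (.ctrl ω) (.tensor (.oplus .unit .unit) A) (.tensor (.oplus .unit .unit) A)

/-- Typing derivations `Δ ⊢ t : A` of terms. -/
abbrev TermDer : Ctx → Term → Ty → Type := Der UDer

/-! ## Valuations -/

/-- Valuations: partial maps from variables to expressions. -/
abbrev Valuation : Type := Var → Option Expr

/-- The substitution `σ(e)`. -/
def Expr.subst (σ : Valuation) : Expr → Expr
  | .unit => .unit
  | .var x => (σ x).getD (.var x)
  | .inl e => .inl (Expr.subst σ e)
  | .inr e => .inr (Expr.subst σ e)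
  | .pair e e' => .pair (Expr.subst σ e) (Expr.subst σ e')
  | .zero => .zero
  | .succ e => .succ (Expr.subst σ e)
  | .app u _ => u.elim
  | .sum n α e => .sum n α (fun i => Expr.subst σ (e i))

/-- `Matches σ b b'`: `b'` matches the pattern `b`, with smallest valuation `σ`. -/
inductive Matches : Valuation → Basis → Basis → Prop
  | unit : Matches (fun _ => none) .unit .unit
  | var (x : Var) (b' : Basis) :
      Matches (fun y => if y = x then some b'.toTm else none) (.var x) b'
  | inl {σ b b'} : Matches σ b b' → Matches σ (.inl b) (.inl b')
  | inr {σ b b'} : Matches σ b b' → Matches σ (.inr b) (.inr b')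
  | pair {σ₁ σ₂ : Valuation} {b₁ b₂ b₁' b₂'} : Matches σ₁ b₁ b₁' → Matches σ₂ b₂ b₂' →
      (∀ x, σ₁ x = none ∨ σ₂ x = none) →
      Matches (fun x => (σ₁ x).or (σ₂ x)) (.pair b₁ b₂) (.pair b₁' b₂')
  | zero : Matches (fun _ => none) .zero .zero
  | succ {σ b b'} : Matches σ b b' → Matches σ (.succ b) (.succ b')

/-! ## Equational theory -/

/-- `Eqn Δ t₁ t₂ A` is the judgement `Δ ⊢ t₁ = t₂ : A`. -/
inductive Eqn : Ctx → Term → Term → Ty → Prop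
  -- equivalence
  | refl {Δ t A} : TermDer Δ t A → Eqn Δ t t A
  | symm {Δ t₁ t₂ A} : Eqn Δ t₁ t₂ A → Eqn Δ t₂ t₁ A
  | trans {Δ t₁ t₂ t₃ A} : Eqn Δ t₁ t₂ A → Eqn Δ t₂ t₃ A → Eqn Δ t₁ t₃ A
  -- vector space structure
  | perm {Δ A} {n : ℕ} {α : Fin n → ℂ} {t : Fin n → Term} (l : Equiv.Perm (Fin n)) :
      TermDer Δ (.sum n α t) A →
      Eqn Δ (.sum n α t) (.sum n (fun i => α (l i)) (fun i => t (l i))) A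
  | zero_scal {Δ A} {n : ℕ} {α : Fin (n + 1) → ℂ} {t : Fin (n + 1) → Term} :
      TermDer Δ (.sum (n + 1) α t) A → α (Fin.last n) = 0 →
      Eqn Δ (.sum (n + 1) α t) (.sum n (fun i => α i.castSucc) (fun i => t i.castSucc)) A
  | one_scal {Δ t A} : TermDer Δ t A → Eqn Δ (.sum 1 (fun _ => 1) (fun _ => t)) t A
  | fubini {Δ A} {n m : ℕ} {α : Fin n → ℂ} {β : Fin n → Fin m → ℂ} {t : Fin m → Term} :
      TermDer Δ (.sum n α (fun i => .sum m (β i) t)) A →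
      Eqn Δ (.sum n α (fun i => .sum m (β i) t)) (.sum m (fun j => ∑ i, α i * β i j) t) A
  | double {Δ A} {n N : ℕ} {m : Fin n → ℕ} {α : Fin n → ℂ} {β : (i : Fin n) → Fin (m i) → ℂ}
      {t : (i : Fin n) → Fin (m i) → Term} (φ : Fin N ≃ (i : Fin n) × Fin (m i)) :
      TermDer Δ (.sum N (fun k => α (φ k).1 * β (φ k).1 (φ k).2)
        (fun k => t (φ k).1 (φ k).2)) A →
      Eqn Δ (.sum n α (fun i => .sum (m i) (β i) (t i)))
        (.sum N (fun k => α (φ k).1 * β (φ k).1 (φ k).2) (fun k => t (φ k).1 (φ k).2)) A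
  -- linearity
  | app_linear {Δ A B ω} {n : ℕ} {α : Fin n → ℂ} {t : Fin n → Term} :
      UDer ω A B → TermDer Δ (.sum n α t) A →
      Eqn Δ (.app ω (.sum n α t)) (.sum n α (fun i => .app ω (t i))) B
  | inl_linear {Δ A B} {n : ℕ} {α : Fin n → ℂ} {t : Fin n → Term} :
      TermDer Δ (.sum n α t) A →
      Eqn Δ (.inl (.sum n α t)) (.sum n α (fun i => .inl (t i))) (.oplus A B)
  | inr_linear {Δ A B} {n : ℕ} {α : Fin n → ℂ} {t : Fin n → Term} :
      TermDer Δ (.sum n α t) B →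
      Eqn Δ (.inr (.sum n α t)) (.sum n α (fun i => .inr (t i))) (.oplus A B)
  | pair_linear_right {Δ Δ₁ Δ₂ A B t} {n : ℕ} {α : Fin n → ℂ} {s : Fin n → Term} :
      Δ.Distinct → Split Δ Δ₁ Δ₂ → TermDer Δ₁ t A → TermDer Δ₂ (.sum n α s) B →
      Eqn Δ (.pair t (.sum n α s)) (.sum n α (fun i => .pair t (s i))) (.tensor A B)
  | pair_linear_left {Δ Δ₁ Δ₂ A B t} {n : ℕ} {α : Fin n → ℂ} {s : Fin n → Term} :
      Δ.Distinct → Split Δ Δ₁ Δ₂ → TermDer Δ₁ (.sum n α s) A → TermDer Δ₂ t B →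
      Eqn Δ (.pair (.sum n α s) t) (.sum n α (fun i => .pair (s i) t)) (.tensor A B)
  | succ_linear {Δ} {n : ℕ} {α : Fin n → ℂ} {t : Fin n → Term} :
      TermDer Δ (.sum n α t) .nat →
      Eqn Δ (.succ (.sum n α t)) (.sum n α (fun i => .succ (t i))) .nat
  -- congruence
  | inl_congr {Δ t₁ t₂ A B} : Eqn Δ t₁ t₂ A → Eqn Δ (.inl t₁) (.inl t₂) (.oplus A B)
  | inr_congr {Δ t₁ t₂ A B} : Eqn Δ t₁ t₂ B → Eqn Δ (.inr t₁) (.inr t₂) (.oplus A B)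
  | pair_congr_left {Δ Δ₁ Δ₂ t₁ t₂ t A B} : Δ.Distinct → Split Δ Δ₁ Δ₂ →
      Eqn Δ₁ t₁ t₂ A → TermDer Δ₂ t B → Eqn Δ (.pair t₁ t) (.pair t₂ t) (.tensor A B)
  | pair_congr_right {Δ Δ₁ Δ₂ t₁ t₂ t A B} : Δ.Distinct → Split Δ Δ₁ Δ₂ →
      TermDer Δ₁ t A → Eqn Δ₂ t₁ t₂ B → Eqn Δ (.pair t t₁) (.pair t t₂) (.tensor A B)
  | succ_congr {Δ t₁ t₂} : Eqn Δ t₁ t₂ .nat → Eqn Δ (.succ t₁) (.succ t₂) .nat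
  | app_congr {Δ ω t₁ t₂ A B} : Eqn Δ t₁ t₂ A → UDer ω A B →
      Eqn Δ (.app ω t₁) (.app ω t₂) B
  | sum_congr {Δ A} {n : ℕ} {α : Fin n → ℂ} {t t' : Fin n → Term} :
      TermDer Δ (.sum n α t) A → (∀ i, Eqn Δ (t i) (t' i) A) →
      Eqn Δ (.sum n α t) (.sum n α t') A
  -- computation
  | beta {A B} {n : ℕ} {b : Fin n → Basis} {e : Fin n → Expr} {b' : Basis} {σ : Valuation}
      (i : Fin n) : TermDer [] b'.toTm A → UDer (.abs n b e) A B → Matches σ (b i) b' →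
      Eqn [] (.app (.abs n b e) b'.toTm) (Expr.toTerm (Expr.subst σ (e i))) B
  | inv {ω A B} {b : Basis} {m : ℕ} {α : Fin m → ℂ} {c : Fin m → Basis} :
      UDer ω A B → TermDer [] b.toTm A →
      Eqn [] (.app ω b.toTm) (.sum m α (fun j => (c j).toTm)) B →
      Eqn [] (.app (.inv ω) (.sum m α (fun j => (c j).toTm))) b.toTm A
  | comp {Δ ω₁ ω₂ A B C} {b : Basis} : UDer ω₁ A B → UDer ω₂ B C → TermDer Δ b.toTm A →
      Eqn Δ (.app (.comp ω₂ ω₁) b.toTm) (.app ω₂ (.app ω₁ b.toTm)) C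
  | tensor {ω₁ ω₂ A₁ A₂ B₁ B₂} {b₁ b₂ : Basis} : UDer ω₁ A₁ B₁ → UDer ω₂ A₂ B₂ →
      TermDer [] b₁.toTm A₁ → TermDer [] b₂.toTm A₂ →
      Eqn [] (.app (.tensor ω₁ ω₂) (.pair b₁.toTm b₂.toTm))
        (.pair (.app ω₁ b₁.toTm) (.app ω₂ b₂.toTm)) (.tensor B₁ B₂)
  | oplus_inl {ω₁ ω₂ A₁ A₂ B₁ B₂} {b : Basis} : UDer ω₁ A₁ B₁ → UDer ω₂ A₂ B₂ →
      TermDer [] b.toTm A₁ →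
      Eqn [] (.app (.oplus ω₁ ω₂) (.inl b.toTm)) (.inl (.app ω₁ b.toTm)) (.oplus B₁ B₂)
  | oplus_inr {ω₁ ω₂ A₁ A₂ B₁ B₂} {b : Basis} : UDer ω₁ A₁ B₁ → UDer ω₂ A₂ B₂ →
      TermDer [] b.toTm A₂ →
      Eqn [] (.app (.oplus ω₁ ω₂) (.inr b.toTm)) (.inr (.app ω₂ b.toTm)) (.oplus B₁ B₂)
  | ctrl_inl {ω A} {b : Basis} : UDer ω A A → TermDer [] b.toTm A →
      Eqn [] (.app (.ctrl ω) (.pair (.inl .unit) b.toTm)) (.pair (.inl .unit) b.toTm)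
        (.tensor (.oplus .unit .unit) A)
  | ctrl_inr {ω A} {b : Basis} : UDer ω A A → TermDer [] b.toTm A →
      Eqn [] (.app (.ctrl ω) (.pair (.inr .unit) b.toTm)) (.pair (.inr .unit) (.app ω b.toTm))
        (.tensor (.oplus .unit .unit) A)

/-! ## Denotational semantics -/

/-- Interpretation of types. -/
def Ty.den : Ty → Hilb
  | .unit => Hilb.one
  | .oplus A B => Hilb.oplus A.den B.den
  | .tensor A B => Hilb.tensor A.den B.den
  | .nat => Hilb.ell2

/-- Interpretation of contexts: `⟦x₁ : A₁, …, xₙ : Aₙ⟧ = ⟦A₁⟧ ⊗ (⋯ ⊗ (⟦Aₙ⟧ ⊗ ℂ))`. -/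
def Ctx.den : Ctx → Hilb
  | [] => Hilb.one
  | p :: Δ => Hilb.tensor p.2.den (Ctx.den Δ)

/-- The permutation `⟦Δ⟧ → ⟦Δ₁⟧ ⊗ ⟦Δ₂⟧` for `Δ = Δ₁, Δ₂`. -/
def Split.den : {Δ Δ₁ Δ₂ : Ctx} → Split Δ Δ₁ Δ₂ →
    (Ctx.den Δ →L[ℂ] Hilb.tensor (Ctx.den Δ₁) (Ctx.den Δ₂))
  | _, _, _, .nil => Hilb.unitSplit
  | _, _, _, .left (Δ₁ := Δ₁) (Δ₂ := Δ₂) p s =>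
      Hilb.assocInv p.2.den (Ctx.den Δ₁) (Ctx.den Δ₂) ∘L
        Hilb.tensorMap (ContinuousLinearMap.id ℂ p.2.den) s.den
  | _, _, _, .right (Δ₁ := Δ₁) (Δ₂ := Δ₂) p s =>
      Hilb.assocHom (Ctx.den Δ₁) p.2.den (Ctx.den Δ₂) ∘L
        Hilb.tensorMap (Hilb.braid p.2.den (Ctx.den Δ₁))
          (ContinuousLinearMap.id ℂ (Ctx.den Δ₂)) ∘L
        Hilb.assocInv p.2.den (Ctx.den Δ₁) (Ctx.den Δ₂) ∘L
        Hilb.tensorMap (ContinuousLinearMap.id ℂ p.2.den) s.den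

/-- Interpretation `⟦Δ ⊢ t : A⟧ : ⟦Δ⟧ → ⟦A⟧` of typing derivations, given that of unitaries. -/
def Der.den {U : Type} {TU : U → Ty → Ty → Type}
    (denU : ∀ {ω A B}, TU ω A B → (A.den →L[ℂ] B.den)) :
    {Δ : Ctx} → {t : Tm U} → {A : Ty} → Der TU Δ t A → (Ctx.den Δ →L[ℂ] A.den)
  | _, _, _, .unit => ContinuousLinearMap.id ℂ Hilb.one
  | _, _, _, .var _ A => Hilb.rightUnitor A.den
  | _, _, _, .pair _ s d₁ d₂ => Hilb.tensorMap (d₁.den denU) (d₂.den denU) ∘L s.den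
  | _, _, _, .inl (A := A) B d => Hilb.inl A.den B.den ∘L d.den denU
  | _, _, _, .inr (B := B) A d => Hilb.inr A.den B.den ∘L d.den denU
  | _, _, _, .zero => Hilb.ketZero
  | _, _, _, .succ d => Hilb.succMap ∘L d.den denU
  | _, _, _, .sum (α := α) d _ _ => ∑ i, α i • (d i).den denU
  | _, _, _, .app u d => denU u ∘L d.den denU

/-- Interpretation of expressions. -/
def ExprDer.den {Δ : Ctx} {e : Expr} {A : Ty} (d : ExprDer Δ e A) : Ctx.den Δ →L[ℂ] A.den :=
  Der.den (fun {ω} _ _ _ => (ω : Empty).elim) d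

/-- Interpretation of unitaries. -/
def UDer.den : {ω : Unitary} → {A B : Ty} → UDer ω A B → (A.den →L[ℂ] B.den)
  | _, _, _, .abs _ db de _ _ _ _ =>
      ∑ i, ExprDer.den (de i) ∘L Hilb.dagger (ExprDer.den (db i))
  | _, _, _, .inv u => Hilb.dagger u.den
  | _, _, _, .comp u₁ u₂ => u₂.den ∘L u₁.den
  | _, _, _, .tensor u₁ u₂ => Hilb.tensorMap u₁.den u₂.den
  | _, _, _, .oplus u₁ u₂ => Hilb.oplusMap u₁.den u₂.den
  | _, _, _, .ctrl u => Hilb.ctrlMap u.den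

/-- Interpretation of terms. -/
def TermDer.den {Δ : Ctx} {t : Term} {A : Ty} (d : TermDer Δ t A) : Ctx.den Δ →L[ℂ] A.den :=
  Der.den (fun u => UDer.den u) d

end QControl

end

/-! The proof replaces Hilbert spaces by the algebraic space `Vec` of finite combinations of basis
values. Well-typed unitaries have matrices with finitely supported columns and rows, even at type
`Nat`, so a term can be evaluated in `Vec` with no limits involved. A closed term thus has a vector
`Tm.vec`, and both sides of the theorem are compared with equality of vectors: provable equality in
`eqn_iff_vec_eq`, equality of denotations in `TermDer.den_eq_iff`.

Closed terms denote unit vectors for two reasons. Syntactic orthogonality implies orthogonality of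
vectors (`Orth.evOrthogonal`), and well-typed unitaries act unitarily (`UDer.isUnitary`). For an
abstraction the latter says that the closed instances of an orthogonal decomposition form an
orthonormal basis: orthogonality is `ODe.orth`, spanning is `ODe.mem_span`. Matching a pattern is
then the expansion of a basis vector in such a basis, which makes it exhaustive and unambiguous.

Soundness (`Eqn.vec_eq`) is a check of the rules. Completeness is a normalisation argument: a closed
term is provably equal to the combination of distinct closed basis values whose coefficients are
those of its vector (`TermDer.hasValue`), and two such combinations with the same vector differ by a
permutation and by zero summands (`Frame.eqn`). The delicate case is `ω⁻¹ b`, because the rule for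
inverses evaluates `ω⁻¹` only on a value already known to equal some `ω b'`. Let `∑ γₖ cₖ` be the
adjoint of `ω` applied to `b`. By induction each `ω cₖ` equals a value `vₖ`; since `ω` is unitary,
`b` and `∑ γₖ vₖ` have the same coefficients, so they are provably equal; linearity and the rule
then give `ω⁻¹ b = ∑ γₖ cₖ`.

Finally, `Ty.emb` maps the closed basis values of type `A` to an orthonormal family with dense span
in `⟦A⟧`, and the denotation of a closed term sends `1` to the image of its vector
(`TermDer.den_one`). Adjoints are identified through their inner products with these basis vectors.
-/

noncomputable section

namespace QControl

/-! ## Finitely supported vectors over basis values -/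

/-- Finite formal linear combinations of basis values. -/
abbrev Vec : Type := Basis →₀ ℂ

/-- The basis vector of `b`. -/
def bvec (b : Basis) : Vec := Finsupp.single b 1

/-- The inner product of `Vec` for which the basis values are orthonormal. -/
def ip (v w : Vec) : ℂ := v.sum fun b z => (starRingEnd ℂ) z * w b

theorem ip_eq_sum {v w : Vec} {s : Finset Basis} (h : v.support ⊆ s) :
    ip v w = ∑ b ∈ s, (starRingEnd ℂ) (v b) * w b :=
  Finsupp.sum_of_support_subset _ h _ (by simp)

@[simp] theorem ip_zero_left (w : Vec) : ip 0 w = 0 := by simp [ip]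

@[simp] theorem ip_zero_right (w : Vec) : ip w 0 = 0 := by simp [ip]

theorem ip_add_left (u v w : Vec) : ip (u + v) w = ip u w + ip v w := by
  unfold ip
  rw [Finsupp.sum_add_index'] <;> simp [add_mul]

theorem ip_smul_left (a : ℂ) (v w : Vec) : ip (a • v) w = (starRingEnd ℂ) a * ip v w := by
  unfold ip
  rw [Finsupp.sum_smul_index (by simp), Finsupp.mul_sum]
  simp [mul_assoc]

theorem ip_add_right (u v w : Vec) : ip u (v + w) = ip u v + ip u w := by
  simp [ip, mul_add, Finsupp.sum_add]

theorem ip_smul_right (a : ℂ) (v w : Vec) : ip v (a • w) = a * ip v w := by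
  simp only [ip, Finsupp.mul_sum, Finsupp.smul_apply, smul_eq_mul]
  exact Finsupp.sum_congr fun b _ => by ring

theorem ip_sum_left {ι : Type*} (s : Finset ι) (v : ι → Vec) (w : Vec) :
    ip (∑ i ∈ s, v i) w = ∑ i ∈ s, ip (v i) w := by
  classical
  induction s using Finset.induction_on with
  | empty => simp
  | insert a s ha ih => simp [Finset.sum_insert ha, ip_add_left, ih]

theorem ip_sum_right {ι : Type*} (s : Finset ι) (v : ι → Vec) (w : Vec) :
    ip w (∑ i ∈ s, v i) = ∑ i ∈ s, ip w (v i) := by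
  classical
  induction s using Finset.induction_on with
  | empty => simp
  | insert a s ha ih => simp [Finset.sum_insert ha, ip_add_right, ih]

@[simp] theorem ip_bvec_left (b : Basis) (w : Vec) : ip (bvec b) w = w b := by
  simp [ip, bvec]

theorem ip_conj (v w : Vec) : (starRingEnd ℂ) (ip v w) = ip w v := by
  classical
  rw [ip_eq_sum (s := v.support ∪ w.support) Finset.subset_union_left,
    ip_eq_sum (s := v.support ∪ w.support) Finset.subset_union_right]
  simp [mul_comm]

@[simp] theorem ip_bvec_right (b : Basis) (w : Vec) : ip w (bvec b) = (starRingEnd ℂ) (w b) := by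
  rw [← ip_conj, ip_bvec_left]

open Classical in
theorem bvec_apply (b b' : Basis) : bvec b b' = if b = b' then 1 else 0 := by
  simp [bvec, Finsupp.single_apply]

theorem bvec_self (b : Basis) : bvec b b = 1 := by simp [bvec]

theorem bvec_injective : Function.Injective bvec := by
  intro b b' h
  by_contra hne
  have := DFunLike.congr_fun h b'
  simp [bvec_apply, hne] at this

/-- The linear extension of a map defined on basis values. -/
abbrev lin {M : Type*} [AddCommGroup M] [Module ℂ M] (f : Basis → M) : Vec →ₗ[ℂ] M :=
  Finsupp.linearCombination ℂ f

theorem lin_bvec {M : Type*} [AddCommGroup M] [Module ℂ M] (f : Basis → M) (b : Basis) :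
    lin f (bvec b) = f b := by
  simp [bvec]

theorem lin_bvec_eq_self (v : Vec) : lin bvec v = v := by
  simp [bvec, Finsupp.linearCombination_apply]

theorem lin_apply (f : Basis → Vec) (v : Vec) (b : Basis) :
    lin f v b = v.sum fun b' z => z * f b' b := by
  simp [Finsupp.linearCombination_apply, Finsupp.sum, Finsupp.finsetSum_apply]

theorem lin_congr {M : Type*} [AddCommGroup M] [Module ℂ M] {f g : Basis → M} {v : Vec}
    (h : ∀ b, v b ≠ 0 → f b = g b) : lin f v = lin g v := by
  simp only [Finsupp.linearCombination_apply]
  exact Finsupp.sum_congr fun b hb => by rw [h b (Finsupp.mem_support_iff.mp hb)]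

theorem lin_ne_zero {f : Basis → Vec} {v : Vec} {b : Basis} (h : lin f v b ≠ 0) :
    ∃ b', v b' ≠ 0 ∧ f b' b ≠ 0 := by
  rw [lin_apply] at h
  obtain ⟨b', -, hb'⟩ := Finset.exists_ne_zero_of_sum_ne_zero h
  exact ⟨b', left_ne_zero_of_mul hb', right_ne_zero_of_mul hb'⟩

theorem ip_sum_sum {ι κ : Type*} (s : Finset ι) (r : Finset κ) (α : ι → ℂ) (β : κ → ℂ)
    (v : ι → Vec) (w : κ → Vec) :
    ip (∑ i ∈ s, α i • v i) (∑ j ∈ r, β j • w j) =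
      ∑ i ∈ s, ∑ j ∈ r, (starRingEnd ℂ) (α i) * (β j * ip (v i) (w j)) := by
  rw [ip_sum_left]
  refine Finset.sum_congr rfl fun i _ => ?_
  rw [ip_smul_left, ip_sum_right, Finset.mul_sum]
  exact Finset.sum_congr rfl fun j _ => by rw [ip_smul_right]

theorem ip_lin_lin (f g : Basis → Vec) (v w : Vec) :
    ip (lin f v) (lin g w) =
      v.sum fun b z => w.sum fun b' z' => (starRingEnd ℂ) z * (z' * ip (f b) (g b')) := by
  simp only [Finsupp.linearCombination_apply, Finsupp.sum, ip_sum_sum]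

theorem ip_lin_congr {f g f' g' : Basis → Vec} {v w : Vec}
    (h : ∀ b b', v b ≠ 0 → w b' ≠ 0 → ip (f b) (g b') = ip (f' b) (g' b')) :
    ip (lin f v) (lin g w) = ip (lin f' v) (lin g' w) := by
  rw [ip_lin_lin, ip_lin_lin]
  refine Finsupp.sum_congr fun b hb => Finsupp.sum_congr fun b' hb' => ?_
  rw [h b b' (Finsupp.mem_support_iff.mp hb) (Finsupp.mem_support_iff.mp hb')]

theorem ip_lin_eq {f : Basis → Vec} {v w : Vec}
    (h : ∀ b b', v b ≠ 0 → w b' ≠ 0 → ip (f b) (f b') = ip (bvec b) (bvec b')) :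
    ip (lin f v) (lin f w) = ip v w := by
  rw [ip_lin_congr (f' := bvec) (g' := bvec) h, lin_bvec_eq_self, lin_bvec_eq_self]

/-- The linear extension of a map between basis values. -/
def mapB (c : Basis → Basis) : Vec →ₗ[ℂ] Vec := lin fun b => bvec (c b)

@[simp] theorem mapB_bvec (c : Basis → Basis) (b : Basis) : mapB c (bvec b) = bvec (c b) :=
  lin_bvec _ _

theorem ip_mapB {c : Basis → Basis} (hc : Function.Injective c) (v w : Vec) :
    ip (mapB c v) (mapB c w) = ip v w :=
  ip_lin_eq fun b b' _ _ => by classical simp [bvec_apply, hc.eq_iff]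

theorem ip_mapB_mapB {c c' : Basis → Basis} (hc : ∀ b b', c b ≠ c' b') (v w : Vec) :
    ip (mapB c v) (mapB c' w) = 0 := by
  have := ip_lin_congr (f := fun b => bvec (c b)) (g := fun b => bvec (c' b)) (f' := 0) (g' := 0)
    (v := v) (w := w) (fun b b' _ _ => by classical simp [bvec_apply, hc b b'])
  simpa [mapB] using this

theorem mapB_apply {c : Basis → Basis} (hc : Function.Injective c) (v : Vec) (b : Basis) :
    mapB c v (c b) = v b := by
  rw [← ip_bvec_left, ← mapB_bvec, ip_mapB hc, ip_bvec_left]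

theorem mapB_ne_zero {c : Basis → Basis} {v : Vec} {b : Basis} (h : mapB c v b ≠ 0) :
    ∃ b', v b' ≠ 0 ∧ c b' = b := by
  obtain ⟨b', h₁, h₂⟩ := lin_ne_zero h
  refine ⟨b', h₁, ?_⟩
  classical
  by_contra hne
  simp [bvec_apply, hne] at h₂

/-- The bilinear extension of the pairing of basis values. -/
def tp : Vec →ₗ[ℂ] Vec →ₗ[ℂ] Vec := lin fun b => mapB (Basis.pair b)

@[simp] theorem tp_bvec (b b' : Basis) : tp (bvec b) (bvec b') = bvec (.pair b b') := by
  rw [tp, lin_bvec, mapB_bvec]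

theorem vec_induction {p : Vec → Prop} (v : Vec) (zero : p 0) (add : ∀ v w, p v → p w → p (v + w))
    (smul : ∀ (a : ℂ) b, p (a • bvec b)) : p v := by
  induction v using Finsupp.induction_linear with
  | zero => exact zero
  | add v w hv hw => exact add v w hv hw
  | single b a => simpa [bvec] using smul a b

theorem ip_tp (v w v' w' : Vec) : ip (tp v w) (tp v' w') = ip v v' * ip w w' := by
  induction v using vec_induction with
  | zero => simp
  | add v₁ v₂ h₁ h₂ => simp [ip_add_left, h₁, h₂, add_mul]
  | smul a b =>
  induction v' using vec_induction with
  | zero => simp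
  | add v₁ v₂ h₁ h₂ => simp only [map_add, LinearMap.add_apply, ip_add_right, h₁, h₂, add_mul]
  | smul a' b' =>
    have : ip (tp (bvec b) w) (tp (bvec b') w') = ip (bvec b) (bvec b') * ip w w' := by
      rw [tp, lin_bvec, lin_bvec]
      by_cases h : b = b'
      · subst h
        rw [ip_mapB (fun _ _ h => by injection h)]
        simp [bvec_self]
      · rw [ip_mapB_mapB (fun _ _ h' => h (by injection h'))]
        classical simp [bvec_apply, h]
    simp only [map_smul, LinearMap.smul_apply, ip_smul_left, ip_smul_right, this]
    ring

theorem tp_apply (v w : Vec) (b b' : Basis) : tp v w (.pair b b') = v b * w b' := by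
  rw [← ip_bvec_left, ← tp_bvec, ip_tp, ip_bvec_left, ip_bvec_left]

theorem tp_ne_zero {v w : Vec} {b : Basis} (h : tp v w b ≠ 0) :
    ∃ b₁ b₂, v b₁ ≠ 0 ∧ w b₂ ≠ 0 ∧ b = .pair b₁ b₂ := by
  have h' : ∃ b₁ b₂, b = .pair b₁ b₂ := by
    rw [tp, Finsupp.linearCombination_apply, Finsupp.sum, LinearMap.sum_apply,
      Finsupp.finsetSum_apply] at h
    obtain ⟨b₁, -, h⟩ := Finset.exists_ne_zero_of_sum_ne_zero h
    rw [LinearMap.smul_apply, Finsupp.smul_apply, smul_eq_mul] at h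
    obtain ⟨b₂, -, h⟩ := mapB_ne_zero (right_ne_zero_of_mul h)
    exact ⟨b₁, b₂, h.symm⟩
  obtain ⟨b₁, b₂, rfl⟩ := h'
  rw [tp_apply] at h
  exact ⟨b₁, b₂, left_ne_zero_of_mul h, right_ne_zero_of_mul h, rfl⟩

/-! ## Closed basis values -/

/-- `Closed A b`: the basis value `b` is closed and of type `A`. -/
inductive Closed : Ty → Basis → Prop
  | unit : Closed .unit .unit
  | inl {A B b} : Closed A b → Closed (.oplus A B) (.inl b)
  | inr {A B b} : Closed B b → Closed (.oplus A B) (.inr b)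
  | pair {A B b b'} : Closed A b → Closed B b' → Closed (.tensor A B) (.pair b b')
  | zero : Closed .nat .zero
  | succ {b} : Closed .nat b → Closed .nat (.succ b)

/-- The vectors supported on the closed basis values of type `A`. -/
def Ty.vecs (A : Ty) : Submodule ℂ Vec := Finsupp.supported ℂ ℂ {b | Closed A b}

theorem Ty.mem_vecs {A : Ty} {v : Vec} : v ∈ A.vecs ↔ ∀ b, v b ≠ 0 → Closed A b := by
  simp [Ty.vecs, Finsupp.mem_supported, Set.subset_def]

theorem bvec_mem {A : Ty} {b : Basis} (h : Closed A b) : bvec b ∈ A.vecs :=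
  Ty.mem_vecs.mpr fun b' hb' => by
    classical
    by_cases h' : b = b'
    · exact h' ▸ h
    · simp [bvec_apply, h'] at hb'

theorem lin_mem {A B : Ty} {f : Basis → Vec} {v : Vec} (hf : ∀ b, Closed A b → f b ∈ B.vecs)
    (hv : v ∈ A.vecs) : lin f v ∈ B.vecs :=
  Ty.mem_vecs.mpr fun b hb => by
    obtain ⟨b', h₁, h₂⟩ := lin_ne_zero hb
    exact Ty.mem_vecs.mp (hf b' (Ty.mem_vecs.mp hv b' h₁)) b h₂

theorem mapB_mem {A B : Ty} {c : Basis → Basis} {v : Vec} (hc : ∀ b, Closed A b → Closed B (c b))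
    (hv : v ∈ A.vecs) : mapB c v ∈ B.vecs :=
  lin_mem (fun b hb => bvec_mem (hc b hb)) hv

theorem tp_mem {A B : Ty} {v w : Vec} (hv : v ∈ A.vecs) (hw : w ∈ B.vecs) :
    tp v w ∈ (Ty.tensor A B).vecs :=
  Ty.mem_vecs.mpr fun b hb => by
    obtain ⟨b₁, b₂, h₁, h₂, rfl⟩ := tp_ne_zero hb
    exact .pair (Ty.mem_vecs.mp hv _ h₁) (Ty.mem_vecs.mp hw _ h₂)

theorem Ty.exists_closed (A : Ty) : ∃ b, Closed A b := by
  induction A with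
  | unit => exact ⟨_, .unit⟩
  | oplus A B hA _ => exact hA.elim fun b hb => ⟨_, .inl hb⟩
  | tensor A B hA hB => exact hA.elim fun b hb => hB.elim fun b' hb' => ⟨_, .pair hb hb'⟩
  | nat => exact ⟨_, .zero⟩

/-- Every type has a closed value, whose outermost constructor reveals the outermost type former;
the inclusion then passes to the components. Unitaries do not have unique types, and this is how a
codomain still determines the domain in `IsUnitary.dom_eq`. -/
theorem Ty.eq_of_closed_imp {A A' : Ty} (h : ∀ b, Closed A b → Closed A' b) : A = A' := by
  induction A generalizing A' with
  | unit => cases h _ .unit; rfl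
  | oplus A B hA hB =>
    obtain ⟨a, ha⟩ := A.exists_closed
    cases h _ (.inl ha)
    rw [hA fun b hb => by cases h _ (.inl hb); assumption,
      hB fun b hb => by cases h _ (.inr hb); assumption]
  | tensor A B hA hB =>
    obtain ⟨a, ha⟩ := A.exists_closed
    obtain ⟨b, hb⟩ := B.exists_closed
    cases h _ (.pair ha hb)
    rw [hA fun a ha => by cases h _ (.pair ha hb); assumption,
      hB fun b hb => by cases h _ (.pair ha hb); assumption]
  | nat => cases h _ .zero; rfl

/-! ## Free variables and contexts -/

/-- The free variables of a term. -/
def Tm.fv {U : Type} : Tm U → Set Var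
  | .unit => ∅
  | .var x => {x}
  | .inl t => t.fv
  | .inr t => t.fv
  | .pair t t' => t.fv ∪ t'.fv
  | .zero => ∅
  | .succ t => t.fv
  | .app _ t => t.fv
  | .sum _ _ t => ⋃ i, (t i).fv

theorem Split.mem_iff {Δ Δ₁ Δ₂ : Ctx} (s : Split Δ Δ₁ Δ₂) (p : Var × Ty) :
    p ∈ Δ ↔ p ∈ Δ₁ ∨ p ∈ Δ₂ := by
  induction s with
  | nil => simp
  | left q s ih => simp [ih, or_assoc]
  | right q s ih => simp only [List.mem_cons, ih]; tauto

theorem Split.perm {Δ Δ₁ Δ₂ : Ctx} (s : Split Δ Δ₁ Δ₂) : Δ.Perm (Δ₁ ++ Δ₂) := by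
  induction s with
  | nil => simp
  | left q s ih => exact ih.cons q
  | right q s ih => exact (ih.cons q).trans List.perm_middle.symm

theorem Split.nodup {Δ Δ₁ Δ₂ : Ctx} (s : Split Δ Δ₁ Δ₂) (h : Δ.Distinct) :
    (Δ₁.map Prod.fst ++ Δ₂.map Prod.fst).Nodup := by
  rw [← List.map_append]
  exact (s.perm.map Prod.fst).nodup_iff.mp h

theorem exists_of_sum_norm {n : ℕ} {α : Fin n → ℂ} (h : ∑ i, ‖α i‖ ^ 2 = 1) : Nonempty (Fin n) := by
  by_contra hn
  rw [not_nonempty_iff] at hn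
  simp at h

variable {U : Type} {TU : U → Ty → Ty → Type}

/-- Typing is strictly linear, so nothing in a context goes unused; a sum has at least one summand
because its coefficients are normalised. In particular the two sides of a clause, typed in one
context, have the same free variables. -/
theorem Der.mem_fv {Δ : Ctx} {t : Tm U} {A : Ty} (d : Der TU Δ t A) (x : Var) :
    x ∈ t.fv ↔ x ∈ Δ.map Prod.fst := by
  induction d with
  | unit => simp [Tm.fv]
  | var y A => simp [Tm.fv]
  | pair hΔ s d₁ d₂ h₁ h₂ =>
    rw [Tm.fv, Set.mem_union, h₁, h₂, (s.perm.map Prod.fst).mem_iff]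
    simp
  | inl B d ih => exact ih
  | inr A d ih => exact ih
  | zero => simp [Tm.fv]
  | succ d ih => exact ih
  | sum d hα ht ih =>
    have := exists_of_sum_norm hα
    simp only [Tm.fv, Set.mem_iUnion, ih, exists_const]
  | app u d ih => exact ih

theorem Der.distinct {Δ : Ctx} {t : Tm U} {A : Ty} (d : Der TU Δ t A) : Δ.Distinct := by
  induction d with
  | unit => simp [Ctx.Distinct]
  | var y A => simp [Ctx.Distinct]
  | pair hΔ s d₁ d₂ h₁ h₂ => exact hΔ
  | inl B d ih => exact ih
  | inr A d ih => exact ih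
  | zero => simp [Ctx.Distinct]
  | succ d ih => exact ih
  | sum d hα ht ih => exact ih (exists_of_sum_norm hα).some
  | app u d ih => exact ih

theorem Der.fv_disjoint {Δ Δ₁ Δ₂ : Ctx} {t₁ t₂ : Tm U} {A₁ A₂ : Ty} (h : Δ.Distinct)
    (s : Split Δ Δ₁ Δ₂) (d₁ : Der TU Δ₁ t₁ A₁) (d₂ : Der TU Δ₂ t₂ A₂) (x : Var)
    (hx : x ∈ t₁.fv) : x ∉ t₂.fv := by
  rw [d₁.mem_fv] at hx
  rw [d₂.mem_fv]
  exact List.disjoint_of_nodup_append (s.nodup h) hx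

/-- Every variable of `Δ` is assigned a closed basis value of its type. -/
def Sat (σ : Var → Basis) (Δ : Ctx) : Prop := ∀ p ∈ Δ, Closed p.2 (σ p.1)

theorem Sat.left {σ : Var → Basis} {Δ Δ₁ Δ₂ : Ctx} (h : Sat σ Δ) (s : Split Δ Δ₁ Δ₂) : Sat σ Δ₁ :=
  fun p hp => h p ((s.mem_iff p).mpr (.inl hp))

theorem Sat.right {σ : Var → Basis} {Δ Δ₁ Δ₂ : Ctx} (h : Sat σ Δ) (s : Split Δ Δ₁ Δ₂) : Sat σ Δ₂ :=
  fun p hp => h p ((s.mem_iff p).mpr (.inr hp))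

theorem Sat.nil (σ : Var → Basis) : Sat σ [] := fun _ h => by simp at h

/-! ## Evaluation -/

/-- The instance of a basis value under an assignment of its variables. -/
def Basis.inst (σ : Var → Basis) : Basis → Basis
  | .unit => .unit
  | .var x => σ x
  | .inl b => .inl (b.inst σ)
  | .inr b => .inr (b.inst σ)
  | .pair b b' => .pair (b.inst σ) (b'.inst σ)
  | .zero => .zero
  | .succ b => .succ (b.inst σ)

/-- The vector denoted by a term, where `F` gives the action of the unitaries on basis values. -/
def Tm.ev (F : U → Basis → Vec) (σ : Var → Basis) : Tm U → Vec
  | .unit => bvec .unit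
  | .var x => bvec (σ x)
  | .inl t => mapB .inl (t.ev F σ)
  | .inr t => mapB .inr (t.ev F σ)
  | .pair t t' => tp (t.ev F σ) (t'.ev F σ)
  | .zero => bvec .zero
  | .succ t => mapB .succ (t.ev F σ)
  | .app ω t => lin (F ω) (t.ev F σ)
  | .sum _ α t => ∑ i, α i • (t i).ev F σ

theorem Tm.ev_toTm (F : U → Basis → Vec) (σ : Var → Basis) (b : Basis) :
    (b.toTm : Tm U).ev F σ = bvec (b.inst σ) := by
  induction b with
  | unit => rfl
  | var x => rfl
  | inl b ih => simp [Basis.toTm, Tm.ev, ih, Basis.inst]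
  | inr b ih => simp [Basis.toTm, Tm.ev, ih, Basis.inst]
  | pair b b' ih ih' => simp [Basis.toTm, Tm.ev, ih, ih', Basis.inst]
  | zero => rfl
  | succ b ih => simp [Basis.toTm, Tm.ev, ih, Basis.inst]

theorem Tm.ev_congr (F : U → Basis → Vec) {σ σ' : Var → Basis} (t : Tm U)
    (h : ∀ x ∈ t.fv, σ x = σ' x) : t.ev F σ = t.ev F σ' := by
  induction t with
  | unit => rfl
  | var x => simp [Tm.ev, h x (by simp [Tm.fv])]
  | inl t ih => simp [Tm.ev, ih h]
  | inr t ih => simp [Tm.ev, ih h]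
  | pair t t' ih ih' =>
    simp [Tm.ev, ih fun x hx => h x (.inl hx), ih' fun x hx => h x (.inr hx)]
  | zero => rfl
  | succ t ih => simp [Tm.ev, ih h]
  | app ω t ih => simp [Tm.ev, ih h]
  | sum n α t ih =>
    simp only [Tm.ev]
    exact Finset.sum_congr rfl fun i _ => by
      rw [ih i fun x hx => h x (Set.mem_iUnion.mpr ⟨i, hx⟩)]

theorem Basis.inst_congr {σ σ' : Var → Basis} (b : Basis)
    (h : ∀ x ∈ (b.toTm : Expr).fv, σ x = σ' x) : b.inst σ = b.inst σ' := by
  have := Tm.ev_congr (fun _ _ => 0) (b.toTm : Expr) h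
  rw [Tm.ev_toTm, Tm.ev_toTm] at this
  exact bvec_injective this

/-- The action `F` of the unitaries is isometric on closed basis values. -/
structure IsometricAction (TU : U → Ty → Ty → Type) (F : U → Basis → Vec) : Prop where
  mem : ∀ {ω A B}, TU ω A B → ∀ b, Closed A b → F ω b ∈ B.vecs
  inner : ∀ {ω A B}, TU ω A B → ∀ b b', Closed A b → Closed A b' →
    ip (F ω b) (F ω b') = ip (bvec b) (bvec b')
  dom : ∀ {ω A A' B}, TU ω A B → TU ω A' B → A = A'

variable {F : U → Basis → Vec}

theorem IsometricAction.of_isEmpty [IsEmpty U] : IsometricAction TU F where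
  mem {ω} := isEmptyElim ω
  inner {ω} := isEmptyElim ω
  dom {ω} := isEmptyElim ω

theorem Der.ev_mem (hF : IsometricAction TU F) {Δ : Ctx} {t : Tm U} {A : Ty} (d : Der TU Δ t A)
    {σ : Var → Basis} (hσ : Sat σ Δ) : t.ev F σ ∈ A.vecs := by
  induction d with
  | unit => exact bvec_mem .unit
  | var x A => exact bvec_mem (hσ (x, A) (by simp))
  | pair hΔ s d₁ d₂ h₁ h₂ => exact tp_mem (h₁ (hσ.left s)) (h₂ (hσ.right s))
  | inl B d ih => exact mapB_mem (fun _ => .inl) (ih hσ)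
  | inr A d ih => exact mapB_mem (fun _ => .inr) (ih hσ)
  | zero => exact bvec_mem .zero
  | succ d ih => exact mapB_mem (fun _ => .succ) (ih hσ)
  | sum d hα ht ih => exact Submodule.sum_mem _ fun i _ => Submodule.smul_mem _ _ (ih i hσ)
  | app u d ih => exact lin_mem (hF.mem u) (ih hσ)

/-! ## Orthogonal terms denote orthogonal vectors -/

/-- The assignments at which terms are evaluated: those of closed values of the right types or,
for terms without application, all assignments. -/
def Admissible (U : Type) (σ : Var → Basis) (Δ : Ctx) : Prop := IsEmpty U ∨ Sat σ Δ

theorem Admissible.left {σ : Var → Basis} {Δ Δ₁ Δ₂ : Ctx} (h : Admissible U σ Δ)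
    (s : Split Δ Δ₁ Δ₂) : Admissible U σ Δ₁ := h.imp_right fun h => h.left s

theorem Admissible.right {σ : Var → Basis} {Δ Δ₁ Δ₂ : Ctx} (h : Admissible U σ Δ)
    (s : Split Δ Δ₁ Δ₂) : Admissible U σ Δ₂ := h.imp_right fun h => h.right s

/-- `t` maps assignments of its variables to orthonormal vectors. -/
def EvOrthonormal (TU : U → Ty → Ty → Type) (F : U → Basis → Vec) (t : Tm U) : Prop :=
  ∀ ⦃Δ Δ' : Ctx⦄ ⦃A : Ty⦄ ⦃σ σ' : Var → Basis⦄, Der TU Δ t A → Der TU Δ' t A →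
    Admissible U σ Δ → Admissible U σ' Δ' →
    ((∀ x ∈ t.fv, σ x = σ' x) → ip (t.ev F σ) (t.ev F σ') = 1) ∧
    ((¬ ∀ x ∈ t.fv, σ x = σ' x) → ip (t.ev F σ) (t.ev F σ') = 0)

/-- The vectors denoted by `t` and `t'` are orthogonal. -/
def EvOrthogonal (TU : U → Ty → Ty → Type) (F : U → Basis → Vec) (t t' : Tm U) : Prop :=
  ∀ ⦃Δ Δ' : Ctx⦄ ⦃A : Ty⦄ ⦃σ σ' : Var → Basis⦄, Der TU Δ t A → Der TU Δ' t' A →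
    Admissible U σ Δ → Admissible U σ' Δ' → ip (t.ev F σ) (t'.ev F σ') = 0

/-- All proper subterms of a term satisfy `EvOrthonormal`. -/
def SubtermsOrthonormal (TU : U → Ty → Ty → Type) (F : U → Basis → Vec) : Tm U → Prop
  | .unit => True
  | .var _ => True
  | .inl t => EvOrthonormal TU F t ∧ SubtermsOrthonormal TU F t
  | .inr t => EvOrthonormal TU F t ∧ SubtermsOrthonormal TU F t
  | .pair t t' => (EvOrthonormal TU F t ∧ SubtermsOrthonormal TU F t) ∧
      (EvOrthonormal TU F t' ∧ SubtermsOrthonormal TU F t')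
  | .zero => True
  | .succ t => EvOrthonormal TU F t ∧ SubtermsOrthonormal TU F t
  | .app _ t => EvOrthonormal TU F t ∧ SubtermsOrthonormal TU F t
  | .sum _ _ t => ∀ i, EvOrthonormal TU F (t i) ∧ SubtermsOrthonormal TU F (t i)

theorem ip_app (hF : IsometricAction TU F) {ω : U} {Δ Δ' : Ctx} {t t' : Tm U} {A B : Ty}
    (u : TU ω A B) {σ σ' : Var → Basis} (d : Der TU Δ t A) (d' : Der TU Δ' t' A)
    (h : Admissible U σ Δ) (h' : Admissible U σ' Δ') :
    ip (lin (F ω) (t.ev F σ)) (lin (F ω) (t'.ev F σ')) = ip (t.ev F σ) (t'.ev F σ') := by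
  rcases h with h | h
  · exact isEmptyElim ω
  rcases h' with h' | h'
  · exact isEmptyElim ω
  exact ip_lin_eq fun b b' hb hb' => hF.inner u b b' (Ty.mem_vecs.mp (d.ev_mem hF h) b hb)
    (Ty.mem_vecs.mp (d'.ev_mem hF h') b' hb')

theorem inl_injective : Function.Injective Basis.inl := fun _ _ h => by injection h
theorem inr_injective : Function.Injective Basis.inr := fun _ _ h => by injection h
theorem succ_injective : Function.Injective Basis.succ := fun _ _ h => by injection h

theorem EvOrthogonal.symm {t t' : Tm U} (h : EvOrthogonal TU F t t') : EvOrthogonal TU F t' t := by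
  intro Δ Δ' A σ σ' d d' a a'
  rw [← ip_conj, h d' d a' a, map_zero]

/-- Induction on the derivation of orthogonality. The rule for two combinations over a common family
also needs the inner products of a member with itself, hence the hypotheses on proper subterms. They
are discharged by the induction on terms in `Tm.evOrthonormal_and_subterms`, which uses the present
lemma in its case of sums. -/
theorem Orth.evOrthogonal_of_subterms (hF : IsometricAction TU F) {t t' : Tm U} (h : Orth t t')
    (ht : SubtermsOrthonormal TU F t) (ht' : SubtermsOrthonormal TU F t') :
    EvOrthogonal TU F t t' := by
  induction h with
  | symm _ ih => exact (ih ht' ht).symm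
  | inl_inr t₁ t₂ =>
    intro Δ Δ' A σ σ' d d' a a'
    exact ip_mapB_mapB (by simp) _ _
  | zero_succ t =>
    intro Δ Δ' A σ σ' d d' a a'
    simp only [Tm.ev, ip_bvec_left]
    by_contra h
    obtain ⟨b, -, h⟩ := mapB_ne_zero h
    cases h
  | succ h ih =>
    intro Δ Δ' A σ σ' d d' a a'
    cases d with | succ d => cases d' with | succ d' =>
    simp only [Tm.ev, ip_mapB succ_injective]
    exact ih ht.2 ht'.2 d d' a a'
  | inl h ih =>
    intro Δ Δ' A σ σ' d d' a a'
    cases d with | inl _ d => cases d' with | inl _ d' =>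
    simp only [Tm.ev, ip_mapB inl_injective]
    exact ih ht.2 ht'.2 d d' a a'
  | inr h ih =>
    intro Δ Δ' A σ σ' d d' a a'
    cases d with | inr _ d => cases d' with | inr _ d' =>
    simp only [Tm.ev, ip_mapB inr_injective]
    exact ih ht.2 ht'.2 d d' a a'
  | pair_right t t' h ih =>
    intro Δ Δ' A σ σ' d d' a a'
    cases d with | pair _ s d₁ d₂ => cases d' with | pair _ s' d₁' d₂' =>
    simp only [Tm.ev, ip_tp]
    rw [ih ht.2.2 ht'.2.2 d₂ d₂' (a.right s) (a'.right s'), mul_zero]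
  | pair_left t t' h ih =>
    intro Δ Δ' A σ σ' d d' a a'
    cases d with | pair _ s d₁ d₂ => cases d' with | pair _ s' d₁' d₂' =>
    simp only [Tm.ev, ip_tp]
    rw [ih ht.1.2 ht'.1.2 d₁ d₁' (a.left s) (a'.left s'), zero_mul]
  | app ω h ih =>
    intro Δ Δ' A σ σ' d d' a a'
    cases d with | app u d => cases d' with | app u' d' =>
    -- The two derivations may assign different types to `ω`. The common codomain forces a common
    -- domain, without which the induction hypothesis would not apply.
    obtain rfl := hF.dom u u'
    simp only [Tm.ev]
    rw [ip_app hF u d d' a a', ih ht.2 ht'.2 d d' a a']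
  | sum_right n α s h ih =>
    intro Δ Δ' A σ σ' d d' a a'
    cases d' with | sum d' hα hs =>
    simp only [Tm.ev, ip_sum_right, ip_smul_right]
    exact Finset.sum_eq_zero fun i _ => by rw [ih i ht (ht' i).2 d (d' i) a a', mul_zero]
  | sum_self n α s k h hk ih =>
    intro Δ Δ' A σ σ' d d' a a'
    cases d' with | sum d' hα hs =>
    simp only [Tm.ev, ip_sum_right, ip_smul_right]
    refine Finset.sum_eq_zero fun i _ => ?_
    by_cases hi : i = k
    · rw [hi, hk, zero_mul]
    · rw [ih i hi ht (ht' i).2 d (d' i) a a', mul_zero]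
  | sum_sum N t p q J K α β hJ hK h hαβ ih =>
    intro Δ Δ' A σ σ' d d' a a'
    cases d with | sum d hα hs => cases d' with | sum d' hα' hs' =>
    classical
    simp only [Tm.ev, ip_sum_sum]
    -- The summands all have the variables of `Δ` as free variables, so a shared member contributes
    -- a scalar, 0 or 1, that does not depend on the member. It factors out, and what remains is the
    -- scalar condition of the rule.
    have key : ∀ i j, (starRingEnd ℂ) (α i) * (β j * ip ((t (J i)).ev F σ) ((t (K j)).ev F σ')) =
        (if J i = K j then (starRingEnd ℂ) (α i) * β j else 0) *
          (if ∀ x ∈ Δ.map Prod.fst, σ x = σ' x then 1 else 0) := by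
      intro i j
      by_cases hij : J i = K j
      · have hd : Der TU Δ' (t (K j)) A := d' j
        rw [← hij] at hd ⊢
        have := (ht i).1 (d i) hd a a'
        simp only [(d i).mem_fv] at this
        rw [if_pos rfl]
        split_ifs with hσ
        · rw [this.1 hσ]; ring
        · rw [this.2 hσ]; ring
      · rw [ih _ _ hij (ht i).2 (ht' j).2 (d i) (d' j) a a', if_neg hij]
        ring
    simp only [key, ← Finset.sum_mul, hαβ, zero_mul]

/-- In a sum the cross terms vanish by the preceding lemma, and the diagonal terms are weighted by
`‖αᵢ‖²`, of total 1. -/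
theorem Tm.evOrthonormal_and_subterms (hF : IsometricAction TU F) (t : Tm U) :
    EvOrthonormal TU F t ∧ SubtermsOrthonormal TU F t := by
  induction t with
  | unit =>
    refine ⟨?_, trivial⟩
    intro Δ Δ' A σ σ' d d' a a'
    simp [Tm.fv, Tm.ev, bvec_self]
  | zero =>
    refine ⟨?_, trivial⟩
    intro Δ Δ' A σ σ' d d' a a'
    simp [Tm.fv, Tm.ev, bvec_self]
  | var x =>
    refine ⟨?_, trivial⟩
    intro Δ Δ' A σ σ' d d' a a'
    classical
    simp only [Tm.fv, Tm.ev, ip_bvec_left, Set.mem_singleton_iff, forall_eq, bvec_apply]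
    exact ⟨fun h => if_pos h.symm, fun h => if_neg (Ne.symm h)⟩
  | inl t ih =>
    refine ⟨?_, ih⟩
    intro Δ Δ' A σ σ' d d' a a'
    cases d with | inl _ d => cases d' with | inl _ d' =>
    simp only [Tm.ev, ip_mapB inl_injective]
    exact ih.1 d d' a a'
  | inr t ih =>
    refine ⟨?_, ih⟩
    intro Δ Δ' A σ σ' d d' a a'
    cases d with | inr _ d => cases d' with | inr _ d' =>
    simp only [Tm.ev, ip_mapB inr_injective]
    exact ih.1 d d' a a'
  | succ t ih =>
    refine ⟨?_, ih⟩
    intro Δ Δ' A σ σ' d d' a a'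
    cases d with | succ d => cases d' with | succ d' =>
    simp only [Tm.ev, ip_mapB succ_injective]
    exact ih.1 d d' a a'
  | app ω t ih =>
    refine ⟨?_, ih⟩
    intro Δ Δ' A σ σ' d d' a a'
    cases d with | app u d => cases d' with | app u' d' =>
    obtain rfl := hF.dom u u'
    simp only [Tm.ev]
    rw [ip_app hF u d d' a a']
    exact ih.1 d d' a a'
  | pair t₁ t₂ ih₁ ih₂ =>
    refine ⟨?_, ih₁, ih₂⟩
    intro Δ Δ' A σ σ' d d' a a'
    cases d with | pair _ s d₁ d₂ => cases d' with | pair _ s' d₁' d₂' =>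
    simp only [Tm.ev, ip_tp, Tm.fv, Set.mem_union]
    have h₁ := ih₁.1 d₁ d₁' (a.left s) (a'.left s')
    have h₂ := ih₂.1 d₂ d₂' (a.right s) (a'.right s')
    constructor
    · intro h
      rw [h₁.1 fun x hx => h x (.inl hx), h₂.1 fun x hx => h x (.inr hx), mul_one]
    · intro h
      by_cases h' : ∀ x ∈ t₁.fv, σ x = σ' x
      · rw [h₂.2 fun h'' => h fun x hx => hx.elim (h' x) (h'' x), mul_zero]
      · rw [h₁.2 h', zero_mul]
  | sum n α t ih =>
    refine ⟨?_, ih⟩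
    intro Δ Δ' A σ σ' d d' a a'
    have hfv : (Tm.sum n α t).fv = {x | x ∈ Δ.map Prod.fst} := Set.ext fun x => d.mem_fv x
    cases d with | sum d hα hs => cases d' with | sum d' hα' hs' =>
    have key : ip ((Tm.sum n α t).ev F σ) ((Tm.sum n α t).ev F σ') =
        ∑ i, (starRingEnd ℂ) (α i) * α i * ip ((t i).ev F σ) ((t i).ev F σ') := by
      simp only [Tm.ev, ip_sum_sum]
      refine Finset.sum_congr rfl fun i _ => ?_
      rw [Finset.sum_eq_single i]
      · ring
      · intro j _ hj
        have := (hs i j hj.symm).evOrthogonal_of_subterms hF (ih i).2 (ih j).2 (d i) (d' j) a a'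
        simp [this]
      · simp
    have hn : ∑ i, (starRingEnd ℂ) (α i) * α i = 1 := by
      have : ((∑ i, ‖α i‖ ^ 2 : ℝ) : ℂ) = 1 := by rw [hα]; simp
      rw [← this]
      push_cast
      exact Finset.sum_congr rfl fun i _ => by rw [← Complex.conj_mul']
    rw [hfv, key]
    constructor
    · intro h
      rw [Finset.sum_congr rfl fun i _ => ?_, hn]
      rw [((ih i).1 (d i) (d' i) a a').1
        (by simpa only [(d i).mem_fv, Set.mem_ofPred_eq] using h), mul_one]
    · intro h
      refine Finset.sum_eq_zero fun i _ => ?_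
      rw [((ih i).1 (d i) (d' i) a a').2
        (by simpa only [(d i).mem_fv, Set.mem_ofPred_eq] using h), mul_zero]

theorem Tm.evOrthonormal (hF : IsometricAction TU F) (t : Tm U) : EvOrthonormal TU F t :=
  (t.evOrthonormal_and_subterms hF).1

theorem Orth.evOrthogonal (hF : IsometricAction TU F) {t t' : Tm U} (h : Orth t t') :
    EvOrthogonal TU F t t' :=
  h.evOrthogonal_of_subterms hF (t.evOrthonormal_and_subterms hF).2
    (t'.evOrthonormal_and_subterms hF).2

end QControl

end

noncomputable section

namespace QControl

/-! ## Orthogonal decompositions are orthonormal bases -/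

theorem Basis.toTm_injective {U : Type} : Function.Injective (Basis.toTm : Basis → Tm U) := by
  intro b
  induction b with
  | unit => intro b' h; cases b' <;> first | rfl | cases h
  | zero => intro b' h; cases b' <;> first | rfl | cases h
  | var x =>
    intro b' h
    cases b' <;> first | (injection h with h; rw [h]) | cases h
  | inl b ih =>
    intro b' h
    cases b' <;> first | (injection h with h; rw [ih h]) | cases h
  | inr b ih =>
    intro b' h
    cases b' <;> first | (injection h with h; rw [ih h]) | cases h
  | succ b ih =>
    intro b' h
    cases b' <;> first | (injection h with h; rw [ih h]) | cases h
  | pair b₁ b₂ ih₁ ih₂ =>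
    intro b' h
    cases b' <;> first | (injection h with h h'; rw [ih₁ h, ih₂ h']) | cases h

theorem pair_mem_image_toTm {S : Set Basis} {e₁ e₂ : Expr} :
    Tm.pair e₁ e₂ ∈ Basis.toTm '' S ↔ ∃ b₁ b₂, .pair b₁ b₂ ∈ S ∧ b₁.toTm = e₁ ∧ b₂.toTm = e₂ := by
  constructor
  · rintro ⟨b, hb, h⟩
    cases b with
    | pair b₁ b₂ => injection h with h₁ h₂; exact ⟨b₁, b₂, hb, h₁, h₂⟩
    | _ => cases h
  · rintro ⟨b₁, b₂, hb, rfl, rfl⟩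
    exact ⟨_, hb, rfl⟩

/-- The rules of `OD` are also rules of `ODe`; hence facts about the right-hand sides of clauses
hold for the patterns too. -/
theorem OD.toODe {A : Ty} {S : Set Basis} (h : OD A S) : ODe A (Basis.toTm '' S) := by
  induction h with
  | var A x => rw [Set.image_singleton]; exact .var A x
  | unit => rw [Set.image_singleton]; exact .unit
  | @oplus A B S T _ _ ihS ihT =>
    have : (Basis.toTm '' (Basis.inl '' S ∪ Basis.inr '' T) : Set Expr) =
        Tm.inl '' (Basis.toTm '' S) ∪ Tm.inr '' (Basis.toTm '' T) := by
      simp only [Set.image_union, Set.image_image, Basis.toTm]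
    rw [this]
    exact .oplus ihS ihT
  | @nat S _ ih =>
    have : (Basis.toTm '' ({.zero} ∪ Basis.succ '' S) : Set Expr) =
        {.zero} ∪ Tm.succ '' (Basis.toTm '' S) := by
      simp only [Set.image_union, Set.image_image, Set.image_singleton, Basis.toTm]
    rw [this]
    exact .nat ih
  | @tensor_right A B S hS _ _ ih₁ ih₂ =>
    refine .tensor_right ?_ ?_ ?_
    · rintro _ ⟨b, hb, rfl⟩
      obtain ⟨b₁, b₂, rfl⟩ := hS b hb
      exact ⟨_, _, rfl⟩
    · convert ih₁ using 1
      ext e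
      simp only [pair_mem_image_toTm]
      constructor
      · rintro ⟨_, b₁, b₂, hb, rfl, rfl⟩; exact ⟨b₂, ⟨b₁, hb⟩, rfl⟩
      · rintro ⟨b₂, ⟨b₁, hb⟩, rfl⟩; exact ⟨_, b₁, b₂, hb, rfl, rfl⟩
    · rintro e₂ ⟨e₁, he⟩
      obtain ⟨b₁, b₂, hb, rfl, rfl⟩ := pair_mem_image_toTm.mp he
      convert ih₂ b₂ ⟨b₁, hb⟩ using 1
      ext e
      simp only [pair_mem_image_toTm]
      constructor
      · rintro ⟨b₁', b₂', hb', rfl, h⟩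
        exact ⟨b₁', by rw [Basis.toTm_injective h] at hb'; exact hb', rfl⟩
      · rintro ⟨b₁', hb', rfl⟩; exact ⟨b₁', b₂, hb', rfl, rfl⟩
  | @tensor_left A B S hS _ _ ih₁ ih₂ =>
    refine .tensor_left ?_ ?_ ?_
    · rintro _ ⟨b, hb, rfl⟩
      obtain ⟨b₁, b₂, rfl⟩ := hS b hb
      exact ⟨_, _, rfl⟩
    · convert ih₁ using 1
      ext e
      simp only [pair_mem_image_toTm]
      constructor
      · rintro ⟨_, b₁, b₂, hb, rfl, rfl⟩; exact ⟨b₁, ⟨b₂, hb⟩, rfl⟩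
      · rintro ⟨b₁, ⟨b₂, hb⟩, rfl⟩; exact ⟨_, b₁, b₂, hb, rfl, rfl⟩
    · rintro e₁ ⟨e₂, he⟩
      obtain ⟨b₁, b₂, hb, rfl, rfl⟩ := pair_mem_image_toTm.mp he
      convert ih₂ b₁ ⟨b₂, hb⟩ using 1
      ext e
      simp only [pair_mem_image_toTm]
      constructor
      · rintro ⟨b₁', b₂', hb', h, rfl⟩
        exact ⟨b₂', by rw [Basis.toTm_injective h] at hb'; exact hb', rfl⟩
      · rintro ⟨b₂', hb', rfl⟩; exact ⟨b₁, b₂', hb', rfl, rfl⟩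

/-- For pairs, one component is decomposed uniformly and the other depending on it: distinct pairs
either differ in the uniform component, or agree there and differ within a single dependent
decomposition. After a change of basis, orthogonality is that of the rows of the matrix. -/
theorem ODe.orth {A : Ty} {S : Set Expr} (h : ODe A S) {e e' : Expr} (he : e ∈ S) (he' : e' ∈ S)
    (hne : e ≠ e') : Orth e e' := by
  induction h generalizing e e' with
  | var A x => exact absurd (he.trans he'.symm) hne
  | unit => exact absurd (he.trans he'.symm) hne
  | oplus _ _ ihS ihT =>
    rcases he with ⟨a, ha, rfl⟩ | ⟨a, ha, rfl⟩ <;> rcases he' with ⟨a', ha', rfl⟩ | ⟨a', ha', rfl⟩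
    · exact .inl (ihS ha ha' fun h => hne (by rw [h]))
    · exact .inl_inr _ _
    · exact (Orth.inl_inr _ _).symm
    · exact .inr (ihT ha ha' fun h => hne (by rw [h]))
  | nat _ ih =>
    rcases he with he | ⟨a, ha, rfl⟩ <;> rcases he' with he' | ⟨a', ha', rfl⟩
    · exact absurd (he.trans he'.symm) hne
    · rw [he]; exact .zero_succ _
    · rw [he']; exact (Orth.zero_succ _).symm
    · exact .succ (ih ha ha' fun h => hne (by rw [h]))
  | tensor_right hS _ _ ih₁ ih₂ =>
    obtain ⟨e₁, e₂, rfl⟩ := hS _ he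
    obtain ⟨e₁', e₂', rfl⟩ := hS _ he'
    by_cases h : e₂ = e₂'
    · subst h
      exact .pair_left _ _ (ih₂ e₂ ⟨_, he⟩ he he' fun h => hne (by rw [h]))
    · exact .pair_right _ _ (ih₁ ⟨_, he⟩ ⟨_, he'⟩ h)
  | tensor_left hS _ _ ih₁ ih₂ =>
    obtain ⟨e₁, e₂, rfl⟩ := hS _ he
    obtain ⟨e₁', e₂', rfl⟩ := hS _ he'
    by_cases h : e₁ = e₁'
    · subst h
      exact .pair_right _ _ (ih₂ e₁ ⟨_, he⟩ he he' fun h => hne (by rw [h]))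
    · exact .pair_left _ _ (ih₁ ⟨_, he⟩ ⟨_, he'⟩ h)
  | change n s α hs _ hα ih =>
    obtain ⟨i, rfl⟩ := he
    obtain ⟨j, rfl⟩ := he'
    refine .sum_sum n s n n id id (α i) (α j) Function.injective_id Function.injective_id
      (fun k l hkl => ih ⟨k, rfl⟩ ⟨l, rfl⟩ (hs.ne hkl)) ?_
    have hij : j ≠ i := fun h => hne (by rw [h])
    -- The entry in position `(j, i)`, and not `(i, j)`, of the product of `α` with its adjoint
    -- carries the conjugate on row `i`, as `Orth.sum_sum` requires.
    have := congrFun (congrFun (Matrix.mem_unitaryGroup_iff.mp hα) j) i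
    rw [Matrix.mul_apply, Matrix.one_apply_ne hij] at this
    refine Eq.trans (Finset.sum_congr rfl fun k _ => ?_) this
    simp [Matrix.star_apply, mul_comm]

/-- The vector denoted by an instance of an expression. -/
abbrev exprEv (σ : Var → Basis) (e : Expr) : Vec := Tm.ev (fun u => u.elim) σ e

/-- The vectors denoted by the closed well-typed instances of the expressions in `S`. -/
def instances (A : Ty) (S : Set Expr) : Set Vec :=
  {v | ∃ e ∈ S, ∃ σ, (∀ Δ, ExprDer Δ e A → Sat σ Δ) ∧ v = exprEv σ e}

/-- The components of a well-typed pair share no variable, so the two assignments can be glued.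
Since `instances` asks an assignment to suit every context that types the expression, the hypotheses
apply to the components of any derivation of the pair, and uniqueness of contexts is never needed.
-/
theorem tp_mem_instances {A B : Ty} {S : Set Expr} {e₁ e₂ : Expr} (he : .pair e₁ e₂ ∈ S)
    (ht : ∃ Δ, Nonempty (ExprDer Δ (.pair e₁ e₂) (.tensor A B))) {σ₁ σ₂ : Var → Basis}
    (h₁ : ∀ Δ, ExprDer Δ e₁ A → Sat σ₁ Δ) (h₂ : ∀ Δ, ExprDer Δ e₂ B → Sat σ₂ Δ) :
    tp (exprEv σ₁ e₁) (exprEv σ₂ e₂) ∈ instances (.tensor A B) S := by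
  classical
  have hdisj : ∀ x ∈ e₂.fv, x ∉ e₁.fv := by
    obtain ⟨Δ, ⟨d⟩⟩ := ht
    cases d with | pair hΔ s d₁ d₂ => exact fun x hx hx' => d₁.fv_disjoint hΔ s d₂ x hx' hx
  refine ⟨_, he, fun x => if x ∈ e₁.fv then σ₁ x else σ₂ x, ?_, ?_⟩
  · intro Δ d p hp
    cases d with | pair hΔ s d₁ d₂ =>
    dsimp only
    rcases (s.mem_iff p).mp hp with hp | hp
    · rw [if_pos ((d₁.mem_fv p.1).mpr (List.mem_map_of_mem hp))]
      exact h₁ _ d₁ p hp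
    · rw [if_neg (hdisj _ ((d₂.mem_fv p.1).mpr (List.mem_map_of_mem hp)))]
      exact h₂ _ d₂ p hp
  · simp only [exprEv, Tm.ev]
    congr 1
    · congr 1
      exact Tm.ev_congr _ _ fun x hx => (if_pos hx).symm
    · exact Tm.ev_congr _ _ fun x hx => (if_neg (hdisj x hx)).symm

theorem map_mem_span {f : Vec →ₗ[ℂ] Vec} {X Y : Set Vec} {v : Vec}
    (h : ∀ x ∈ X, f x ∈ Submodule.span ℂ Y) (hv : v ∈ Submodule.span ℂ X) :
    f v ∈ Submodule.span ℂ Y :=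
  (Submodule.span_le (p := (Submodule.span ℂ Y).comap f)).mpr h hv

theorem tp_mem_span_left {X Y : Set Vec} {v w : Vec} (h : ∀ x ∈ X, tp x w ∈ Submodule.span ℂ Y)
    (hv : v ∈ Submodule.span ℂ X) : tp v w ∈ Submodule.span ℂ Y := by
  rw [← LinearMap.flip_apply]
  exact map_mem_span (fun x hx => by rw [LinearMap.flip_apply]; exact h x hx) hv

/-- Spanning passes through each constructor by linearity, and through pairs by bilinearity, one
component at a time. Well-typedness matters for pairs, whose components must be instantiated
independently. Together with `ODe.orth`, this makes the closed instances an orthonormal basis. -/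
theorem ODe.mem_span {A : Ty} {S : Set Expr} (h : ODe A S)
    (hS : ∀ e ∈ S, ∃ Δ, Nonempty (ExprDer Δ e A)) {b : Basis} (hb : Closed A b) :
    bvec b ∈ Submodule.span ℂ (instances A S) := by
  induction h generalizing b with
  | var A x =>
    refine Submodule.subset_span ⟨_, rfl, fun _ => b, ?_, rfl⟩
    intro Δ d p hp
    cases d
    simp only [List.mem_singleton] at hp
    subst hp
    exact hb
  | unit =>
    cases hb
    refine Submodule.subset_span ⟨_, rfl, fun _ => .unit, ?_, rfl⟩
    intro Δ d p hp
    cases d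
    simp at hp
  | @oplus A B S T _ _ ihS ihT =>
    cases hb with
    | @inl _ _ b hb =>
      rw [← mapB_bvec]
      refine map_mem_span (f := mapB Basis.inl) ?_ (ihS ?_ hb)
      · rintro _ ⟨e, he, σ, hσ, rfl⟩
        refine Submodule.subset_span ⟨.inl e, .inl ⟨e, he, rfl⟩, σ, ?_, rfl⟩
        intro Δ d
        cases d with | inl _ d => exact hσ Δ d
      · intro e he
        obtain ⟨Δ, ⟨d⟩⟩ := hS (.inl e) (.inl ⟨e, he, rfl⟩)
        cases d with | inl _ d => exact ⟨Δ, ⟨d⟩⟩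
    | @inr _ _ b hb =>
      rw [← mapB_bvec]
      refine map_mem_span (f := mapB Basis.inr) ?_ (ihT ?_ hb)
      · rintro _ ⟨e, he, σ, hσ, rfl⟩
        refine Submodule.subset_span ⟨.inr e, .inr ⟨e, he, rfl⟩, σ, ?_, rfl⟩
        intro Δ d
        cases d with | inr _ d => exact hσ Δ d
      · intro e he
        obtain ⟨Δ, ⟨d⟩⟩ := hS (.inr e) (.inr ⟨e, he, rfl⟩)
        cases d with | inr _ d => exact ⟨Δ, ⟨d⟩⟩
  | @nat S _ ih =>
    cases hb with
    | zero =>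
      refine Submodule.subset_span ⟨.zero, .inl rfl, fun _ => .unit, ?_, rfl⟩
      intro Δ d p hp
      cases d
      simp at hp
    | @succ b hb =>
      rw [← mapB_bvec]
      refine map_mem_span (f := mapB Basis.succ) ?_ (ih ?_ hb)
      · rintro _ ⟨e, he, σ, hσ, rfl⟩
        refine Submodule.subset_span ⟨.succ e, .inr ⟨e, he, rfl⟩, σ, ?_, rfl⟩
        intro Δ d
        cases d with | succ d => exact hσ Δ d
      · intro e he
        obtain ⟨Δ, ⟨d⟩⟩ := hS (.succ e) (.inr ⟨e, he, rfl⟩)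
        cases d with | succ d => exact ⟨Δ, ⟨d⟩⟩
  | @tensor_right A B S hp _ _ ih₁ ih₂ =>
    cases hb with | @pair _ _ b₁ b₂ hb₁ hb₂ =>
    rw [← tp_bvec]
    refine map_mem_span (f := tp (bvec b₁)) ?_ (ih₁ ?_ hb₂)
    · rintro _ ⟨e₂, he₂, σ₂, hσ₂, rfl⟩
      refine tp_mem_span_left ?_ (ih₂ e₂ he₂ ?_ hb₁)
      · rintro _ ⟨e₁, he₁, σ₁, hσ₁, rfl⟩
        replace he₁ : Tm.pair e₁ e₂ ∈ S := he₁
        exact Submodule.subset_span (tp_mem_instances he₁ (hS _ he₁) hσ₁ hσ₂)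
      · intro e₁ he₁
        obtain ⟨Δ, ⟨d⟩⟩ := hS _ he₁
        cases d with | pair _ s d₁ d₂ => exact ⟨_, ⟨d₁⟩⟩
    · rintro e₂ ⟨e₁, he₁⟩
      obtain ⟨Δ, ⟨d⟩⟩ := hS _ he₁
      cases d with | pair _ s d₁ d₂ => exact ⟨_, ⟨d₂⟩⟩
  | @tensor_left A B S hp _ _ ih₁ ih₂ =>
    cases hb with | @pair _ _ b₁ b₂ hb₁ hb₂ =>
    rw [← tp_bvec]
    refine tp_mem_span_left ?_ (ih₁ ?_ hb₁)
    · rintro _ ⟨e₁, he₁, σ₁, hσ₁, rfl⟩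
      refine map_mem_span (f := tp (exprEv σ₁ e₁)) ?_ (ih₂ e₁ he₁ ?_ hb₂)
      · rintro _ ⟨e₂, he₂, σ₂, hσ₂, rfl⟩
        replace he₂ : Tm.pair e₁ e₂ ∈ S := he₂
        exact Submodule.subset_span (tp_mem_instances he₂ (hS _ he₂) hσ₁ hσ₂)
      · intro e₂ he₂
        obtain ⟨Δ, ⟨d⟩⟩ := hS _ he₂
        cases d with | pair _ s d₁ d₂ => exact ⟨_, ⟨d₂⟩⟩
    · rintro e₁ ⟨e₂, he₂⟩
      obtain ⟨Δ, ⟨d⟩⟩ := hS _ he₂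
      cases d with | pair _ s d₁ d₂ => exact ⟨_, ⟨d₁⟩⟩
  | @change A n s α hs _ hα ih =>
    refine Submodule.span_le.mpr ?_ (ih ?_ hb)
    · rintro _ ⟨_, ⟨j, rfl⟩, σ, hσ, rfl⟩
      -- The adjoint matrix inverts the change of basis, because the columns of `α` are orthonormal.
      have : exprEv σ (s j) = ∑ i, (starRingEnd ℂ) (α i j) • exprEv σ (.sum n (α i) s) := by
        simp only [exprEv, Tm.ev, Finset.smul_sum]
        rw [Finset.sum_comm]
        simp only [smul_smul, ← Finset.sum_smul]
        have h : ∀ k, ∑ i, (starRingEnd ℂ) (α i j) * α i k = (1 : Matrix (Fin n) (Fin n) ℂ) j k := by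
          intro k
          rw [← Matrix.mem_unitaryGroup_iff'.mp hα, Matrix.mul_apply]
          rfl
        simp only [h, Matrix.one_apply, ite_smul, one_smul, zero_smul, Finset.sum_ite_eq,
          Finset.mem_univ, if_true]
      rw [SetLike.mem_coe, this]
      refine Submodule.sum_mem _ fun i _ => Submodule.smul_mem _ _ (Submodule.subset_span
        ⟨_, ⟨i, rfl⟩, σ, ?_, rfl⟩)
      intro Δ d
      cases d with | sum d _ _ => exact hσ Δ (d j)
    · rintro _ ⟨j, rfl⟩
      obtain ⟨Δ, ⟨d⟩⟩ := hS _ ⟨j, rfl⟩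
      cases d with | sum d _ _ => exact ⟨Δ, ⟨d j⟩⟩

/-! ## The action of unitaries on basis values -/

/-- The adjoint of a linear map given by its columns. -/
def adj (f : Basis → Vec) (b' : Basis) : Vec :=
  open Classical in
  if h : {b | f b b' ≠ 0}.Finite then
    Finsupp.onFinset h.toFinset (fun b => (starRingEnd ℂ) (f b b')) (by simp)
  else 0

/-- The default value 0 of `adj` concerns rows with infinitely many nonzero entries;
`IsUnitary.finite` excludes them in the codomain type. -/
theorem adj_apply {f : Basis → Vec} {b' : Basis} (h : {b | f b b' ≠ 0}.Finite) (b : Basis) :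
    adj f b' b = (starRingEnd ℂ) (f b b') := by
  simp [adj, h]

theorem ne_zero_of_adj_ne_zero {f : Basis → Vec} {b b' : Basis} (h : adj f b' b ≠ 0) :
    f b b' ≠ 0 := by
  unfold adj at h
  split_ifs at h
  · simpa using h
  · simp at h

/-- `f` restricts to a unitary from the closed basis values of type `A` to those of type `B`, and
the entries of its matrix in the rows of type `B` vanish outside of the columns of type `A`. -/
structure IsUnitary (f : Basis → Vec) (A B : Ty) : Prop where
  mem : ∀ {b}, Closed A b → f b ∈ B.vecs
  finite : ∀ {b'}, Closed B b' → {b | f b b' ≠ 0}.Finite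
  closed : ∀ {b b'}, Closed B b' → f b b' ≠ 0 → Closed A b
  inner : ∀ {b₁ b₂}, Closed A b₁ → Closed A b₂ → ip (f b₁) (f b₂) = ip (bvec b₁) (bvec b₂)
  surj : ∀ {b'}, Closed B b' → ∃ v ∈ A.vecs, lin f v = bvec b'

theorem Ty.vecs_eq_span (A : Ty) : A.vecs = Submodule.span ℂ (bvec '' {b | Closed A b}) :=
  Finsupp.supported_eq_span_single ℂ _

theorem lin_lin (f g : Basis → Vec) (v : Vec) : lin f (lin g v) = lin (fun b => lin f (g b)) v := by
  rw [← LinearMap.comp_apply]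
  congr 1
  ext b
  simp

namespace IsUnitary

variable {f g : Basis → Vec} {A B C A' B' : Ty}

theorem inner_lin (h : IsUnitary f A B) {v w : Vec} (hv : v ∈ A.vecs) (hw : w ∈ A.vecs) :
    ip (lin f v) (lin f w) = ip v w :=
  ip_lin_eq fun b b' hb hb' => h.inner (Ty.mem_vecs.mp hv b hb) (Ty.mem_vecs.mp hw b' hb')

theorem surj_vecs (h : IsUnitary f A B) {w : Vec} (hw : w ∈ B.vecs) : ∃ v ∈ A.vecs, lin f v = w := by
  have : B.vecs ≤ A.vecs.map (lin f) := by
    rw [B.vecs_eq_span, Submodule.span_le]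
    rintro _ ⟨b', hb', rfl⟩
    exact h.surj hb'
  exact this hw

theorem exists_ne_zero (h : IsUnitary f A B) {b : Basis} (hb : Closed A b) :
    ∃ b', Closed B b' ∧ f b b' ≠ 0 := by
  have h₁ : ip (f b) (f b) = 1 := by rw [h.inner hb hb, ip_bvec_left, bvec_self]
  have h₂ : f b ≠ 0 := fun h => by simp [h] at h₁
  obtain ⟨b', hb'⟩ := Finsupp.ne_iff.mp h₂
  exact ⟨b', Ty.mem_vecs.mp (h.mem hb) b' hb', hb'⟩

/-- A column of type `A` has a nonzero entry in some row of type `B`, and such a row only meets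
columns of type `A'`. -/
theorem dom_eq (h : IsUnitary f A B) (h' : IsUnitary f A' B) : A = A' :=
  Ty.eq_of_closed_imp fun _ hb =>
    let ⟨_, hb', hne⟩ := h.exists_ne_zero hb
    h'.closed hb' hne

/-- The coefficient at `b₀` is the inner product of `f b₀` with the image of `v`. If `b₀` has type
`A`, isometry turns it into `v b₀`. Otherwise column `b₀` vanishes in all rows of type `B`, by the
field `closed`, and both coefficients are 0. -/
theorem adj_lin (h : IsUnitary f A B) {v : Vec} (hv : v ∈ A.vecs) : lin (adj f) (lin f v) = v := by
  ext b₀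
  have hw : lin f v ∈ B.vecs := lin_mem (fun _ => h.mem) hv
  have key : lin (adj f) (lin f v) b₀ = ip (f b₀) (lin f v) := by
    rw [lin_apply, ← ip_conj, ip, Finsupp.sum, Finsupp.sum, map_sum]
    refine Finset.sum_congr rfl fun b' hb' => ?_
    rw [adj_apply (h.finite (Ty.mem_vecs.mp hw b' (Finsupp.mem_support_iff.mp hb')))]
    simp
  rw [key]
  by_cases hb₀ : Closed A b₀
  · rw [← lin_bvec f b₀, h.inner_lin (bvec_mem hb₀) hv, ip_bvec_left]
  · have h₁ : v b₀ = 0 := by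
      by_contra h'
      exact hb₀ (Ty.mem_vecs.mp hv b₀ h')
    rw [h₁, ← ip_conj, ip, Finsupp.sum, map_sum]
    refine Finset.sum_eq_zero fun b' hb' => ?_
    have : f b₀ b' = 0 := by
      by_contra h'
      exact hb₀ (h.closed (Ty.mem_vecs.mp hw b' (Finsupp.mem_support_iff.mp hb')) h')
    simp [this]

theorem lin_adj (h : IsUnitary f A B) {w : Vec} (hw : w ∈ B.vecs) : lin f (lin (adj f) w) = w := by
  obtain ⟨v, hv, rfl⟩ := h.surj_vecs hw
  rw [h.adj_lin hv]

theorem adj_mem (h : IsUnitary f A B) {b' : Basis} (hb' : Closed B b') : adj f b' ∈ A.vecs :=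
  Ty.mem_vecs.mpr fun _ hb => h.closed hb' (ne_zero_of_adj_ne_zero hb)

protected theorem adj (h : IsUnitary f A B) : IsUnitary (adj f) B A where
  mem := h.adj_mem
  finite {b} _ := (f b).support.finite_toSet.subset fun _ hb' =>
    Finsupp.mem_support_iff.mpr (ne_zero_of_adj_ne_zero hb')
  closed hb hb' := Ty.mem_vecs.mp (h.mem hb) _ (ne_zero_of_adj_ne_zero hb')
  inner h₁ h₂ := by
    rw [← h.inner_lin (h.adj_mem h₁) (h.adj_mem h₂), ← lin_bvec (QControl.adj f),
      ← lin_bvec (QControl.adj f), h.lin_adj (bvec_mem h₁), h.lin_adj (bvec_mem h₂)]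
  surj {b} hb := ⟨f b, h.mem hb, by rw [← lin_bvec f, h.adj_lin (bvec_mem hb)]⟩

protected theorem comp (hf : IsUnitary f A B) (hg : IsUnitary g B C) :
    IsUnitary (fun b => lin g (f b)) A C where
  mem hb := lin_mem (fun _ => hg.mem) (hf.mem hb)
  finite {c} hc := by
    -- The guard `Closed B b` makes every set of the union finite whatever `b` is; it excludes
    -- nothing, since row `c` of `g` only meets columns of type `B`.
    refine ((hg.finite hc).biUnion (t := fun b => {a | Closed B b ∧ f a b ≠ 0})
      fun b _ => ?_).subset fun a ha => ?_
    · by_cases hb : Closed B b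
      · simpa [hb] using hf.finite hb
      · simp [hb]
    · obtain ⟨b, h₁, h₂⟩ := lin_ne_zero ha
      exact Set.mem_biUnion (x := b) h₂ ⟨hg.closed hc h₂, h₁⟩
  closed hc ha := by
    obtain ⟨b, h₁, h₂⟩ := lin_ne_zero ha
    exact hf.closed (hg.closed hc h₂) h₁
  inner h₁ h₂ := by rw [hg.inner_lin (hf.mem h₁) (hf.mem h₂), hf.inner h₁ h₂]
  surj hc := by
    obtain ⟨w, hw, h⟩ := hg.surj hc
    obtain ⟨v, hv, rfl⟩ := hf.surj_vecs hw
    exact ⟨v, hv, by rw [← h, lin_lin]⟩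

end IsUnitary

/-- The action of `ω₁ ⊗ ω₂`. -/
def tensorAct (f g : Basis → Vec) : Basis → Vec
  | .pair b b' => tp (f b) (g b')
  | _ => 0

/-- The action of `ω₁ ⊕ ω₂`. -/
def oplusAct (f g : Basis → Vec) : Basis → Vec
  | .inl b => mapB .inl (f b)
  | .inr b => mapB .inr (g b)
  | _ => 0

/-- The action of `ctrl ω`. -/
def ctrlAct (f : Basis → Vec) : Basis → Vec
  | .pair (.inl .unit) b => mapB (.pair (.inl .unit)) (bvec b)
  | .pair (.inr .unit) b => mapB (.pair (.inr .unit)) (f b)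
  | _ => 0

/-- The action of a unitary abstraction. -/
def absAct (n : ℕ) (b : Fin n → Basis) (e : Fin n → Expr) (c : Basis) : Vec :=
  open Classical in
  if h : ∃ p : Fin n × (Var → Basis), (b p.1).inst p.2 = c then
    exprEv h.choose.2 (e h.choose.1)
  else 0

/-- The action of a unitary on basis values. -/
def Unitary.act : Unitary → Basis → Vec
  | .abs n b e => absAct n b e
  | .tensor ω₁ ω₂ => tensorAct ω₁.act ω₂.act
  | .oplus ω₁ ω₂ => oplusAct ω₁.act ω₂.act
  | .comp ω₂ ω₁ => fun b => lin ω₂.act (ω₁.act b)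
  | .inv ω => adj ω.act
  | .ctrl ω => ctrlAct ω.act

theorem tensorAct_ne_zero {f g : Basis → Vec} {b b' : Basis} (h : tensorAct f g b b' ≠ 0) :
    ∃ b₁ b₂ b₁' b₂', b = .pair b₁ b₂ ∧ b' = .pair b₁' b₂' ∧ f b₁ b₁' ≠ 0 ∧ g b₂ b₂' ≠ 0 := by
  unfold tensorAct at h
  split at h
  · obtain ⟨b₁, b₂, h₁, h₂, rfl⟩ := tp_ne_zero h
    exact ⟨_, _, _, _, rfl, rfl, h₁, h₂⟩
  · simp at h

theorem lin_tensorAct (f g : Basis → Vec) (v w : Vec) :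
    lin (tensorAct f g) (tp v w) = tp (lin f v) (lin g w) := by
  induction v using vec_induction with
  | zero => simp
  | add v₁ v₂ h₁ h₂ => simp only [map_add, LinearMap.add_apply, h₁, h₂]
  | smul a b =>
  induction w using vec_induction with
  | zero => simp
  | add v₁ v₂ h₁ h₂ => simp only [map_add, h₁, h₂]
  | smul a' b' => simp only [map_smul, LinearMap.smul_apply, tp_bvec, lin_bvec]; rfl

theorem lin_mapB {f g : Basis → Vec} {c c' : Basis → Basis} (h : ∀ b, f (c b) = mapB c' (g b))
    (v : Vec) : lin f (mapB c v) = mapB c' (lin g v) := by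
  rw [mapB, lin_lin, mapB, lin_lin]
  simp only [lin_bvec, h]
  rfl

theorem IsUnitary.tensor {f g : Basis → Vec} {A B A' B' : Ty} (hf : IsUnitary f A B)
    (hg : IsUnitary g A' B') : IsUnitary (tensorAct f g) (.tensor A A') (.tensor B B') where
  mem hb := by
    cases hb with | pair h₁ h₂ => exact tp_mem (hf.mem h₁) (hg.mem h₂)
  finite hb := by
    cases hb with | pair h₁ h₂ =>
    refine ((hf.finite h₁).image2 Basis.pair (hg.finite h₂)).subset fun b hb => ?_
    obtain ⟨b₁, b₂, b₁', b₂', rfl, h, h₁', h₂'⟩ := tensorAct_ne_zero hb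
    cases h
    exact ⟨b₁, h₁', b₂, h₂', rfl⟩
  closed hb h := by
    obtain ⟨b₁, b₂, b₁', b₂', rfl, rfl, h₁', h₂'⟩ := tensorAct_ne_zero h
    cases hb with | pair h₁ h₂ => exact .pair (hf.closed h₁ h₁') (hg.closed h₂ h₂')
  inner hb hb' := by
    cases hb with | pair h₁ h₂ => cases hb' with | pair h₁' h₂' =>
    rw [tensorAct, tensorAct, ip_tp, hf.inner h₁ h₁', hg.inner h₂ h₂', ← ip_tp, tp_bvec, tp_bvec]
  surj hb := by
    cases hb with | pair h₁ h₂ =>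
    obtain ⟨v, hv, h⟩ := hf.surj h₁
    obtain ⟨w, hw, h'⟩ := hg.surj h₂
    exact ⟨tp v w, tp_mem hv hw, by rw [lin_tensorAct, h, h', tp_bvec]⟩

theorem IsUnitary.oplus {f g : Basis → Vec} {A B A' B' : Ty} (hf : IsUnitary f A B)
    (hg : IsUnitary g A' B') : IsUnitary (oplusAct f g) (.oplus A A') (.oplus B B') where
  mem hb := by
    cases hb with
    | inl h => exact mapB_mem (fun _ => .inl) (hf.mem h)
    | inr h => exact mapB_mem (fun _ => .inr) (hg.mem h)
  finite hb := by
    cases hb with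
    | inl h =>
      refine ((hf.finite h).image Basis.inl).subset fun b hb => ?_
      simp only [Set.mem_ofPred_eq] at hb
      unfold oplusAct at hb
      split at hb
      · exact ⟨_, by simpa [mapB_apply inl_injective] using hb, rfl⟩
      · obtain ⟨_, _, h⟩ := mapB_ne_zero hb
        cases h
      · simp at hb
    | inr h =>
      refine ((hg.finite h).image Basis.inr).subset fun b hb => ?_
      simp only [Set.mem_ofPred_eq] at hb
      unfold oplusAct at hb
      split at hb
      · obtain ⟨_, _, h⟩ := mapB_ne_zero hb
        cases h
      · exact ⟨_, by simpa [mapB_apply inr_injective] using hb, rfl⟩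
      · simp at hb
  closed hb h := by
    unfold oplusAct at h
    split at h
    · obtain ⟨_, h', rfl⟩ := mapB_ne_zero h
      cases hb with | inl hb => exact .inl (hf.closed hb h')
    · obtain ⟨_, h', rfl⟩ := mapB_ne_zero h
      cases hb with | inr hb => exact .inr (hg.closed hb h')
    · simp at h
  inner hb hb' := by
    cases hb with
    | inl h =>
      cases hb' with
      | inl h' => rw [oplusAct, oplusAct, ip_mapB inl_injective, hf.inner h h', ← mapB_bvec,
          ← mapB_bvec, ip_mapB inl_injective]
      | inr h' => rw [oplusAct, oplusAct, ← mapB_bvec, ← mapB_bvec, ip_mapB_mapB (by simp),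
          ip_mapB_mapB (by simp)]
    | inr h =>
      cases hb' with
      | inr h' => rw [oplusAct, oplusAct, ip_mapB inr_injective, hg.inner h h', ← mapB_bvec,
          ← mapB_bvec, ip_mapB inr_injective]
      | inl h' => rw [oplusAct, oplusAct, ← mapB_bvec, ← mapB_bvec, ip_mapB_mapB (by simp),
          ip_mapB_mapB (by simp)]
  surj hb := by
    cases hb with
    | inl h =>
      obtain ⟨v, hv, h⟩ := hf.surj h
      exact ⟨mapB .inl v, mapB_mem (fun _ => .inl) hv,
        by rw [lin_mapB (c' := .inl) (g := f) (fun _ => rfl), h, mapB_bvec]⟩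
    | inr h =>
      obtain ⟨v, hv, h⟩ := hg.surj h
      exact ⟨mapB .inr v, mapB_mem (fun _ => .inr) hv,
        by rw [lin_mapB (c' := .inr) (g := g) (fun _ => rfl), h, mapB_bvec]⟩

theorem pair_injective (b : Basis) : Function.Injective (Basis.pair b) :=
  fun _ _ h => by injection h

theorem IsUnitary.ctrl {f : Basis → Vec} {A : Ty} (hf : IsUnitary f A A) :
    IsUnitary (ctrlAct f) (.tensor (.oplus .unit .unit) A) (.tensor (.oplus .unit .unit) A) where
  mem hb := by
    cases hb with | pair h₁ h₂ =>
    cases h₁ with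
    | inl h => cases h; exact mapB_mem (fun _ => .pair (.inl .unit)) (bvec_mem h₂)
    | inr h => cases h; exact mapB_mem (fun _ => .pair (.inr .unit)) (hf.mem h₂)
  finite hb := by
    cases hb with | @pair _ _ b₁' b₂' h₁ h₂ =>
    refine ((Set.finite_singleton (Basis.pair b₁' b₂')).union
      ((hf.finite h₂).image (Basis.pair (.inr .unit)))).subset fun b hb => ?_
    simp only [Set.mem_ofPred_eq] at hb
    unfold ctrlAct at hb
    split at hb
    · rw [mapB_bvec] at hb
      refine .inl ?_
      classical
      by_contra hne
      exact hb ((bvec_apply _ _).trans (if_neg hne))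
    · obtain ⟨_, h', h⟩ := mapB_ne_zero hb
      cases h
      exact .inr ⟨_, h', rfl⟩
    · simp at hb
  closed hb h := by
    unfold ctrlAct at h
    split at h
    · rw [mapB_bvec] at h
      classical
      rw [bvec_apply] at h
      split_ifs at h with hh
      · rw [hh]; exact hb
      · simp at h
    · obtain ⟨_, h', rfl⟩ := mapB_ne_zero h
      cases hb with | pair h₁ h₂ => exact .pair h₁ (hf.closed h₂ h')
    · simp at h
  inner hb hb' := by
    cases hb with | pair h₁ h₂ => cases hb' with | pair h₁' h₂' =>
    cases h₁ with
    | inl h =>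
      cases h
      cases h₁' with
      | inl h' => cases h'; rw [ctrlAct, ctrlAct, mapB_bvec, mapB_bvec]
      | inr h' =>
        cases h'
        rw [ctrlAct, ctrlAct, ip_mapB_mapB (by simp), ← mapB_bvec, ← mapB_bvec,
          ip_mapB_mapB (by simp)]
    | inr h =>
      cases h
      cases h₁' with
      | inl h' =>
        cases h'
        rw [ctrlAct, ctrlAct, ip_mapB_mapB (by simp), ← mapB_bvec, ← mapB_bvec,
          ip_mapB_mapB (by simp)]
      | inr h' =>
        cases h'
        rw [ctrlAct, ctrlAct, ip_mapB (pair_injective _), hf.inner h₂ h₂', ← mapB_bvec,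
          ← mapB_bvec, ip_mapB (pair_injective _)]
  surj hb := by
    cases hb with | pair h₁ h₂ =>
    cases h₁ with
    | inl h =>
      cases h
      exact ⟨_, bvec_mem (.pair (.inl .unit) h₂), by rw [lin_bvec, ctrlAct, mapB_bvec]⟩
    | inr h =>
      cases h
      obtain ⟨v, hv, h⟩ := hf.surj h₂
      exact ⟨mapB (.pair (.inr .unit)) v, mapB_mem (fun _ => .pair (.inr .unit)) hv,
        by rw [lin_mapB (c' := .pair (.inr .unit)) (g := f) (fun _ => rfl), h, mapB_bvec]⟩

/-! ## Unitary abstractions -/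

/-- A vector orthogonal to `X` is orthogonal to everything `X` spans, here to `bvec b`. This turns
spanning into exhaustiveness of patterns and into finiteness of rows. -/
theorem exists_ip_ne_zero {b : Basis} {X : Set Vec} (h : bvec b ∈ Submodule.span ℂ X) {v : Vec}
    (hv : v b ≠ 0) : ∃ x ∈ X, ip v x ≠ 0 := by
  by_contra hX
  push Not at hX
  have : ∀ w ∈ Submodule.span ℂ X, ip v w = 0 := by
    intro w hw
    induction hw using Submodule.span_induction with
    | mem x hx => exact hX x hx
    | zero => simp
    | add x y _ _ hx hy => rw [ip_add_right, hx, hy, add_zero]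
    | smul a x _ hx => rw [ip_smul_right, hx, mul_zero]
  have := this _ h
  rw [ip_bvec_right] at this
  exact hv (by simpa using this)

section Abs

variable {A : Ty} {n : ℕ} {e : Fin n → Expr} {Δ : Fin n → Ctx}

/-- The assignments need not respect types, because expressions contain no unitaries to be
evaluated. This generality is used for `absAct`, whose chosen assignment is arbitrary. -/
theorem ip_clause (de : ∀ i, ExprDer (Δ i) (e i) A) (he : Function.Injective e)
    (hO : ODe A (Set.range e)) {i j : Fin n} {σ τ : Var → Basis}
    (h : ip (exprEv σ (e i)) (exprEv τ (e j)) ≠ 0) :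
    i = j ∧ ∀ x ∈ (e i).fv, σ x = τ x := by
  have hij : i = j := by
    by_contra hij
    exact h ((hO.orth ⟨i, rfl⟩ ⟨j, rfl⟩ (he.ne hij)).evOrthogonal .of_isEmpty (de i) (de j)
      (.inl inferInstance) (.inl inferInstance))
  subst hij
  refine ⟨rfl, ?_⟩
  by_contra hσ
  exact h (((e i).evOrthonormal .of_isEmpty (de i) (de i)
      (.inl inferInstance) (.inl inferInstance)).2 hσ)

theorem ip_clause_self (de : ∀ i, ExprDer (Δ i) (e i) A) (i : Fin n) (σ : Var → Basis) :
    ip (exprEv σ (e i)) (exprEv σ (e i)) = 1 :=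
  ((e i).evOrthonormal .of_isEmpty (de i) (de i)
      (.inl inferInstance) (.inl inferInstance)).1 fun _ _ => rfl

theorem mem_span_clauses (de : ∀ i, ExprDer (Δ i) (e i) A) (hO : ODe A (Set.range e)) {b : Basis}
    (hb : Closed A b) :
    bvec b ∈ Submodule.span ℂ {v | ∃ i σ, Sat σ (Δ i) ∧ v = exprEv σ (e i)} := by
  refine Submodule.span_mono ?_ (hO.mem_span ?_ hb)
  · rintro _ ⟨_, ⟨i, rfl⟩, σ, hσ, rfl⟩
    exact ⟨i, σ, hσ _ (de i), rfl⟩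
  · rintro _ ⟨i, rfl⟩
    exact ⟨_, ⟨de i⟩⟩

variable {b : Fin n → Basis}

theorem range_toTm (b : Fin n → Basis) :
    Set.range (fun i => ((b i).toTm : Expr)) = Basis.toTm '' Set.range b :=
  Set.range_comp Basis.toTm b

/-- Matching is unambiguous: instances of patterns are basis vectors, so equal ones have inner
product 1, which `ip_clause` allows only for the same clause and the same assignment of its
variables. -/
theorem inst_eq_inst (db : ∀ i, ExprDer (Δ i) (b i).toTm A) (hb : Function.Injective b)
    (hO : OD A (Set.range b)) {i j : Fin n} {σ τ : Var → Basis}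
    (h : (b i).inst σ = (b j).inst τ) : i = j ∧ ∀ x ∈ ((b i).toTm : Expr).fv, σ x = τ x := by
  refine ip_clause (e := fun i => (b i).toTm) db (Basis.toTm_injective.comp hb)
    (by rw [range_toTm]; exact hO.toODe) ?_
  simp only [exprEv, Tm.ev_toTm, h, ip_bvec_left, bvec_self]
  exact one_ne_zero

/-- Matching is exhaustive: the closed instances span, so one of them is not orthogonal to `c`;
being a basis vector, it is that of `c`. -/
theorem exists_inst_eq (db : ∀ i, ExprDer (Δ i) (b i).toTm A) (hO : OD A (Set.range b))
    {c : Basis} (hc : Closed A c) : ∃ i σ, Sat σ (Δ i) ∧ (b i).inst σ = c := by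
  have h := mem_span_clauses (e := fun i => (b i).toTm) db (by rw [range_toTm]; exact hO.toODe) hc
  obtain ⟨_, ⟨i, σ, hσ, rfl⟩, h'⟩ := exists_ip_ne_zero h (v := bvec c) (by simp [bvec_self])
  refine ⟨i, σ, hσ, ?_⟩
  simp only [exprEv, Tm.ev_toTm, ip_bvec_left] at h'
  classical
  by_contra hne
  exact h' (by rw [bvec_apply, if_neg hne])

/-- Since matching is unambiguous, the arbitrary choice made by `absAct` does not affect the result;
the right-hand side has no variables beyond those of the pattern. -/
theorem absAct_inst {B : Ty} (db : ∀ i, ExprDer (Δ i) (b i).toTm A)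
    (de : ∀ i, ExprDer (Δ i) (e i) B) (hb : Function.Injective b) (hO : OD A (Set.range b))
    (i : Fin n) (σ : Var → Basis) : absAct n b e ((b i).inst σ) = exprEv σ (e i) := by
  have h : ∃ p : Fin n × (Var → Basis), (b p.1).inst p.2 = (b i).inst σ := ⟨(i, σ), rfl⟩
  rw [absAct, dif_pos h]
  have h' := h.choose_spec
  obtain ⟨h₁, h₂⟩ := inst_eq_inst db hb hO h'
  rw [h₁]
  refine Tm.ev_congr _ _ fun x hx => h₂ x ?_
  rw [h₁, (db i).mem_fv, ← (de i).mem_fv]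
  exact hx

theorem absAct_ne_zero {c c' : Basis} (h : absAct n b e c c' ≠ 0) :
    ∃ i σ, (b i).inst σ = c := by
  unfold absAct at h
  split_ifs at h with h'
  · exact ⟨_, _, h'.choose_spec⟩
  · simp at h

theorem isUnitary_absAct {B : Ty} (db : ∀ i, ExprDer (Δ i) (b i).toTm A)
    (de : ∀ i, ExprDer (Δ i) (e i) B) (hb : Function.Injective b) (he : Function.Injective e)
    (hO : OD A (Set.range b)) (hO' : ODe B (Set.range e)) : IsUnitary (absAct n b e) A B := by
  have inst_closed : ∀ i σ, Sat σ (Δ i) → Closed A ((b i).inst σ) := fun i σ hσ => by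
    have := (db i).ev_mem (F := fun u => u.elim) .of_isEmpty hσ
    rw [Tm.ev_toTm] at this
    exact Ty.mem_vecs.mp this _ (by simp [bvec_self])
  have inst_congr : ∀ i σ τ, (∀ x ∈ (e i).fv, σ x = τ x) → (b i).inst σ = (b i).inst τ :=
    fun i σ τ h => Basis.inst_congr _ fun x hx => h x (by
      rwa [(de i).mem_fv, ← (db i).mem_fv])
  have mem : ∀ {c}, Closed A c → absAct n b e c ∈ B.vecs := fun {c} hc => by
    obtain ⟨i, σ, hσ, rfl⟩ := exists_inst_eq db hO hc
    rw [absAct_inst db de hb hO]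
    exact (de i).ev_mem .of_isEmpty hσ
  have inner : ∀ {c c'}, Closed A c → Closed A c' →
      ip (absAct n b e c) (absAct n b e c') = ip (bvec c) (bvec c') := fun {c c'} hc hc' => by
    obtain ⟨i, σ, hσ, rfl⟩ := exists_inst_eq db hO hc
    obtain ⟨j, τ, hτ, rfl⟩ := exists_inst_eq db hO hc'
    rw [absAct_inst db de hb hO, absAct_inst db de hb hO]
    by_cases h : (b i).inst σ = (b j).inst τ
    · obtain ⟨rfl, h'⟩ := inst_eq_inst db hb hO h
      rw [← h, ip_bvec_left, bvec_self, ← ip_clause_self de i σ]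
      congr 1
      exact Tm.ev_congr _ _ fun x hx => (h' x (by rwa [(db i).mem_fv, ← (de i).mem_fv])).symm
    · have : ip (exprEv σ (e i)) (exprEv τ (e j)) = 0 := by
        by_contra h'
        obtain ⟨rfl, hστ⟩ := ip_clause de he hO' h'
        exact h (inst_congr i σ τ hστ)
      classical
      rw [this, ip_bvec_right, bvec_apply, if_neg h, map_zero]
  -- every row meets only finitely many columns, all of type `A`
  have row : ∀ {c'}, Closed B c' → ∃ T : Set Basis, T.Finite ∧ (∀ c ∈ T, Closed A c) ∧
      ∀ c, absAct n b e c c' ≠ 0 → c ∈ T := fun {c'} hc' => by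
    -- Finitely many closed instances suffice to span the basis vector of `c'`. A column meeting
    -- this row is an instance not orthogonal to some member of `X`, hence comes from the same
    -- clause and assignment. The map `g` below recovers the pattern instance from a member of `X`;
    -- its value off `X` is irrelevant.
    obtain ⟨X, hX, hc'X⟩ := Submodule.mem_span_finite_of_mem_span (mem_span_clauses de hO' hc')
    have hX' : ∀ v, ∃ c, v ∈ X → ∃ i σ, Sat σ (Δ i) ∧ v = exprEv σ (e i) ∧ (b i).inst σ = c := by
      intro v
      by_cases hv : v ∈ X
      · obtain ⟨i, σ, hσ, h⟩ := hX hv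
        exact ⟨_, fun _ => ⟨i, σ, hσ, h, rfl⟩⟩
      · exact ⟨.unit, fun h => absurd h hv⟩
    choose g hg using hX'
    refine ⟨g '' X, X.finite_toSet.image _, ?_, ?_⟩
    · rintro _ ⟨v, hv, rfl⟩
      obtain ⟨i, σ, hσ, -, h⟩ := hg v hv
      rw [← h]
      exact inst_closed _ _ hσ
    · intro c hc
      obtain ⟨j, τ, rfl⟩ := absAct_ne_zero hc
      rw [absAct_inst db de hb hO] at hc
      obtain ⟨v, hvX, hne⟩ := exists_ip_ne_zero hc'X hc
      obtain ⟨i, σ, -, hv, h⟩ := hg v hvX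
      rw [hv] at hne
      obtain ⟨rfl, h₂⟩ := ip_clause de he hO' hne
      exact ⟨v, hvX, by rw [← h, inst_congr j _ _ h₂]⟩
  refine ⟨mem, ?_, ?_, inner, ?_⟩
  · intro c' hc'
    obtain ⟨T, hT, -, h⟩ := row hc'
    exact hT.subset h
  · intro c c' hc' hne
    obtain ⟨T, -, hT, h⟩ := row hc'
    exact hT c (h c hne)
  · intro c' hc'
    refine (Submodule.span_le (p := A.vecs.map (lin (absAct n b e)))).mpr ?_
      (mem_span_clauses de hO' hc')
    rintro _ ⟨i, σ, hσ, rfl⟩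
    exact ⟨_, bvec_mem (inst_closed i σ hσ), by rw [lin_bvec, absAct_inst db de hb hO]⟩

end Abs

/-! ### Well-typed unitaries and the vectors of closed terms -/

theorem UDer.isUnitary {ω : Unitary} {A B : Ty} (u : UDer ω A B) : IsUnitary ω.act A B := by
  induction u with
  | abs Δ db de hb he ODb ODe => exact isUnitary_absAct db de hb he ODb ODe
  | inv u ih => exact ih.adj
  | comp u₁ u₂ ih₁ ih₂ => exact ih₁.comp ih₂
  | tensor u₁ u₂ ih₁ ih₂ => exact ih₁.tensor ih₂
  | oplus u₁ u₂ ih₁ ih₂ => exact ih₁.oplus ih₂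
  | ctrl u ih => exact ih.ctrl

theorem isometricAction_act : IsometricAction UDer Unitary.act where
  mem u _ hb := u.isUnitary.mem hb
  inner u _ _ hb hb' := u.isUnitary.inner hb hb'
  dom u u' := u.isUnitary.dom_eq u'.isUnitary

/-- The vector denoted by a closed term. -/
def Tm.vec (t : Term) : Vec := t.ev Unitary.act Basis.var

theorem TermDer.vec_mem {t : Term} {A : Ty} (d : TermDer [] t A) : t.vec ∈ A.vecs :=
  Der.ev_mem isometricAction_act d (.nil _)

theorem TermDer.ip_vec_self {t : Term} {A : Ty} (d : TermDer [] t A) : ip t.vec t.vec = 1 :=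
  (t.evOrthonormal isometricAction_act d d (.inr (.nil _)) (.inr (.nil _))).1 fun _ _ => rfl

theorem Orth.ip_vec {t t' : Term} (h : Orth t t') {A : Ty} (d : TermDer [] t A)
    (d' : TermDer [] t' A) : ip t.vec t'.vec = 0 :=
  h.evOrthogonal isometricAction_act d d' (.inr (.nil _)) (.inr (.nil _))

end QControl

end

noncomputable section

namespace QControl

/-! ## Soundness of the equational theory -/

theorem Basis.inst_var (b : Basis) : b.inst Basis.var = b := by
  induction b with
  | unit => rfl
  | var x => rfl
  | inl b ih => simp [Basis.inst, ih]
  | inr b ih => simp [Basis.inst, ih]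
  | pair b b' ih ih' => simp [Basis.inst, ih, ih']
  | zero => rfl
  | succ b ih => simp [Basis.inst, ih]

theorem vec_toTm (b : Basis) : (b.toTm : Term).vec = bvec b := by
  rw [Tm.vec, Tm.ev_toTm, b.inst_var]

theorem vec_unit : (Tm.unit : Term).vec = bvec .unit := rfl
theorem vec_inl (t : Term) : t.inl.vec = mapB .inl t.vec := rfl
theorem vec_inr (t : Term) : t.inr.vec = mapB .inr t.vec := rfl
theorem vec_succ (t : Term) : t.succ.vec = mapB .succ t.vec := rfl
theorem vec_pair (t t' : Term) : (t.pair t').vec = tp t.vec t'.vec := rfl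
theorem vec_app (ω : Unitary) (t : Term) : (Tm.app ω t).vec = lin ω.act t.vec := rfl
theorem vec_sum (n : ℕ) (α : Fin n → ℂ) (t : Fin n → Term) :
    (Tm.sum n α t).vec = ∑ i, α i • (t i).vec := rfl

theorem TermDer.closed {b : Basis} {A : Ty} (d : TermDer [] b.toTm A) : Closed A b := by
  have := d.vec_mem
  rw [vec_toTm] at this
  exact Ty.mem_vecs.mp this b (by simp [bvec_self])

theorem Expr.ev_toTerm (σ : Var → Basis) (e : Expr) :
    (Expr.toTerm e).ev Unitary.act σ = exprEv σ e := by
  induction e with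
  | unit => rfl
  | var x => rfl
  | inl e ih => simp [Expr.toTerm, Tm.ev, ih]
  | inr e ih => simp [Expr.toTerm, Tm.ev, ih]
  | pair e e' ih ih' => simp [Expr.toTerm, Tm.ev, ih, ih']
  | zero => rfl
  | succ e ih => simp [Expr.toTerm, Tm.ev, ih]
  | app u e => exact u.elim
  | sum n α e ih => simp [Expr.toTerm, Tm.ev, ih]

theorem Expr.toTerm_toTm (b : Basis) : Expr.toTerm (b.toTm : Expr) = b.toTm := by
  induction b with
  | unit => rfl
  | var x => rfl
  | inl b ih => simp [Expr.toTerm, Basis.toTm, ih]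
  | inr b ih => simp [Expr.toTerm, Basis.toTm, ih]
  | pair b b' ih ih' => simp [Expr.toTerm, Basis.toTm, ih, ih']
  | zero => rfl
  | succ b ih => simp [Expr.toTerm, Basis.toTm, ih]

/-- The valuation `σ` assigns to the variables in `X` the values given by `τ`. -/
def Agrees (σ : Valuation) (τ : Var → Basis) (X : Set Var) : Prop :=
  ∀ x ∈ X, σ x = some (τ x).toTm

theorem Expr.ev_subst {σ : Valuation} {τ : Var → Basis} {e : Expr} (h : Agrees σ τ e.fv) :
    exprEv Basis.var (Expr.subst σ e) = exprEv τ e := by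
  induction e with
  | unit => rfl
  | var x =>
    rw [Expr.subst, h x rfl, Option.getD_some, exprEv, Tm.ev_toTm, Basis.inst_var]
    rfl
  | inl e ih => simp only [exprEv, Expr.subst, Tm.ev] at ih ⊢; rw [ih h]
  | inr e ih => simp only [exprEv, Expr.subst, Tm.ev] at ih ⊢; rw [ih h]
  | pair e e' ih ih' =>
    simp only [exprEv, Expr.subst, Tm.ev] at ih ih' ⊢
    rw [ih fun x hx => h x (.inl hx), ih' fun x hx => h x (.inr hx)]
  | zero => rfl
  | succ e ih => simp only [exprEv, Expr.subst, Tm.ev] at ih ⊢; rw [ih h]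
  | app u e => exact u.elim
  | sum n α e ih =>
    simp only [exprEv, Expr.subst, Tm.ev] at ih ⊢
    exact Finset.sum_congr rfl fun i _ => by
      rw [ih i fun x hx => h x (Set.mem_iUnion.mpr ⟨i, hx⟩)]

theorem Matches.exists_agrees {σ : Valuation} {b b' : Basis} (h : Matches σ b b') :
    ∃ τ, Agrees σ τ (b.toTm : Expr).fv ∧ b.inst τ = b' := by
  induction h with
  | unit => exact ⟨fun _ => .unit, fun x hx => hx.elim, rfl⟩
  | zero => exact ⟨fun _ => .unit, fun x hx => hx.elim, rfl⟩
  | var x b' => exact ⟨fun _ => b', fun y hy => if_pos hy, rfl⟩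
  | inl _ ih => exact ih.imp fun τ h => ⟨h.1, congrArg _ h.2⟩
  | inr _ ih => exact ih.imp fun τ h => ⟨h.1, congrArg _ h.2⟩
  | succ _ ih => exact ih.imp fun τ h => ⟨h.1, congrArg _ h.2⟩
  | @pair σ₁ σ₂ b₁ b₂ b₁' b₂' _ _ hdisj ih₁ ih₂ =>
    classical
    obtain ⟨τ₁, h₁, rfl⟩ := ih₁
    obtain ⟨τ₂, h₂, rfl⟩ := ih₂
    have hd : ∀ x ∈ (b₂.toTm : Expr).fv, x ∉ (b₁.toTm : Expr).fv := fun x hx hx' => by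
      rcases hdisj x with h | h
      · rw [h₁ x hx'] at h; cases h
      · rw [h₂ x hx] at h; cases h
    refine ⟨fun x => if x ∈ (b₁.toTm : Expr).fv then τ₁ x else τ₂ x, ?_, ?_⟩
    · rintro x (hx | hx)
      · simp only [h₁ x hx, if_pos hx, Option.some_or]
      · have : σ₁ x = none := (hdisj x).resolve_right (by rw [h₂ x hx]; simp)
        simp only [this, h₂ x hx, if_neg (hd x hx), Option.none_or]
    · simp only [Basis.inst]
      rw [Basis.inst_congr b₁ (σ' := τ₁) fun x hx => if_pos hx,
        Basis.inst_congr b₂ (σ' := τ₂) fun x hx => if_neg (hd x hx)]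

/-- That `σ` is undefined off the variables of the pattern is carried along for the disjointness
condition in the matching of pairs. -/
theorem exists_matches {Δ : Ctx} {A : Ty} {b : Basis} (d : ExprDer Δ b.toTm A) (τ : Var → Basis) :
    ∃ σ, Matches σ b (b.inst τ) ∧ Agrees σ τ (b.toTm : Expr).fv ∧
      ∀ x ∉ (b.toTm : Expr).fv, σ x = none := by
  induction b generalizing Δ A with
  | unit => exact ⟨_, .unit, fun x hx => hx.elim, fun _ _ => rfl⟩
  | zero => exact ⟨_, .zero, fun x hx => hx.elim, fun _ _ => rfl⟩
  | var x => exact ⟨_, .var x _, fun y hy => by rw [hy]; exact if_pos rfl, fun y hy => if_neg hy⟩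
  | inl b ih => cases d with | inl _ d => exact (ih d).imp fun σ h => ⟨.inl h.1, h.2⟩
  | inr b ih => cases d with | inr _ d => exact (ih d).imp fun σ h => ⟨.inr h.1, h.2⟩
  | succ b ih => cases d with | succ d => exact (ih d).imp fun σ h => ⟨.succ h.1, h.2⟩
  | pair b₁ b₂ ih₁ ih₂ =>
    cases d with | pair hΔ s d₁ d₂ =>
    obtain ⟨σ₁, m₁, h₁, n₁⟩ := ih₁ d₁
    obtain ⟨σ₂, m₂, h₂, n₂⟩ := ih₂ d₂
    have hd := d₁.fv_disjoint hΔ s d₂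
    refine ⟨_, .pair m₁ m₂ fun x => ?_, ?_, ?_⟩
    · by_cases hx : x ∈ (b₁.toTm : Expr).fv
      · exact .inr (n₂ x (hd x hx))
      · exact .inl (n₁ x hx)
    · rintro x (hx | hx)
      · simp only [h₁ x hx, Option.some_or]
      · have : x ∉ (b₁.toTm : Expr).fv := fun hx' => hd x hx' hx
        simp only [n₁ x this, h₂ x hx, Option.none_or]
    · intro x hx
      simp only [Basis.toTm, Tm.fv, Set.mem_union, not_or] at hx
      simp only [n₁ x hx.1, n₂ x hx.2, Option.none_or]

/-- Open terms are included because `Tm.vec` evaluates each variable to itself. Only the rules for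
abstractions and for inverses rely on typing; the others hold by linearity or by the definition of
the action. -/
theorem Eqn.vec_eq {Δ : Ctx} {t₁ t₂ : Term} {A : Ty} (h : Eqn Δ t₁ t₂ A) : t₁.vec = t₂.vec := by
  induction h with
  | refl => rfl
  | symm _ ih => exact ih.symm
  | trans _ _ ih ih' => exact ih.trans ih'
  | perm l d => exact (Equiv.sum_comp l _).symm
  | zero_scal d h => rw [vec_sum, vec_sum, Fin.sum_univ_castSucc, h, zero_smul, add_zero]
  | one_scal d => simp [vec_sum]
  | fubini d =>
    simp only [vec_sum, Finset.smul_sum, Finset.sum_smul, smul_smul]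
    exact Finset.sum_comm
  | double φ d =>
    simp only [vec_sum, Finset.smul_sum, smul_smul]
    rw [← Fintype.sum_sigma']
    exact (Equiv.sum_comp φ _).symm
  | app_linear u d => simp only [vec_app, vec_sum, map_sum, map_smul]
  | inl_linear d => simp only [vec_inl, vec_sum, map_sum, map_smul]
  | inr_linear d => simp only [vec_inr, vec_sum, map_sum, map_smul]
  | pair_linear_right _ _ d d' => simp only [vec_pair, vec_sum, map_sum, map_smul]
  | pair_linear_left _ _ d d' =>
    simp only [vec_pair, vec_sum, map_sum, map_smul, LinearMap.sum_apply, LinearMap.smul_apply]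
  | succ_linear d => simp only [vec_succ, vec_sum, map_sum, map_smul]
  | inl_congr _ ih => simp only [vec_inl, ih]
  | inr_congr _ ih => simp only [vec_inr, ih]
  | pair_congr_left _ _ _ _ ih => simp only [vec_pair, ih]
  | pair_congr_right _ _ _ _ ih => simp only [vec_pair, ih]
  | succ_congr _ ih => simp only [vec_succ, ih]
  | app_congr _ _ ih => simp only [vec_app, ih]
  | sum_congr _ _ ih => simp only [vec_sum, ih]
  | beta i d u m =>
    obtain ⟨τ, hτ, rfl⟩ := m.exists_agrees
    cases u with | abs Δ db de hb he ODb ODe =>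
    rw [vec_app, vec_toTm, lin_bvec, Tm.vec, Expr.ev_toTerm, Expr.ev_subst (τ := τ)]
    · exact absAct_inst db de hb ODb i τ
    · intro x hx
      exact hτ x (by rwa [(db i).mem_fv, ← (de i).mem_fv])
  | inv u d _ ih =>
    rw [vec_app, ← ih, vec_app, vec_toTm]
    exact u.isUnitary.adj_lin (bvec_mem d.closed)
  | comp u₁ u₂ d => simp only [vec_app, vec_toTm, lin_bvec, Unitary.act]
  | tensor u₁ u₂ d₁ d₂ =>
    simp only [vec_app, vec_pair, vec_toTm, tp_bvec, lin_bvec, Unitary.act, tensorAct]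
  | oplus_inl u₁ u₂ d =>
    simp only [vec_app, vec_inl, vec_toTm, mapB_bvec, lin_bvec, Unitary.act, oplusAct]
  | oplus_inr u₁ u₂ d =>
    simp only [vec_app, vec_inr, vec_toTm, mapB_bvec, lin_bvec, Unitary.act, oplusAct]
  | ctrl_inl u d =>
    simp only [vec_app, vec_pair, vec_inl, vec_unit, vec_toTm, mapB_bvec, tp_bvec, lin_bvec,
      Unitary.act, ctrlAct]
  | ctrl_inr u d =>
    simp only [vec_app, vec_pair, vec_inr, vec_unit, vec_toTm, mapB_bvec, tp_bvec, lin_bvec,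
      Unitary.act, ctrlAct]
    rw [tp, lin_bvec]

/-! ## Values -/

theorem Ctx.distinct_nil : Ctx.Distinct [] := List.nodup_nil

theorem Closed.nonempty_der {A : Ty} {b : Basis} (h : Closed A b) :
    Nonempty (TermDer [] b.toTm A) := by
  induction h with
  | unit => exact ⟨.unit⟩
  | inl _ ih => exact ih.map fun d => .inl _ d
  | inr _ ih => exact ih.map fun d => .inr _ d
  | pair _ _ ih ih' => exact ih.elim fun d => ih'.map fun d' => .pair Ctx.distinct_nil .nil d d'
  | zero => exact ⟨.zero⟩
  | succ _ ih => exact ih.map fun d => .succ d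

/-- A typing derivation of a closed basis value. -/
def Closed.der {A : Ty} {b : Basis} (h : Closed A b) : TermDer [] b.toTm A := h.nonempty_der.some

theorem Closed.orth {U : Type} {A : Ty} {b b' : Basis} (h : Closed A b) (h' : Closed A b')
    (hne : b ≠ b') : Orth (b.toTm : Tm U) b'.toTm := by
  induction h generalizing b' with
  | unit => cases h'; exact absurd rfl hne
  | inl _ ih =>
    cases h' with
    | inl h' => exact .inl (ih h' fun h => hne (by rw [h]))
    | inr h' => exact .inl_inr _ _
  | inr _ ih =>
    cases h' with
    | inl h' => exact (Orth.inl_inr _ _).symm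
    | inr h' => exact .inr (ih h' fun h => hne (by rw [h]))
  | @pair A B b₁ b₂ _ _ ih₁ ih₂ =>
    cases h' with | @pair _ _ b₁' b₂' h₁ h₂ =>
    by_cases h : b₁ = b₁'
    · exact .pair_right _ _ (ih₂ h₂ fun h' => hne (by rw [h, h']))
    · exact .pair_left _ _ (ih₁ h₁ h)
  | zero =>
    cases h' with
    | zero => exact absurd rfl hne
    | succ h' => exact .zero_succ _
  | succ _ ih =>
    cases h' with
    | zero => exact (Orth.zero_succ _).symm
    | succ h' => exact .succ (ih h' fun h => hne (by rw [h]))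

/-- An injective family of closed basis values of type `A` that covers the support of `v`. -/
structure Frame (A : Ty) (v : Vec) {n : ℕ} (c : Fin n → Basis) : Prop where
  inj : Function.Injective c
  closed : ∀ j, Closed A (c j)
  cover : ∀ b, v b ≠ 0 → ∃ j, c j = b

/-- The value with the coefficients of `v` at the family `c`. -/
def valTm (v : Vec) {n : ℕ} (c : Fin n → Basis) : Term :=
  .sum n (fun j => v (c j)) (fun j => (c j).toTm)

theorem Frame.ip_eq {A : Ty} {v w : Vec} {n : ℕ} {c : Fin n → Basis} (h : Frame A v c) :
    ip v w = ∑ j, (starRingEnd ℂ) (v (c j)) * w (c j) := by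
  classical
  rw [ip_eq_sum (s := Finset.univ.image c), Finset.sum_image fun _ _ _ _ h' => h.inj h']
  intro b hb
  obtain ⟨j, rfl⟩ := h.cover b (Finsupp.mem_support_iff.mp hb)
  simp

theorem Frame.lin_eq {A : Ty} {v : Vec} {n : ℕ} {c : Fin n → Basis} (h : Frame A v c)
    (f : Basis → Vec) : lin f v = ∑ j, v (c j) • f (c j) := by
  classical
  rw [Finsupp.linearCombination_apply, Finsupp.sum_of_support_subset (s := Finset.univ.image c),
    Finset.sum_image fun _ _ _ _ h' => h.inj h']
  · intro b hb
    obtain ⟨j, rfl⟩ := h.cover b (Finsupp.mem_support_iff.mp hb)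
    simp
  · simp

theorem Frame.sum_norm {A : Ty} {v : Vec} {n : ℕ} {c : Fin n → Basis} (h : Frame A v c)
    (hv : ip v v = 1) : ∑ j, ‖v (c j)‖ ^ 2 = 1 := by
  rw [h.ip_eq] at hv
  have : ((∑ j, ‖v (c j)‖ ^ 2 : ℝ) : ℂ) = 1 := by
    rw [← hv]
    push_cast
    exact Finset.sum_congr rfl fun j _ => by rw [← Complex.conj_mul']
  exact_mod_cast this

theorem Frame.orth {A : Ty} {v : Vec} {n : ℕ} {c : Fin n → Basis} (h : Frame A v c)
    (i j : Fin n) (hij : i ≠ j) : Orth ((c i).toTm : Term) (c j).toTm :=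
  (h.closed i).orth (h.closed j) (h.inj.ne hij)

/-- A typing derivation of a value. -/
def Frame.der {A : Ty} {v : Vec} {n : ℕ} {c : Fin n → Basis} (h : Frame A v c)
    (hv : ip v v = 1) : TermDer [] (valTm v c) A :=
  .sum (fun j => (h.closed j).der) (h.sum_norm hv) h.orth

theorem Frame.of_finset {A : Ty} {v : Vec} {s : Finset Basis} (hs : ∀ b ∈ s, Closed A b)
    (hv : v.support ⊆ s) : Frame A v (fun j : Fin s.card => (s.equivFin.symm j : Basis)) where
  inj := Subtype.val_injective.comp s.equivFin.symm.injective
  closed j := hs _ (s.equivFin.symm j).2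
  cover b hb := ⟨s.equivFin ⟨b, hv (Finsupp.mem_support_iff.mpr hb)⟩, by simp⟩

theorem Frame.of_mem {A : Ty} {v : Vec} (hv : v ∈ A.vecs) :
    Frame A v (fun j : Fin v.support.card => (v.support.equivFin.symm j : Basis)) :=
  .of_finset (fun b hb => Ty.mem_vecs.mp hv b (Finsupp.mem_support_iff.mp hb)) subset_rfl

theorem Frame.mem {A : Ty} {v : Vec} {n : ℕ} {c : Fin n → Basis} (h : Frame A v c) :
    v ∈ A.vecs :=
  Ty.mem_vecs.mpr fun b hb => by
    obtain ⟨j, rfl⟩ := h.cover b hb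
    exact h.closed j

/-- Without zero coefficients, both families enumerate the support of `v`, so they differ by a
permutation. -/
theorem Frame.eqn_of_ne_zero {A : Ty} {v : Vec} (hv : ip v v = 1) {n m : ℕ} {c : Fin n → Basis}
    {c' : Fin m → Basis} (h : Frame A v c) (h' : Frame A v c') (hc : ∀ j, v (c j) ≠ 0)
    (hc' : ∀ j, v (c' j) ≠ 0) : Eqn [] (valTm v c) (valTm v c') A := by
  choose f hf using fun j => h.cover (c' j) (hc' j)
  choose g hg using fun j => h'.cover (c j) (hc j)
  -- This equivalence only serves to identify the two lengths; afterwards `f` itself is shown to be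
  -- a permutation.
  have e : Fin m ≃ Fin n := by
    refine ⟨f, g, fun j => h'.inj ?_, fun j => h.inj ?_⟩
    · rw [hg, hf]
    · rw [hf, hg]
  obtain rfl : m = n := by simpa using Fintype.card_congr e
  have hfb : Function.Bijective f := by
    refine ⟨fun i j hij => h'.inj ?_, fun j => ⟨g j, h.inj ?_⟩⟩
    · rw [← hf, ← hf, hij]
    · rw [hf, hg]
  have := Eqn.perm (Equiv.ofBijective f hfb) (h.der hv)
  simpa only [Equiv.ofBijective_apply, hf, valTm] using this

/-- The rule for zero coefficients drops the last summand only, so a vanishing one is first swapped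
to the end; induction on the length. -/
theorem Frame.eqn_support {A : Ty} {v : Vec} (hv : ip v v = 1) {n : ℕ} {c : Fin n → Basis}
    (h : Frame A v c) :
    Eqn [] (valTm v c) (valTm v fun j : Fin v.support.card => v.support.equivFin.symm j) A := by
  have h₀ : ∀ j : Fin v.support.card, v (v.support.equivFin.symm j : Basis) ≠ 0 := fun j =>
    Finsupp.mem_support_iff.mp (v.support.equivFin.symm j).2
  induction n with
  | zero => exact h.eqn_of_ne_zero hv (.of_mem h.mem) (fun j => j.elim0) h₀
  | succ k ih =>
    by_cases hz : ∃ j, v (c j) = 0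
    · obtain ⟨j, hj⟩ := hz
      set l := Equiv.swap j (Fin.last k) with hl
      have h₁ : Frame A v (fun i => c (l i)) :=
        ⟨h.inj.comp l.injective, fun i => h.closed _, fun b hb => by
          obtain ⟨i, rfl⟩ := h.cover b hb
          exact ⟨l.symm i, by simp⟩⟩
      have hlast : v (c (l (Fin.last k))) = 0 := by rw [hl, Equiv.swap_apply_right]; exact hj
      have h₂ : Frame A v (fun i : Fin k => c (l i.castSucc)) :=
        ⟨h₁.inj.comp (Fin.castSucc_injective k), fun i => h₁.closed _, fun b hb => by
          obtain ⟨i, rfl⟩ := h₁.cover b hb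
          rcases Fin.eq_castSucc_or_eq_last i with ⟨i', rfl⟩ | rfl
          · exact ⟨i', rfl⟩
          · exact absurd hlast hb⟩
      exact (Eqn.perm l (h.der hv)).trans ((Eqn.zero_scal (h₁.der hv) hlast).trans (ih h₂))
    · push Not at hz
      exact h.eqn_of_ne_zero hv (.of_mem h.mem) hz h₀

theorem Frame.eqn {A : Ty} {v : Vec} (hv : ip v v = 1) {n m : ℕ} {c : Fin n → Basis}
    {c' : Fin m → Basis} (h : Frame A v c) (h' : Frame A v c') :
    Eqn [] (valTm v c) (valTm v c') A :=
  (h.eqn_support hv).trans (h'.eqn_support hv).symm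

/-! ## Every closed term is equal to a value -/

/-- `t` is provably equal to each value that denotes the same vector. -/
structure HasValue (t : Term) (A : Ty) : Prop where
  mem : t.vec ∈ A.vecs
  norm : ip t.vec t.vec = 1
  eqn : ∀ {n : ℕ} {c : Fin n → Basis}, Frame A t.vec c → Eqn [] t (valTm t.vec c) A

/-- One provable equality with a value is enough: soundness identifies the coefficients with those
of `t.vec`, and `Frame.eqn` passes to any other frame. -/
theorem HasValue.of_eqn_sum {t : Term} {A : Ty} {n : ℕ} {α : Fin n → ℂ} {c : Fin n → Basis}
    (hα : ∑ j, ‖α j‖ ^ 2 = 1) (hc : Function.Injective c) (hcl : ∀ j, Closed A (c j))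
    (h : Eqn [] t (.sum n α fun j => (c j).toTm) A) : HasValue t A := by
  classical
  have hv : t.vec = ∑ j, α j • bvec (c j) := by
    rw [h.vec_eq, vec_sum]
    simp only [vec_toTm]
  have hαj : ∀ j, t.vec (c j) = α j := by
    intro j
    rw [hv, Finsupp.finsetSum_apply, Finset.sum_eq_single j]
    · simp [bvec_self]
    · intro i _ hij
      simp [bvec_apply, hc.ne hij]
    · simp
  have hfr : Frame A t.vec c := ⟨hc, hcl, fun b hb => by
    by_contra hne
    push Not at hne
    refine hb ?_
    rw [hv, Finsupp.finsetSum_apply]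
    exact Finset.sum_eq_zero fun i _ => by simp [bvec_apply, hne i]⟩
  have hval : valTm t.vec c = .sum n α fun j => (c j).toTm := by
    simp only [valTm, hαj]
  have hn : ip t.vec t.vec = 1 := by
    rw [hfr.ip_eq]
    simp only [hαj, Complex.conj_mul']
    exact_mod_cast hα
  exact ⟨hfr.mem, hn, fun hfr' => by
    rw [← hval] at h
    exact h.trans (hfr.eqn hn hfr')⟩

theorem HasValue.of_eqn {t t' : Term} {A : Ty} (h : Eqn [] t t' A) (h' : HasValue t' A) :
    HasValue t A where
  mem := h.vec_eq ▸ h'.mem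
  norm := h.vec_eq ▸ h'.norm
  eqn hfr := by
    rw [h.vec_eq] at hfr ⊢
    exact h.trans (h'.eqn hfr)

theorem Closed.hasValue {A : Ty} {b : Basis} (h : Closed A b) : HasValue b.toTm A :=
  .of_eqn_sum (n := 1) (α := fun _ => 1) (c := fun _ => b) (by simp)
    (Function.injective_of_subsingleton _) (fun _ => h) (Eqn.one_scal h.der).symm

theorem HasValue.exists_frame {t : Term} {A : Ty} (h : HasValue t A) :
    ∃ (n : ℕ) (c : Fin n → Basis), Frame A t.vec c := ⟨_, _, .of_mem h.mem⟩

theorem HasValue.inl {t : Term} {A : Ty} (B : Ty) (h : HasValue t A) :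
    HasValue t.inl (.oplus A B) := by
  obtain ⟨n, c, hfr⟩ := h.exists_frame
  exact .of_eqn_sum (c := fun j => .inl (c j)) (hfr.sum_norm h.norm) (inl_injective.comp hfr.inj)
    (fun j => .inl (hfr.closed j))
    ((Eqn.inl_congr (h.eqn hfr)).trans (Eqn.inl_linear (hfr.der h.norm)))

theorem HasValue.inr {t : Term} {B : Ty} (A : Ty) (h : HasValue t B) :
    HasValue t.inr (.oplus A B) := by
  obtain ⟨n, c, hfr⟩ := h.exists_frame
  exact .of_eqn_sum (c := fun j => .inr (c j)) (hfr.sum_norm h.norm) (inr_injective.comp hfr.inj)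
    (fun j => .inr (hfr.closed j))
    ((Eqn.inr_congr (h.eqn hfr)).trans (Eqn.inr_linear (hfr.der h.norm)))

theorem HasValue.succ {t : Term} (h : HasValue t .nat) : HasValue t.succ .nat := by
  obtain ⟨n, c, hfr⟩ := h.exists_frame
  exact .of_eqn_sum (c := fun j => .succ (c j)) (hfr.sum_norm h.norm) (succ_injective.comp hfr.inj)
    (fun j => .succ (hfr.closed j))
    ((Eqn.succ_congr (h.eqn hfr)).trans (Eqn.succ_linear (hfr.der h.norm)))

theorem HasValue.pair {t t' : Term} {A B : Ty} (h : HasValue t A) (h' : HasValue t' B)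
    (d' : TermDer [] t' B) : HasValue (t.pair t') (.tensor A B) := by
  obtain ⟨n, c, hfr⟩ := h.exists_frame
  obtain ⟨m, c', hfr'⟩ := h'.exists_frame
  have d₁ := hfr.der h.norm
  have d₂ := hfr'.der h'.norm
  -- The rule `double` indexes the flattened sum by a dependent pair, here with constant fibres.
  let φ : Fin (n * m) ≃ (_ : Fin n) × Fin m :=
    finProdFinEquiv.symm.trans (Equiv.sigmaEquivProd _ _).symm
  have hnorm : ∑ k, ‖t.vec (c (φ k).1) * t'.vec (c' (φ k).2)‖ ^ 2 = 1 := by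
    rw [Equiv.sum_comp φ (fun p => ‖t.vec (c p.1) * t'.vec (c' p.2)‖ ^ 2), Fintype.sum_sigma]
    simp only [norm_mul, mul_pow, ← Finset.mul_sum, hfr'.sum_norm h'.norm, mul_one,
      hfr.sum_norm h.norm]
  have hinj : Function.Injective fun k => Basis.pair (c (φ k).1) (c' (φ k).2) := by
    intro k k' hk
    injection hk with h₁ h₂
    refine φ.injective (Sigma.ext (hfr.inj h₁) (heq_of_eq (hfr'.inj h₂)))
  have hcl : ∀ k, Closed (.tensor A B) (Basis.pair (c (φ k).1) (c' (φ k).2)) := fun k =>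
    .pair (hfr.closed _) (hfr'.closed _)
  have e₁ : Eqn [] (t.pair t') ((valTm t.vec c).pair (valTm t'.vec c')) (.tensor A B) :=
    (Eqn.pair_congr_left Ctx.distinct_nil .nil (h.eqn hfr) d').trans
      (Eqn.pair_congr_right Ctx.distinct_nil .nil d₁ (h'.eqn hfr'))
  have e₂ := Eqn.pair_linear_left Ctx.distinct_nil .nil d₁ d₂
  have e₃ : Eqn [] (.sum n (fun j => t.vec (c j)) fun j => (c j).toTm.pair (valTm t'.vec c'))
      (.sum n (fun j => t.vec (c j)) fun j => .sum m (fun k => t'.vec (c' k))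
        fun k => (c j).toTm.pair (c' k).toTm) (.tensor A B) := by
    refine Eqn.sum_congr (.sum (fun j => .pair Ctx.distinct_nil .nil (hfr.closed j).der d₂)
      (hfr.sum_norm h.norm) fun i j hij => .pair_left _ _ (hfr.orth i j hij)) fun j => ?_
    exact Eqn.pair_linear_right Ctx.distinct_nil .nil (hfr.closed j).der d₂
  have e₄ := Eqn.double (α := fun j => t.vec (c j)) (β := fun _ k => t'.vec (c' k))
    (t := fun j k => (c j).toTm.pair (c' k).toTm) φ
    (.sum (fun k => (hcl k).der) hnorm fun i j hij => (hcl i).orth (hcl j) (hinj.ne hij))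
  exact .of_eqn_sum hnorm hinj hcl (e₁.trans (e₂.trans (e₃.trans e₄)))

/-- A frame may exceed the support, at the price of zero coefficients, so the union of the supports
serves all the vectors at once. -/
theorem exists_common_frame {A : Ty} {ι : Type} [Fintype ι] {v : ι → Vec}
    (hv : ∀ i, v i ∈ A.vecs) : ∃ (n : ℕ) (c : Fin n → Basis), ∀ i, Frame A (v i) c := by
  classical
  refine ⟨_, _, fun i => Frame.of_finset (s := Finset.univ.biUnion fun i => (v i).support) ?_
    (Finset.subset_biUnion_of_mem (fun i => (v i).support) (Finset.mem_univ i))⟩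
  intro b hb
  obtain ⟨i, -, hb⟩ := Finset.mem_biUnion.mp hb
  exact Ty.mem_vecs.mp (hv i) b (Finsupp.mem_support_iff.mp hb)

theorem Frame.orth_valTm {A : Ty} {v w : Vec} {n : ℕ} {c : Fin n → Basis} (h : Frame A v c)
    (hvw : ip v w = 0) : Orth (valTm v c) (valTm w c) := by
  refine .sum_sum n (fun j => (c j).toTm) n n id id _ _ Function.injective_id
    Function.injective_id h.orth ?_
  rw [h.ip_eq] at hvw
  simpa using hvw

/-- Over one common frame, `fubini` merges the values of the summands. Its premise, that the
combination of values is well typed, needs these values to be syntactically orthogonal: the terms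
are orthogonal, hence so are their vectors, and over a common frame the rule `Orth.sum_sum` converts
this back into syntax. -/
theorem HasValue.sum {n : ℕ} {α : Fin n → ℂ} {t : Fin n → Term} {A : Ty}
    (d : TermDer [] (.sum n α t) A) (h : ∀ i, HasValue (t i) A) : HasValue (.sum n α t) A := by
  have hn := d.ip_vec_self
  obtain ⟨m, c, hfr⟩ := exists_common_frame fun i => (h i).mem
  have hsum : ∀ b, (Tm.sum n α t).vec b = ∑ i, α i * (t i).vec b := fun b => by
    rw [vec_sum, Finsupp.finsetSum_apply]
    rfl
  have hfr' : Frame A (Tm.sum n α t).vec c := by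
    cases d with | sum d hα ht =>
    refine ⟨(hfr (exists_of_sum_norm hα).some).inj, (hfr (exists_of_sum_norm hα).some).closed,
      fun b hb => ?_⟩
    rw [hsum] at hb
    obtain ⟨i, -, hi⟩ := Finset.exists_ne_zero_of_sum_ne_zero hb
    exact (hfr i).cover b (right_ne_zero_of_mul hi)
  have e₁ : Eqn [] (.sum n α t) (.sum n α fun i => valTm (t i).vec c) A :=
    .sum_congr d fun i => (h i).eqn (hfr i)
  have e₂ : Eqn [] (.sum n α fun i => valTm (t i).vec c) (valTm (Tm.sum n α t).vec c) A := by
    simp only [valTm, hsum]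
    cases d with | sum d hα ht =>
    exact .fubini (.sum (fun i => (hfr i).der (h i).norm) hα fun i j hij =>
      (hfr i).orth_valTm ((ht i j hij).ip_vec (d i) (d j)))
  exact .of_eqn_sum (hfr'.sum_norm hn) hfr'.inj hfr'.closed (e₁.trans e₂)

/-- Once the argument is a value, linearity leaves only applications to basis values. -/
theorem HasValue.app {t : Term} {ω : Unitary} {A B : Ty} (u : UDer ω A B) (h : HasValue t A)
    (hω : ∀ b : Basis, Closed A b → HasValue (.app ω b.toTm) B) : HasValue (.app ω t) B := by
  obtain ⟨n, c, hfr⟩ := h.exists_frame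
  refine .of_eqn ((Eqn.app_congr (h.eqn hfr) u).trans (Eqn.app_linear u (hfr.der h.norm))) ?_
  exact .sum (.sum (fun j => .app u (hfr.closed j).der) (hfr.sum_norm h.norm)
    fun i j hij => .app ω (hfr.orth i j hij)) fun j => hω _ (hfr.closed j)

theorem Orth.toTerm_subst (σ : Valuation) {e e' : Expr} (h : Orth e e') :
    Orth (Expr.toTerm (Expr.subst σ e)) (Expr.toTerm (Expr.subst σ e')) := by
  induction h with
  | symm _ ih => exact ih.symm
  | inl_inr t₁ t₂ => exact .inl_inr _ _
  | zero_succ t => exact .zero_succ _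
  | succ _ ih => exact .succ ih
  | pair_right t t' _ ih => exact .pair_right _ _ ih
  | pair_left t t' _ ih => exact .pair_left _ _ ih
  | inl _ ih => exact .inl ih
  | inr _ ih => exact .inr ih
  | app ω _ => exact ω.elim
  | sum_right n α s _ ih => exact .sum_right _ _ _ ih
  | sum_self n α s k _ hk ih =>
    exact .sum_self n α (fun i => Expr.toTerm (Expr.subst σ (s i))) k ih hk
  | sum_sum N t p q J K α β hJ hK _ hαβ ih =>
    exact .sum_sum N (fun i => Expr.toTerm (Expr.subst σ (t i))) p q J K α β hJ hK ih hαβ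

/-- The typing of the substituted expression is proved simultaneously, since the cases of pairs and
sums ask for derivations; orthogonality of summands survives substitution. -/
theorem subst_hasValue {Δ : Ctx} {e : Expr} {A : Ty} (d : ExprDer Δ e A) {σ : Valuation}
    {τ : Var → Basis} (hσ : Agrees σ τ e.fv) (hτ : Sat τ Δ) :
    Nonempty (TermDer [] (Expr.toTerm (Expr.subst σ e)) A) ∧
      HasValue (Expr.toTerm (Expr.subst σ e)) A := by
  induction d with
  | unit => exact ⟨⟨.unit⟩, Closed.unit.hasValue⟩
  | zero => exact ⟨⟨.zero⟩, Closed.zero.hasValue⟩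
  | var x A =>
    have := hτ (x, A) (by simp)
    rw [Expr.subst, hσ x rfl, Option.getD_some, Expr.toTerm_toTm]
    exact ⟨⟨this.der⟩, this.hasValue⟩
  | inl B d ih => exact ⟨(ih hσ hτ).1.map fun d => .inl _ d, (ih hσ hτ).2.inl B⟩
  | inr A d ih => exact ⟨(ih hσ hτ).1.map fun d => .inr _ d, (ih hσ hτ).2.inr A⟩
  | succ d ih => exact ⟨(ih hσ hτ).1.map fun d => .succ d, (ih hσ hτ).2.succ⟩
  | pair hΔ s d₁ d₂ ih₁ ih₂ =>
    obtain ⟨⟨d₁'⟩, h₁⟩ := ih₁ (fun x hx => hσ x (.inl hx)) (hτ.left s)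
    obtain ⟨⟨d₂'⟩, h₂⟩ := ih₂ (fun x hx => hσ x (.inr hx)) (hτ.right s)
    exact ⟨⟨.pair Ctx.distinct_nil .nil d₁' d₂'⟩, h₁.pair h₂ d₂'⟩
  | @sum Δ A n α t d hα ht ih =>
    have ih' := fun i => ih i (fun x hx => hσ x (Set.mem_iUnion.mpr ⟨i, hx⟩)) hτ
    have d' : TermDer [] (Expr.toTerm (Expr.subst σ (.sum n α t))) A :=
      .sum (fun i => (ih' i).1.some) hα fun i j hij => (ht i j hij).toTerm_subst σ
    exact ⟨⟨d'⟩, .sum d' fun i => (ih' i).2⟩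
  | @app Δ ω t A B u d ih => exact ω.elim

/-- Each case but the inverse follows from its computation rule and the induction hypotheses. For
the inverse, `b` is rewritten as a superposition of values of `ω`, on which the rule for inverses
can act. -/
theorem UDer.hasValue_app {ω : Unitary} {A B : Ty} (u : UDer ω A B) {b : Basis}
    (hb : Closed A b) : HasValue (.app ω b.toTm) B := by
  induction u generalizing b with
  | @abs A B n p e Δ db de hp he ODb ODe =>
    obtain ⟨i, τ, hτ, rfl⟩ := exists_inst_eq db ODb hb
    obtain ⟨σ, hm, hσ, -⟩ := exists_matches (db i) τ
    refine .of_eqn (Eqn.beta i hb.der (.abs Δ db de hp he ODb ODe) hm)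
      (subst_hasValue (de i) (fun x hx => hσ x ?_) hτ).2
    rwa [(db i).mem_fv, ← (de i).mem_fv]
  | @inv ω A B u ih =>
    have hu := u.isUnitary
    have hγ : adj ω.act b ∈ A.vecs := hu.adj_mem hb
    have hγn : ip (adj ω.act b) (adj ω.act b) = 1 := by
      rw [hu.adj.inner hb hb, ip_bvec_left, bvec_self]
    obtain ⟨n, c, hfr⟩ : ∃ (n : ℕ) (c : Fin n → Basis), Frame A (adj ω.act b) c :=
      ⟨_, _, .of_mem hγ⟩
    have hval := fun j => ih (hfr.closed j)
    have hvec : ∀ j, (Tm.app ω (c j).toTm).vec = ω.act (c j) := fun j => by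
      rw [vec_app, vec_toTm, lin_bvec]
    -- A single frame for all `ω cₖ` and, through `none`, for `b`. Over it `b` carries zero
    -- coefficients at the basis values where the superposition of the `ω cₖ` cancels, which is the
    -- form that `fubini` produces.
    obtain ⟨m, a, hfr'⟩ := exists_common_frame
      (v := fun o : Option (Fin n) => o.elim (bvec b) fun j => ω.act (c j)) (A := B) (by
        rintro (_ | j)
        · exact bvec_mem hb
        · exact hu.mem (hfr.closed j))
    have hsum : ∀ j, bvec b (a j) = ∑ k, adj ω.act b (c k) * ω.act (c k) (a j) := by
      intro j
      have h₁ : lin ω.act (adj ω.act b) = bvec b := by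
        rw [← lin_bvec (adj ω.act) b, hu.lin_adj (bvec_mem hb)]
      rw [← h₁, hfr.lin_eq, Finsupp.finsetSum_apply]
      rfl
    have eb : Eqn [] b.toTm (.sum m (fun j => bvec b (a j)) fun j => (a j).toTm) B := by
      have := hb.hasValue.eqn (c := a) (by rw [vec_toTm]; exact hfr' none)
      rwa [vec_toTm] at this
    have dk : TermDer [] (.sum _ (fun k => adj ω.act b (c k)) fun k => valTm (ω.act (c k)) a) B := by
      refine .sum (fun k => (hfr' (some k)).der ?_) (hfr.sum_norm hγn) fun i j hij =>
        (hfr' (some i)).orth_valTm ?_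
      · change ip (ω.act (c k)) (ω.act (c k)) = 1
        rw [hu.inner (hfr.closed k) (hfr.closed k), ip_bvec_left, bvec_self]
      · change ip (ω.act (c i)) (ω.act (c j)) = 0
        classical
        rw [hu.inner (hfr.closed i) (hfr.closed j), ip_bvec_left, bvec_apply,
          if_neg (hfr.inj.ne hij.symm)]
    have ef : Eqn [] (.sum _ (fun k => adj ω.act b (c k)) fun k => valTm (ω.act (c k)) a)
        (.sum m (fun j => bvec b (a j)) fun j => (a j).toTm) B := by
      simp only [hsum]
      exact .fubini dk
    -- The premise of the rule is the induction hypothesis for `ω` at `cₖ`, stated for the value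
    -- over the common frame; this is why `HasValue` quantifies over all frames.
    have eω : ∀ k, Eqn [] (.app (.inv ω) (valTm (ω.act (c k)) a)) (c k).toTm A := fun k => by
      refine .inv u (hfr.closed k).der ?_
      have := (hval k).eqn (c := a) (by rw [hvec]; exact hfr' (some k))
      rwa [hvec] at this
    refine .of_eqn_sum (hfr.sum_norm hγn) hfr.inj hfr.closed
      ((Eqn.app_congr (eb.trans ef.symm) (.inv u)).trans ((Eqn.app_linear (.inv u) dk).trans
        (Eqn.sum_congr ?_ eω)))
    cases dk with | sum d hα ht =>
    exact .sum (fun k => .app (.inv u) (d k)) hα fun i j hij => .app _ (ht i j hij)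
  | comp u₁ u₂ ih₁ ih₂ =>
    exact .of_eqn (Eqn.comp u₁ u₂ hb.der) (.app u₂ (ih₁ hb) fun _ => ih₂)
  | tensor u₁ u₂ ih₁ ih₂ =>
    cases hb with | pair h₁ h₂ =>
    exact .of_eqn (Eqn.tensor u₁ u₂ h₁.der h₂.der) ((ih₁ h₁).pair (ih₂ h₂) (.app u₂ h₂.der))
  | oplus u₁ u₂ ih₁ ih₂ =>
    cases hb with
    | inl h => exact .of_eqn (Eqn.oplus_inl u₁ u₂ h.der) ((ih₁ h).inl _)
    | inr h => exact .of_eqn (Eqn.oplus_inr u₁ u₂ h.der) ((ih₂ h).inr _)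
  | ctrl u ih =>
    cases hb with | pair h₁ h₂ =>
    cases h₁ with
    | inl h =>
      cases h
      exact .of_eqn (Eqn.ctrl_inl u h₂.der) (Closed.pair (.inl .unit) h₂).hasValue
    | inr h =>
      cases h
      exact .of_eqn (Eqn.ctrl_inr u h₂.der)
        ((Closed.inr (A := .unit) .unit).hasValue.pair (ih h₂) (.app u h₂.der))

theorem TermDer.hasValue {t : Term} {A : Ty} (d : TermDer [] t A) : HasValue t A := by
  generalize hΔ : ([] : Ctx) = Δ at d
  induction d with
  | unit => exact Closed.unit.hasValue
  | var x A => cases hΔ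
  | pair _ s d₁ d₂ ih₁ ih₂ =>
    subst hΔ
    cases s
    exact (ih₁ rfl).pair (ih₂ rfl) d₂
  | inl B d ih => exact (ih hΔ).inl B
  | inr A d ih => exact (ih hΔ).inr A
  | zero => exact Closed.zero.hasValue
  | succ d ih => exact (ih hΔ).succ
  | sum d hα ht ih =>
    subst hΔ
    exact .sum (.sum d hα ht) fun i => ih i rfl
  | app u d ih => exact (ih hΔ).app u fun _ => u.hasValue_app

theorem eqn_iff_vec_eq {t₁ t₂ : Term} {A : Ty} (d₁ : TermDer [] t₁ A) (d₂ : TermDer [] t₂ A) :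
    Eqn [] t₁ t₂ A ↔ t₁.vec = t₂.vec := by
  refine ⟨Eqn.vec_eq, fun h => ?_⟩
  obtain ⟨n, c, hfr⟩ := d₁.hasValue.exists_frame
  have e := d₂.hasValue.eqn (h ▸ hfr)
  rw [← h] at e
  exact (d₁.hasValue.eqn hfr).trans e.symm

end QControl

end

noncomputable section

namespace Hilb

/-! ## Pure tensors -/

variable {X X' Y Y' Z : Hilb}

theorem inner_tmul (x x' : X) (y y' : Y) :
    inner ℂ (tmul x y) (tmul x' y') = inner ℂ x x' * inner ℂ y y' := by
  rw [← TensorProduct.inner_tmul]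
  exact Completion.inner_coe _ _

/-- The pure tensors as a bilinear map. -/
def tmulHom (X Y : Hilb) : X →ₗ[ℂ] Y →ₗ[ℂ] tensor X Y :=
  (TensorProduct.mk ℂ X Y).compr₂ (embed X Y).toLinearMap

theorem tmulHom_apply (x : X) (y : Y) : tmulHom X Y x y = tmul x y := rfl

theorem norm_tmul (x : X) (y : Y) : ‖tmul x y‖ = ‖x‖ * ‖y‖ :=
  (Completion.norm_coe _).trans (TensorProduct.norm_tmul x y)

theorem continuous_tmul_left (y : Y) : Continuous fun x : X => tmul x y :=
  (LinearMap.mkContinuous ((tmulHom X Y).flip y) ‖y‖ fun x => by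
    rw [LinearMap.flip_apply, tmulHom_apply, norm_tmul, mul_comm]).continuous

theorem continuous_tmul_right (x : X) : Continuous fun y : Y => tmul x y :=
  (LinearMap.mkContinuous (tmulHom X Y x) ‖x‖ fun y => by
    rw [tmulHom_apply, norm_tmul]).continuous

theorem tensorMap_tmul (f : X →L[ℂ] Y) (g : X' →L[ℂ] Y') (x : X) (x' : X') :
    tensorMap f g (tmul x x') = tmul (f x) (g x') :=
  ContinuousLinearMap.completion_apply_coe _ _

theorem braid_tmul (x : X) (y : Y) : braid X Y (tmul x y) = tmul y x :=
  ContinuousLinearMap.completion_apply_coe _ _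

theorem rightUnitor_tmul (x : X) : rightUnitor X (tmul (Y := one) x (1 : ℂ)) = x := by
  refine (ContinuousLinearMap.fromCompletion_apply_coe _ _).trans ?_
  exact one_smul ℂ x

theorem unitSplit_one : unitSplit (1 : ℂ) = tmul (X := one) (Y := one) (1 : ℂ) (1 : ℂ) :=
  one_smul ℂ _

theorem assocHom_tmul (x : X) (y : Y) (z : Z) :
    assocHom X Y Z (tmul (tmul x y) z) = tmul x (tmul y z) :=
  LinearEquiv.extendOfIsometry_eq (TensorProduct.assoc ℂ X Y Z) (assocDom X Y Z).toLinearMap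
    (assocCod X Y Z).toLinearMap (denseRange_assocDom X Y Z) (denseRange_assocCod X Y Z)
    (fun x => ((assocCod X Y Z).norm_map _).trans
      (((TensorProduct.assocIsometry ℂ X Y Z).norm_map x).trans
        ((assocDom X Y Z).norm_map x).symm)) ((x ⊗ₜ[ℂ] y) ⊗ₜ[ℂ] z)

theorem assocInv_tmul (x : X) (y : Y) (z : Z) :
    assocInv X Y Z (tmul x (tmul y z)) = tmul (tmul x y) z := by
  rw [← assocHom_tmul]
  exact (assoc X Y Z).symm_apply_apply _

theorem inner_inl_inl (x x' : X) : inner ℂ (inl X Y x) (inl X Y x') = inner ℂ x x' := by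
  refine (WithLp.prod_inner_apply _ _).trans ?_
  change inner ℂ x x' + inner ℂ (0 : Y) 0 = _
  simp

theorem inner_inr_inr (y y' : Y) : inner ℂ (inr X Y y) (inr X Y y') = inner ℂ y y' := by
  refine (WithLp.prod_inner_apply _ _).trans ?_
  change inner ℂ (0 : X) 0 + inner ℂ y y' = _
  simp

theorem inner_inl_inr (x : X) (y : Y) : inner ℂ (inl X Y x) (inr X Y y) = 0 := by
  refine (WithLp.prod_inner_apply _ _).trans ?_
  change inner ℂ x 0 + inner ℂ (0 : Y) y = _
  simp

theorem inner_inr_inl (x : X) (y : Y) : inner ℂ (inr X Y y) (inl X Y x) = 0 := by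
  rw [← inner_conj_symm, inner_inl_inr, map_zero]

theorem inl_add_inr (z : oplus X Y) : ∃ x y, z = inl X Y x + inr X Y y := by
  refine ⟨(WithLp.ofLp z).1, (WithLp.ofLp z).2, ?_⟩
  refine WithLp.ofLp_injective 2 (Prod.ext ?_ ?_)
  · exact (add_zero _).symm
  · exact (zero_add _).symm

theorem oplusMap_inl (f : X →L[ℂ] Y) (g : X' →L[ℂ] Y') (x : X) :
    oplusMap f g (inl X X' x) = inl Y Y' (f x) := by
  refine WithLp.ofLp_injective 2 (Prod.ext rfl ?_)
  exact map_zero g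

theorem oplusMap_inr (f : X →L[ℂ] Y) (g : X' →L[ℂ] Y') (x : X') :
    oplusMap f g (inr X X' x) = inr Y Y' (g x) := by
  refine WithLp.ofLp_injective 2 (Prod.ext ?_ rfl)
  exact map_zero f

theorem inner_dagger_right (f : X →L[ℂ] Y) (x : X) (y : Y) :
    inner ℂ x (dagger f y) = inner ℂ (f x) y :=
  ContinuousLinearMap.adjoint_inner_right f x y

theorem dagger_inl_inl (x : X) : dagger (inl X Y) (inl X Y x) = x :=
  ext_inner_left ℂ fun z => by rw [inner_dagger_right, inner_inl_inl]

theorem dagger_inl_inr (y : Y) : dagger (inl X Y) (inr X Y y) = 0 :=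
  ext_inner_left ℂ fun z => by rw [inner_dagger_right, inner_inl_inr, inner_zero_right]

theorem dagger_inr_inr (y : Y) : dagger (inr X Y) (inr X Y y) = y :=
  ext_inner_left ℂ fun z => by rw [inner_dagger_right, inner_inr_inr]

theorem dagger_inr_inl (x : X) : dagger (inr X Y) (inl X Y x) = 0 :=
  ext_inner_left ℂ fun z => by rw [inner_dagger_right, inner_inr_inl, inner_zero_right]

theorem tmul_zero_left (y : Y) : tmul (0 : X) y = 0 := by
  rw [← tmulHom_apply, map_zero, LinearMap.zero_apply]

theorem ctrlMap_inl (f : X →L[ℂ] X) (z : one) (x : X) :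
    ctrlMap f (tmul (inl one one z) x) = tmul (inl one one z) x := by
  simp only [ctrlMap, add_apply, tensorMap_tmul, ContinuousLinearMap.comp_apply, dagger_inl_inl,
    dagger_inr_inl, map_zero, tmul_zero_left, add_zero, ContinuousLinearMap.id_apply]

theorem ctrlMap_inr (f : X →L[ℂ] X) (z : one) (x : X) :
    ctrlMap f (tmul (inr one one z) x) = tmul (inr one one z) (f x) := by
  simp only [ctrlMap, add_apply, tensorMap_tmul, ContinuousLinearMap.comp_apply, dagger_inr_inr,
    dagger_inl_inr, map_zero, tmul_zero_left, zero_add, ContinuousLinearMap.id_apply]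

theorem succMap_ket (n : ℕ) : succMap (ket n) = ket (n + 1) := by
  refine (orthonormal_ket_succ.orthogonalFamily.linearIsometry_apply_single (i := n)
    (1 : ℂ)).trans ?_
  exact one_smul ℂ _

/-! ## Total sets -/

/-- The closed linear span of `S` is the whole space. -/
def Total (S : Set X) : Prop :=
  ∀ K : Submodule ℂ X, IsClosed (K : Set X) → S ⊆ K → K = ⊤

theorem Total.mono {S T : Set X} (hS : Total S) (h : S ⊆ T) : Total T :=
  fun K hK hT => hS K hK (h.trans hT)

/-- The orthogonal complement of `x - y` is closed and contains `S`, hence contains `x - y`.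
Adjoints are computed by testing against a total set in this way. -/
theorem Total.ext {S : Set X} (hS : Total S) {x y : X}
    (h : ∀ s ∈ S, inner ℂ s x = inner ℂ s y) : x = y := by
  have := hS (ℂ ∙ (x - y))ᗮ (Submodule.isClosed_orthogonal _) fun s hs => by
    rw [SetLike.mem_coe, Submodule.mem_orthogonal_singleton_iff_inner_left, inner_sub_right, h s hs,
      sub_self]
  have h' : x - y ∈ (ℂ ∙ (x - y))ᗮ := by rw [this]; trivial
  rw [Submodule.mem_orthogonal_singleton_iff_inner_left, inner_self_eq_zero] at h'
  exact sub_eq_zero.mp h'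

/-- Pure tensors are continuous in each variable separately, so the factors are freed one after the
other; sums of pure tensors are dense in the completion. -/
theorem Total.tmul {S : Set X} {T : Set Y} (hS : Total S) (hT : Total T) :
    Total (X := tensor X Y) (Set.image2 (Hilb.tmul (X := X) (Y := Y)) S T) := by
  intro K hK h
  have h₁ : ∀ x : X, ∀ t ∈ T, Hilb.tmul x t ∈ K := fun x t ht => by
    have := hS (K.comap ((tmulHom X Y).flip t)) (hK.preimage (continuous_tmul_left t))
      fun s hs => h ⟨s, hs, t, ht, rfl⟩
    have hx : x ∈ K.comap ((tmulHom X Y).flip t) := by rw [this]; trivial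
    exact hx
  have h₂ : ∀ (x : X) (y : Y), Hilb.tmul x y ∈ K := fun x y => by
    have := hT (K.comap (tmulHom X Y x)) (hK.preimage (continuous_tmul_right x))
      fun t ht => h₁ x t ht
    have hy : y ∈ K.comap (tmulHom X Y x) := by rw [this]; trivial
    exact hy
  have h₃ : ∀ z : (X : Type) ⊗[ℂ] Y, embed X Y z ∈ K := fun z => by
    induction z with
    | zero => rw [map_zero]; exact K.zero_mem
    | add z z' hz hz' => rw [map_add]; exact K.add_mem hz hz'
    | tmul x y => exact h₂ x y
  refine eq_top_iff.mpr fun z _ => ?_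
  exact (denseRange_embed X Y).induction_on (p := fun z => z ∈ K) z hK h₃

end Hilb

namespace QControl

open Hilb (tmul Total)

/-! ## Basis values as vectors of the interpretation -/

/-- The basis vector of `⟦A⟧` given by a closed basis value of type `A`. -/
def Ty.ket : (A : Ty) → Basis → A.den
  | .unit, _ => (1 : ℂ)
  | .oplus A B, .inl b => Hilb.inl A.den B.den (A.ket b)
  | .oplus A B, .inr b => Hilb.inr A.den B.den (B.ket b)
  | .oplus _ _, _ => 0
  | .tensor A B, .pair b b' => tmul (A.ket b) (B.ket b')
  | .tensor _ _, _ => 0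
  | .nat, b => Hilb.ket (numeral b)
where
  /-- The number denoted by a numeral. -/
  numeral : Basis → ℕ
    | .succ b => numeral b + 1
    | _ => 0

theorem numeral_injOn {b b' : Basis} (h : Closed .nat b) (h' : Closed .nat b')
    (hn : Ty.ket.numeral b = Ty.ket.numeral b') : b = b' := by
  induction b generalizing b' with
  | zero => cases h' with
    | zero => rfl
    | succ _ => simp [Ty.ket.numeral] at hn
  | succ b ih => cases h with | succ h => cases h' with
    | zero => simp [Ty.ket.numeral] at hn
    | succ h' => rw [ih h h' (by simpa [Ty.ket.numeral] using hn)]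
  | _ => cases h

theorem exists_numeral (n : ℕ) : ∃ b, Closed .nat b ∧ Ty.ket.numeral b = n := by
  induction n with
  | zero => exact ⟨_, .zero, rfl⟩
  | succ n ih =>
    obtain ⟨b, hb, h⟩ := ih
    exact ⟨_, .succ hb, congrArg (· + 1) h⟩

theorem inner_ket {A : Ty} {b b' : Basis} (h : Closed A b) (h' : Closed A b') :
    inner ℂ (A.ket b) (A.ket b') = ip (bvec b) (bvec b') := by
  classical
  induction A generalizing b b' with
  | unit =>
    cases h; cases h'
    rw [ip_bvec_left, bvec_self]
    change inner ℂ (1 : ℂ) (1 : ℂ) = 1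
    simp
  | oplus A B ihA ihB =>
    cases h with
    | inl h =>
      cases h' with
      | inl h' => rw [← mapB_bvec, ← mapB_bvec, ip_mapB inl_injective, ← ihA h h']
                  exact Hilb.inner_inl_inl _ _
      | inr h' => rw [← mapB_bvec, ← mapB_bvec, ip_mapB_mapB (by simp)]
                  exact Hilb.inner_inl_inr _ _
    | inr h =>
      cases h' with
      | inl h' => rw [← mapB_bvec, ← mapB_bvec, ip_mapB_mapB (by simp)]
                  exact Hilb.inner_inr_inl _ _
      | inr h' => rw [← mapB_bvec, ← mapB_bvec, ip_mapB inr_injective, ← ihB h h']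
                  exact Hilb.inner_inr_inr _ _
  | tensor A B ihA ihB =>
    cases h with | pair h₁ h₂ => cases h' with | pair h₁' h₂' =>
    rw [← tp_bvec, ← tp_bvec, ip_tp, ← ihA h₁ h₁', ← ihB h₂ h₂']
    exact Hilb.inner_tmul _ _ _ _
  | nat =>
    rw [ip_bvec_left, bvec_apply]
    have : inner ℂ (Hilb.ket (Ty.ket.numeral b)) (Hilb.ket (Ty.ket.numeral b')) =
        if Ty.ket.numeral b' = Ty.ket.numeral b then (1 : ℂ) else 0 := by
      simp only [Hilb.ket]
      rw [lp.inner_single_left, lp.single_apply, Pi.single_apply]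
      simp [eq_comm]
    refine this.trans ?_
    by_cases hb : b' = b
    · rw [if_pos hb, if_pos (by rw [hb])]
    · rw [if_neg hb, if_neg fun hn => hb (numeral_injOn h' h hn)]

theorem total_ket (A : Ty) : Total (A.ket '' {b | Closed A b}) := by
  induction A with
  | unit =>
    intro K _ h
    refine eq_top_iff.mpr fun (z : ℂ) _ => ?_
    have : z • (1 : ℂ) ∈ K := K.smul_mem z (h ⟨_, .unit, rfl⟩)
    rwa [smul_eq_mul, mul_one] at this
  | oplus A B ihA ihB =>
    intro K hK h
    refine eq_top_iff.mpr fun z _ => ?_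
    obtain ⟨x, y, rfl⟩ := Hilb.inl_add_inr (X := A.den) (Y := B.den) z
    refine K.add_mem ?_ ?_
    · have := ihA (K.comap (Hilb.inl A.den B.den).toLinearMap)
        (hK.preimage (Hilb.inl A.den B.den).continuous)
        (by rintro _ ⟨b, hb, rfl⟩; exact h ⟨_, .inl hb, rfl⟩)
      have hx : x ∈ K.comap (Hilb.inl A.den B.den).toLinearMap := by rw [this]; trivial
      exact hx
    · have := ihB (K.comap (Hilb.inr A.den B.den).toLinearMap)
        (hK.preimage (Hilb.inr A.den B.den).continuous)
        (by rintro _ ⟨b, hb, rfl⟩; exact h ⟨_, .inr hb, rfl⟩)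
      have hy : y ∈ K.comap (Hilb.inr A.den B.den).toLinearMap := by rw [this]; trivial
      exact hy
  | tensor A B ihA ihB =>
    refine (ihA.tmul ihB).mono ?_
    rintro _ ⟨_, ⟨b, hb, rfl⟩, _, ⟨b', hb', rfl⟩, rfl⟩
    exact ⟨_, .pair hb hb', rfl⟩
  | nat =>
    intro K hK h
    refine eq_top_iff.mpr fun (z : lp (fun _ : ℕ => ℂ) 2) _ => ?_
    refine hK.mem_of_tendsto (lp.hasSum_single (by simp) z) (.of_forall fun s => ?_)
    refine K.sum_mem fun n _ => ?_
    obtain ⟨b, hb, hn⟩ := exists_numeral n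
    have : z n • Hilb.ket n ∈ K := K.smul_mem (z n) (h ⟨b, hb, congrArg Hilb.ket hn⟩)
    rw [Hilb.ket, ← lp.single_smul, smul_eq_mul, mul_one] at this
    exact this

/-- The embedding into `⟦A⟧` of the vectors supported on closed basis values of type `A`. -/
def Ty.emb (A : Ty) : Vec →ₗ[ℂ] A.den := lin A.ket

theorem emb_bvec (A : Ty) (b : Basis) : A.emb (bvec b) = A.ket b := lin_bvec _ _

theorem inner_emb {A : Ty} {v w : Vec} (hv : v ∈ A.vecs) (hw : w ∈ A.vecs) :
    inner ℂ (A.emb v) (A.emb w) = ip v w := by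
  rw [← lin_bvec_eq_self v, ← lin_bvec_eq_self w, ip_lin_lin, lin_bvec_eq_self, lin_bvec_eq_self]
  simp only [Ty.emb, Finsupp.linearCombination_apply, Finsupp.sum]
  rw [sum_inner]
  refine Finset.sum_congr rfl fun b hb => ?_
  rw [inner_smul_left, inner_sum, Finset.mul_sum]
  refine Finset.sum_congr rfl fun b' hb' => ?_
  rw [inner_smul_right]
  rw [inner_ket (Ty.mem_vecs.mp hv b (Finsupp.mem_support_iff.mp hb))
    (Ty.mem_vecs.mp hw b' (Finsupp.mem_support_iff.mp hb'))]

theorem emb_injOn {A : Ty} {v w : Vec} (hv : v ∈ A.vecs) (hw : w ∈ A.vecs)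
    (h : A.emb v = A.emb w) : v = w := by
  have key : ∀ b, Closed A b → v b = w b := fun b hb => by
    rw [← ip_bvec_left, ← inner_emb (bvec_mem hb) hv, h, inner_emb (bvec_mem hb) hw, ip_bvec_left]
  ext b
  by_cases hb : Closed A b
  · exact key b hb
  · have h₁ : v b = 0 := by_contra fun h' => hb (Ty.mem_vecs.mp hv b h')
    have h₂ : w b = 0 := by_contra fun h' => hb (Ty.mem_vecs.mp hw b h')
    rw [h₁, h₂]

theorem map_lin {M N : Type*} [AddCommGroup M] [Module ℂ M] [AddCommGroup N] [Module ℂ N]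
    (g : M →ₗ[ℂ] N) (f : Basis → M) (v : Vec) : g (lin f v) = lin (fun b => g (f b)) v := by
  rw [← LinearMap.comp_apply]
  congr 1
  ext b
  simp

/-- The comparison is required on the support of `v` only, hence on closed values when `v` is typed;
elsewhere `Ty.ket` takes junk values. -/
theorem map_emb {A : Ty} {M : Type*} [AddCommGroup M] [Module ℂ M] (g : A.den →ₗ[ℂ] M)
    (h : Vec →ₗ[ℂ] M) {v : Vec} (hgh : ∀ b, v b ≠ 0 → g (A.ket b) = h (bvec b)) :
    g (A.emb v) = h v := by
  conv_rhs => rw [← lin_bvec_eq_self v, map_lin]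
  rw [Ty.emb, map_lin]
  exact lin_congr hgh

theorem emb_inl (A B : Ty) (v : Vec) :
    (Ty.oplus A B).emb (mapB .inl v) = Hilb.inl A.den B.den (A.emb v) :=
  (map_emb (M := (Ty.oplus A B).den) (Hilb.inl A.den B.den).toLinearMap
    ((Ty.oplus A B).emb ∘ₗ mapB .inl) fun b _ =>
      ((congrArg (Ty.oplus A B).emb (mapB_bvec .inl b)).trans (emb_bvec _ _)).symm).symm

theorem emb_inr (A B : Ty) (v : Vec) :
    (Ty.oplus A B).emb (mapB .inr v) = Hilb.inr A.den B.den (B.emb v) :=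
  (map_emb (M := (Ty.oplus A B).den) (Hilb.inr A.den B.den).toLinearMap
    ((Ty.oplus A B).emb ∘ₗ mapB .inr) fun b _ =>
      ((congrArg (Ty.oplus A B).emb (mapB_bvec .inr b)).trans (emb_bvec _ _)).symm).symm

theorem emb_succ (v : Vec) : Ty.nat.emb (mapB .succ v) = Hilb.succMap (Ty.nat.emb v) :=
  (map_emb (A := .nat) (M := Ty.nat.den) Hilb.succMap.toLinearMap
    (Ty.nat.emb ∘ₗ mapB .succ) fun b _ =>
      (Hilb.succMap_ket _).trans
        ((congrArg Ty.nat.emb (mapB_bvec .succ b)).trans (emb_bvec _ _)).symm).symm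

theorem emb_tp (A B : Ty) (v w : Vec) :
    (Ty.tensor A B).emb (tp v w) = tmul (A.emb v) (B.emb w) := by
  have h : ∀ b, tmul (A.ket b) (B.emb w) = (Ty.tensor A B).emb (tp (bvec b) w) := fun b =>
    map_emb (M := (Ty.tensor A B).den) (Hilb.tmulHom A.den B.den (A.ket b))
      ((Ty.tensor A B).emb ∘ₗ tp (bvec b)) fun b' _ =>
        ((congrArg (Ty.tensor A B).emb (tp_bvec b b')).trans (emb_bvec _ _)).symm
  exact (map_emb (M := (Ty.tensor A B).den) ((Hilb.tmulHom A.den B.den).flip (B.emb w))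
    ((Ty.tensor A B).emb ∘ₗ tp.flip w) fun b _ => h b).symm

/-! ## Contexts -/

/-- The basis vector of `⟦Δ⟧` given by an assignment of closed basis values. -/
def Ctx.ket : (Δ : Ctx) → (Var → Basis) → Ctx.den Δ
  | [], _ => (1 : ℂ)
  | p :: Δ, σ => tmul (p.2.ket (σ p.1)) (Ctx.ket Δ σ)

theorem Ctx.ket_congr {Δ : Ctx} {σ τ : Var → Basis} (h : ∀ x ∈ Δ.map Prod.fst, σ x = τ x) :
    Ctx.ket Δ σ = Ctx.ket Δ τ := by
  induction Δ with
  | nil => rfl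
  | cons p Δ ih =>
    simp only [List.map_cons, List.mem_cons, forall_eq_or_imp] at h
    rw [Ctx.ket, Ctx.ket, h.1, ih h.2]

theorem Ctx.inner_ket {Δ : Ctx} {σ τ : Var → Basis} (hσ : Sat σ Δ) (hτ : Sat τ Δ) :
    ((∀ x ∈ Δ.map Prod.fst, σ x = τ x) → inner ℂ (Ctx.ket Δ σ) (Ctx.ket Δ τ) = 1) ∧
    ((¬ ∀ x ∈ Δ.map Prod.fst, σ x = τ x) → inner ℂ (Ctx.ket Δ σ) (Ctx.ket Δ τ) = 0) := by
  classical
  induction Δ with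
  | nil =>
    have : inner ℂ (Ctx.ket [] σ) (Ctx.ket [] τ) = 1 := by
      change inner ℂ (1 : ℂ) (1 : ℂ) = 1
      simp
    exact ⟨fun _ => this, fun h => absurd (by simp) h⟩
  | cons p Δ ih =>
    have h₁ := QControl.inner_ket (hσ p (by simp)) (hτ p (by simp))
    have ih := ih (fun q hq => hσ q (List.mem_cons_of_mem _ hq))
      (fun q hq => hτ q (List.mem_cons_of_mem _ hq))
    have key : inner ℂ (Ctx.ket (p :: Δ) σ) (Ctx.ket (p :: Δ) τ) =
        inner ℂ (p.2.ket (σ p.1)) (p.2.ket (τ p.1)) * inner ℂ (Ctx.ket Δ σ) (Ctx.ket Δ τ) :=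
      Hilb.inner_tmul _ _ _ _
    rw [key, h₁, ip_bvec_left, bvec_apply]
    simp only [List.map_cons, List.mem_cons, forall_eq_or_imp]
    constructor
    · rintro ⟨h, h'⟩
      rw [if_pos h.symm, ih.1 h', mul_one]
    · intro h
      by_cases hp : σ p.1 = τ p.1
      · rw [ih.2 fun h' => h ⟨hp, h'⟩, mul_zero]
      · rw [if_neg (Ne.symm hp), zero_mul]

/-- Distinctness of the variables lets the first one be assigned freely without disturbing the
others. -/
theorem Ctx.total_ket {Δ : Ctx} (hΔ : Δ.Distinct) : Total (Ctx.ket Δ '' {σ | Sat σ Δ}) := by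
  classical
  induction Δ with
  | nil =>
    intro K _ h
    refine eq_top_iff.mpr fun (z : ℂ) _ => ?_
    have : z • (1 : ℂ) ∈ K := K.smul_mem z (h ⟨fun _ => .unit, Sat.nil fun _ => .unit, rfl⟩)
    rwa [smul_eq_mul, mul_one] at this
  | cons p Δ ih =>
    rw [Ctx.Distinct, List.map_cons, List.nodup_cons] at hΔ
    refine ((QControl.total_ket p.2).tmul (ih hΔ.2)).mono ?_
    rintro _ ⟨_, ⟨b, hb, rfl⟩, _, ⟨σ, hσ, rfl⟩, rfl⟩
    have hne : ∀ x ∈ Δ.map Prod.fst, Function.update σ p.1 b x = σ x := fun x hx =>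
      Function.update_of_ne (by rintro rfl; exact hΔ.1 hx) _ _
    refine ⟨Function.update σ p.1 b, ?_, ?_⟩
    · intro q hq
      rcases List.mem_cons.mp hq with rfl | hq
      · simpa using hb
      · rw [hne _ (List.mem_map_of_mem hq)]
        exact hσ q hq
    · rw [Ctx.ket, Function.update_self, Ctx.ket_congr hne]

theorem Split.den_ket {Δ Δ₁ Δ₂ : Ctx} (s : Split Δ Δ₁ Δ₂) (σ : Var → Basis) :
    s.den (Ctx.ket Δ σ) = tmul (Ctx.ket Δ₁ σ) (Ctx.ket Δ₂ σ) := by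
  induction s with
  | nil => exact Hilb.unitSplit_one
  | left p s ih =>
    exact (congrArg (Hilb.assocInv _ _ _)
      ((Hilb.tensorMap_tmul _ _ _ _).trans (congrArg (tmul _) ih))).trans (Hilb.assocInv_tmul _ _ _)
  | @right Δ Δ₁ Δ₂ p s ih =>
    have h₁ := (congrArg (Hilb.assocInv _ _ _)
      ((Hilb.tensorMap_tmul (ContinuousLinearMap.id ℂ p.2.den) s.den (p.2.ket (σ p.1))
        (Ctx.ket Δ σ)).trans (congrArg (tmul _) ih))).trans (Hilb.assocInv_tmul _ _ _)
    have h₂ := (congrArg (Hilb.tensorMap (Hilb.braid p.2.den (Ctx.den Δ₁))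
      (ContinuousLinearMap.id ℂ (Ctx.den Δ₂))) h₁).trans ((Hilb.tensorMap_tmul _ _ _ _).trans
        (congrArg (fun z => tmul z (Ctx.ket Δ₂ σ)) (Hilb.braid_tmul _ _)))
    exact (congrArg (Hilb.assocHom _ _ _) h₂).trans (Hilb.assocHom_tmul _ _ _)

/-! ## The interpretation of terms and unitaries -/

/-- The unitaries are compared with their action at closed values only, and typed evaluation meets
no others. Keeping `U` general allows a first use for expressions, which enter the denotation of
unitaries, and a second one for terms. -/
theorem Der.den_ket {U : Type} {TU : U → Ty → Ty → Type} {F : U → Basis → Vec}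
    (hF : IsometricAction TU F) {denU : ∀ {ω A B}, TU ω A B → (A.den →L[ℂ] B.den)}
    (hden : ∀ {ω A B} (u : TU ω A B) (b : Basis), Closed A b → denU u (A.ket b) = B.emb (F ω b))
    {Δ : Ctx} {t : Tm U} {A : Ty} (d : Der TU Δ t A) {σ : Var → Basis} (hσ : Sat σ Δ) :
    d.den denU (Ctx.ket Δ σ) = A.emb (t.ev F σ) := by
  induction d with
  | unit => exact (emb_bvec .unit .unit).symm
  | var x A =>
    refine (Hilb.rightUnitor_tmul _).trans ?_
    exact (emb_bvec _ _).symm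
  | pair hΔ s d₁ d₂ h₁ h₂ =>
    refine (congrArg (Hilb.tensorMap _ _) (s.den_ket σ)).trans
      ((Hilb.tensorMap_tmul _ _ _ _).trans ?_)
    rw [h₁ (hσ.left s), h₂ (hσ.right s)]
    exact (emb_tp _ _ _ _).symm
  | inl B d ih => exact (congrArg (Hilb.inl _ _) (ih hσ)).trans (emb_inl _ _ _).symm
  | inr A d ih => exact (congrArg (Hilb.inr _ _) (ih hσ)).trans (emb_inr _ _ _).symm
  | zero =>
    refine Eq.trans ?_ (emb_bvec _ _).symm
    exact one_smul ℂ _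
  | succ d ih => exact (congrArg Hilb.succMap (ih hσ)).trans (emb_succ _).symm
  | sum d hα ht ih =>
    rw [Der.den, Tm.ev, map_sum, sum_apply]
    exact Finset.sum_congr rfl fun i _ => by
      rw [smul_apply, map_smul, ih i hσ]
  | @app Δ ω t A B u d ih =>
    rw [Der.den, ContinuousLinearMap.comp_apply, ih hσ]
    refine map_emb (denU u).toLinearMap (B.emb ∘ₗ lin (F ω)) fun b hb => ?_
    rw [LinearMap.comp_apply, lin_bvec]
    exact hden u b (Ty.mem_vecs.mp (d.ev_mem hF hσ) b hb)

theorem ExprDer.den_ket {Δ : Ctx} {e : Expr} {A : Ty} (d : ExprDer Δ e A) {σ : Var → Basis}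
    (hσ : Sat σ Δ) : ExprDer.den d (Ctx.ket Δ σ) = A.emb (exprEv σ e) :=
  Der.den_ket .of_isEmpty (fun {ω} => ω.elim) d hσ

/-- The adjoint of a pattern performs matching. Tested against the context vectors, it yields inner
products of pattern instances, and these vanish unless clause and assignment coincide. -/
theorem dagger_den_ket {A : Ty} {n : ℕ} {b : Fin n → Basis} {Δ : Fin n → Ctx}
    (db : ∀ i, ExprDer (Δ i) (b i).toTm A) (hb : Function.Injective b) (hO : OD A (Set.range b))
    (i j : Fin n) {τ : Var → Basis} (hτ : Sat τ (Δ j)) :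
    Hilb.dagger (ExprDer.den (db i)) (A.ket ((b j).inst τ)) =
      if j = i then Ctx.ket (Δ i) τ else 0 := by
  have closed : ∀ {i σ}, Sat σ (Δ i) → Closed A ((b i).inst σ) := fun {i σ} hσ => by
    have := (db i).ev_mem (F := fun u => u.elim) .of_isEmpty hσ
    rw [Tm.ev_toTm] at this
    exact Ty.mem_vecs.mp this _ (by simp [bvec_self])
  classical
  refine (Ctx.total_ket (db i).distinct).ext ?_
  rintro _ ⟨σ, hσ, rfl⟩
  rw [Hilb.inner_dagger_right, ExprDer.den_ket (db i) hσ, exprEv, Tm.ev_toTm, emb_bvec,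
    inner_ket (closed hσ) (closed hτ), ip_bvec_left, bvec_apply]
  by_cases h : j = i
  · subst h
    rw [if_pos rfl]
    have key := Ctx.inner_ket hσ hτ
    by_cases hst : ∀ x ∈ (Δ j).map Prod.fst, σ x = τ x
    · rw [key.1 hst, if_pos]
      exact Basis.inst_congr _ fun x hx => (hst x (((db j).mem_fv x).mp hx)).symm
    · rw [key.2 hst, if_neg]
      intro h
      exact hst fun x hx => ((inst_eq_inst db hb hO h).2 x (((db j).mem_fv x).mpr hx)).symm
  · rw [if_neg h, inner_zero_right, if_neg fun h' => h (inst_eq_inst db hb hO h').1]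

/-- Agreement at closed basis vectors is all that closed terms require. For an abstraction only the
matching clause survives in the sum; for an inverse both sides have the same matrix entries. -/
theorem UDer.den_ket {ω : Unitary} {A B : Ty} (u : UDer ω A B) {b : Basis} (hb : Closed A b) :
    u.den (A.ket b) = B.emb (ω.act b) := by
  induction u generalizing b with
  | @abs A B n p e Δ db de hp he ODb ODe =>
    obtain ⟨j, τ, hτ, rfl⟩ := exists_inst_eq db ODb hb
    rw [UDer.den, sum_apply, Finset.sum_eq_single j]
    · rw [ContinuousLinearMap.comp_apply, dagger_den_ket db hp ODb j j hτ, if_pos rfl,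
        ExprDer.den_ket (de j) hτ, Unitary.act, absAct_inst db de hp ODb]
    · intro i _ hij
      rw [ContinuousLinearMap.comp_apply, dagger_den_ket db hp ODb i j hτ, if_neg hij.symm,
        map_zero]
    · simp
  | @inv ω A B u ih =>
    refine (total_ket A).ext ?_
    rintro _ ⟨a, ha, rfl⟩
    have hu := u.isUnitary
    rw [UDer.den, Hilb.inner_dagger_right, ih ha, ← emb_bvec, ← emb_bvec, Unitary.act,
      inner_emb (hu.mem ha) (bvec_mem hb), inner_emb (bvec_mem ha) (hu.adj.mem hb), ip_bvec_left,
      ip_bvec_right, adj_apply (hu.finite hb)]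
  | @comp ω₂ ω₁ A B C u₁ u₂ ih₁ ih₂ =>
    rw [UDer.den, ContinuousLinearMap.comp_apply, ih₁ hb]
    refine map_emb u₂.den.toLinearMap (C.emb ∘ₗ lin ω₂.act) fun b' hb' => ?_
    rw [LinearMap.comp_apply, lin_bvec]
    exact ih₂ (Ty.mem_vecs.mp (u₁.isUnitary.mem hb) b' hb')
  | tensor u₁ u₂ ih₁ ih₂ =>
    cases hb with | pair h₁ h₂ =>
    rw [Unitary.act, tensorAct, emb_tp, ← ih₁ h₁, ← ih₂ h₂]
    exact Hilb.tensorMap_tmul _ _ _ _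
  | oplus u₁ u₂ ih₁ ih₂ =>
    cases hb with
    | inl h =>
      rw [Unitary.act, oplusAct, emb_inl, ← ih₁ h]
      exact Hilb.oplusMap_inl _ _ _
    | inr h =>
      rw [Unitary.act, oplusAct, emb_inr, ← ih₂ h]
      exact Hilb.oplusMap_inr _ _ _
  | @ctrl ω A u ih =>
    cases hb with | @pair _ _ b₁ b₂ h₁ h₂ =>
    cases h₁ with
    | inl h =>
      cases h
      rw [Unitary.act, ctrlAct, mapB_bvec, emb_bvec]
      exact Hilb.ctrlMap_inl _ _ _
    | inr h =>
      cases h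
      have : mapB (.pair (.inr .unit)) (ω.act b₂) = tp (bvec (.inr .unit)) (ω.act b₂) := by
        rw [tp, lin_bvec]
      rw [Unitary.act, ctrlAct, this, emb_tp, emb_bvec, ← ih h₂]
      exact Hilb.ctrlMap_inr _ _ _

/-! ### Denotations of closed terms -/

theorem TermDer.den_one {t : Term} {A : Ty} (d : TermDer [] t A) :
    TermDer.den d (1 : ℂ) = A.emb t.vec :=
  Der.den_ket isometricAction_act (fun u _ => u.den_ket) d (σ := Basis.var) (Sat.nil _)

theorem TermDer.den_apply {t : Term} {A : Ty} (d : TermDer [] t A) (z : ℂ) :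
    TermDer.den d z = z • A.emb t.vec :=
  (congrArg (TermDer.den d) (mul_one z).symm).trans
    (((TermDer.den d).map_smul z (1 : ℂ)).trans (congrArg (z • ·) d.den_one))

theorem TermDer.isometry_den {t : Term} {A : Ty} (d : TermDer [] t A) :
    Isometry (TermDer.den d) := by
  have h : ‖A.emb t.vec‖ = 1 := by
    have := inner_emb d.vec_mem d.vec_mem
    rw [d.ip_vec_self] at this
    have h' : ‖A.emb t.vec‖ ^ 2 = 1 := by
      rw [← inner_self_eq_norm_sq (𝕜 := ℂ), this, RCLike.one_re]
    exact (pow_eq_one_iff_of_nonneg (norm_nonneg _) two_ne_zero).mp h'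
  refine AddMonoidHomClass.isometry_of_norm _ fun (z : ℂ) => ?_
  exact (congrArg norm (d.den_apply z)).trans
    ((norm_smul z (A.emb t.vec)).trans (by rw [h, mul_one]; rfl))

theorem TermDer.den_eq_iff {t₁ t₂ : Term} {A : Ty} (d₁ : TermDer [] t₁ A) (d₂ : TermDer [] t₂ A) :
    TermDer.den d₁ = TermDer.den d₂ ↔ t₁.vec = t₂.vec := by
  constructor
  · intro h
    refine emb_injOn d₁.vec_mem d₂.vec_mem ?_
    rw [← d₁.den_one, ← d₂.den_one, h]
  · intro h
    refine ContinuousLinearMap.ext fun (z : ℂ) => ?_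
    exact (d₁.den_apply z).trans ((congrArg (fun v => z • A.emb v) h).trans
      (d₂.den_apply z).symm)

end QControl

end

theorem mainTheorem4 (A : QControl.Ty) (t₁ t₂ : QControl.Term)
    (d₁ : QControl.TermDer [] t₁ A) (d₂ : QControl.TermDer [] t₂ A) :
    Isometry (QControl.TermDer.den d₁) ∧ Isometry (QControl.TermDer.den d₂) ∧
      (QControl.Eqn [] t₁ t₂ A ↔ QControl.TermDer.den d₁ = QControl.TermDer.den d₂) := by
  exact ⟨d₁.isometry_den, d₂.isometry_den,
    (QControl.eqn_iff_vec_eq d₁ d₂).trans (d₁.den_eq_iff d₂).symm⟩
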